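/- **Conventions.** Let $\mathbf k$ be an algebraically closed field of characteristic $0$ and $H$ a cocommutative Hopf algebra over $\mathbf k$ with coproduct $\Delta(h)=h_{(1)}\otimes h_{(2)}$, counit $\varepsilon$, antipode $S$ and $H_+=\ker\varepsilon$. Tensor products without index are over $\mathbf k$; $H$ acts on $M\otimes N$ through $\Delta$, and $(H\otimes H)\otimes_H M$ is formed with the right action of $H$ on $H\otimes H$ through $\Delta$ (similarly for $H^{\otimes 3}$). $\sigma$ denotes the flip. A *Lie $H$-pseudoalgebra* is a left $H$-module $L$ with a $\mathbf k$-bilinear pseudobracket $[a*b]\in(H\otimes H)\otimes_H L$ satisfying $[fa*gb]=((f\otimes g)\otimes_H1)[a*b]$, $[b*a]=-(\sigma\otimes_H\mathrm{id})[a*b]$ and $[a*[b*c]]-((\sigma\otimes\mathrm{id})\otimes_H\mathrm{id})[b*[a*c]]=[[a*b]*c]$ in $H^{\otimes3}\otimes_HL$ (with the usual compositions of polylinear maps). A *Lie $H$-coalgebra* is an $H$-module $L$ with an $H$-linear map $\delta:L\to\wedge^2L$ such that $(I\otimes\delta)\delta-\tau_{12}(I\otimes\delta)\delta=(\delta\otimes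 I)\delta$. A *Lie pseudo-bialgebra* is an $H$-module with both structures such that $a*\delta(b)-(\sigma\otimes_H\mathrm{id})\,b*\delta(a)=\delta([a*b])$, where $a*(m\otimes n)=\sum(h\otimes1)\otimes_H(m'\otimes n)+\sum(h'\otimes1)\otimes_H(m\otimes n')$ if $[a*m]=\sum(h\otimes1)\otimes_Hm'$ and $[a*n]=\sum(h'\otimes1)\otimes_Hn'$. Its *opposite* has the same pseudobracket and cobracket $-\delta$. Homomorphisms are $H$-linear maps compatible with the pseudobrackets and cobrackets. The dual $L^*=\mathrm{Chom}(L,\mathbf k)$ consists of the $\mathbf k$-linear maps $\varphi:L\to(H\otimes H)\otimes_H\mathbf k$ with $\varphi(hv)=((1\otimes h)\otimes_H1)\varphi(v)$, with $H$-action $(h\varphi)(v)=((h\otimes1)\otimes_H1)\varphi(v)$; write $\varphi*v=\varphi(v)$. A basis $\{e_i\}$ of a free $H$-module $L$ of finite rank has the dual basis $\{e_i^*\}$ of $L^*$, $e_i^**e_j=(1\otimes1)\otimes_H\delta_{ij}$. For $r\in L\otimes L$ put $\delta_r(a)=\sum f\varepsilon(g)\,m$ if $a*r=\sum(f\otimes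 g)\otimes_Hm$. For $r=\sum_ia_i\otimes b_i$ put $$[[r,r]]=\sum_{i,j}\Big(\sum c\otimes S(h)b_j\otimes b_i-\sum a_i\otimes c'\otimes S(h')b_j-\sum a_i\otimes S(h'')a_j\otimes c''\Big),$$ where $[a_j*a_i]=\sum(h\otimes1)\otimes_Hc$, $[a_j*b_i]=\sum(h'\otimes1)\otimes_Hc'$, $[b_j*b_i]=\sum(h''\otimes1)\otimes_Hc''$. A Lie pseudo-bialgebra $(L,[\,*\,],\delta)$ is *quasitriangular* with respect to $r$ if $\delta=\delta_r$, $[[r,r]]\in H_+\cdot(L\otimes L\otimes L)$, and $\delta_{r+r_{21}}=0$. A *pseudo Manin triple* $(R,R_1,R_0)$ consists of a Lie pseudoalgebra $R$ of finite rank with a symmetric, invariant ($\langle[a*b],c\rangle=\langle a,[b*c]\rangle$) bilinear pseudo-form with values in $(H\otimes H)\otimes_H\mathbf k$ that is non-degenerate (it induces an isomorphism $R\to R^*$), and two isotropic subalgebras $R_1,R_0$ of finite rank with $R=R_0\oplus R_1$ as $H$-modules. **Theorem (pseudo Drinfeld double).** Let $L$ be a Lie pseudo-bialgebra that is free of finite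 rank as an $H$-module. 1. There is a unique Lie pseudo-bialgebra structure on $L^*$ that is dual to that of $L$, i.e. such that for every basis $\{e_i\}$ of $L$: if $[e_i*e_j]=\sum_s(h_s^{ij}\otimes l_s^{ij})\otimes_He_s$, then $\delta_{L^*}(e_s^*)=\sum_{i,j}S(h_s^{ij})e_i^*\otimes S(l_s^{ij})e_j^*$; and if $[e_i^**e_j^*]=\sum_s(f_s^{ij}\otimes g_s^{ij})\otimes_He_s^*$, then $\delta_L(e_s)=\sum_{i,j}S(f_s^{ij})e_i\otimes S(g_s^{ij})e_j$ (sums of pure tensors in the coefficients being understood). 2. There is a unique Lie pseudoalgebra structure on $L\oplus L^*$ that extends those of $L$ and $L^*$ and makes $(L\oplus L^*,L,L^*)$ a pseudo Manin triple for the pseudo-form $\langle a+f,b+g\rangle=f*b+(\sigma\otimes_H\mathrm{id})(g*a)$. 3. With this pseudobracket and the cobracket $\delta_{L\oplus L^*}=\delta_L-\delta_{L^*}$, $L\oplus L^*$ is a Lie pseudo-bialgebra, and the inclusions $L\hookrightarrow L\oplus L^*\hookleftarrow(L^*)^{\mathrm{op}}$ are homomorphisms of Lie pseudo-bialgebras.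 4. For every basis $\{e_i\}$ of $L$, this Lie pseudo-bialgebra is quasitriangular with respect to $r=\sum_ie_i\otimes e_i^*$; in particular $[[r,r]]=0$ modulo $H_+\cdot\big((L\oplus L^*)^{\otimes3}\big)$ and $\delta_{r+r_{21}}=0$. -/

import Mathlib

open scoped TensorProduct

noncomputable section

namespace PseudoBialg

universe uk uH

set_option linter.unusedSectionVars false

/-! ### Extension of scalars `A ⊗_H M` along an algebra homomorphism `φ : H → A`

`H` is not assumed commutative, so `A ⊗_H M` is built as the quotient of `A ⊗ M` by the relations
`a φ(h) ⊗ m = a ⊗ h m`.  The relevant cases are `A = H ⊗ H` with `φ = Δ` and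
`A = H ⊗ H ⊗ H` with `φ = (id ⊗ Δ) Δ`. -/

section Ext

variable {k : Type uk} [Field k] {H : Type uH} [Ring H] [Algebra k H]
variable {A : Type*} [Ring A] [Algebra k A] {B : Type*} [Ring B] [Algebra k B]

/-- The `A`-submodule generated by the `φ(h) ⊗ m - 1 ⊗ h m`, that is, the span of all
`a φ(h) ⊗ m - a ⊗ h m`. -/
def extRel (φ : H →ₐ[k] A) (M : Type*) [AddCommGroup M] [Module k M] [Module H M] :
    Submodule A (A ⊗[k] M) :=
  Submodule.span A {x | ∃ (h : H) (m : M), x = φ h ⊗ₜ[k] m - (1 : A) ⊗ₜ[k] (h • m)}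

/-- The left `A`-module `A ⊗_H M`. -/
def Ext (φ : H →ₐ[k] A) (M : Type*) [AddCommGroup M] [Module k M] [Module H M] : Type _ :=
  (A ⊗[k] M) ⧸ extRel φ M

variable (φ : H →ₐ[k] A) (M : Type*) [AddCommGroup M] [Module k M] [Module H M]

instance : AddCommGroup (Ext φ M) := inferInstanceAs (AddCommGroup ((A ⊗[k] M) ⧸ extRel φ M))
instance : Module A (Ext φ M) := inferInstanceAs (Module A ((A ⊗[k] M) ⧸ extRel φ M))
instance : Module k (Ext φ M) := inferInstanceAs (Module k ((A ⊗[k] M) ⧸ extRel φ M))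
instance : IsScalarTower k A (Ext φ M) :=
  inferInstanceAs (IsScalarTower k A ((A ⊗[k] M) ⧸ extRel φ M))
instance : SMulCommClass A k (Ext φ M) where
  smul_comm a c x := by
    rw [← algebraMap_smul A c x, ← algebraMap_smul A c (a • x), ← mul_smul, ← mul_smul,
      Algebra.commutes]

variable {M}

/-- The class `a ⊗_H m` of `a ⊗ m` in `A ⊗_H M`, as a bilinear map. -/
def Ext.mk : A →ₗ[k] M →ₗ[k] Ext φ M :=
  TensorProduct.curry ((extRel φ M).mkQ.restrictScalars k)

theorem Ext.smul_mk (a b : A) (m : M) : a • Ext.mk φ b m = Ext.mk φ (a * b) m := rfl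

theorem Ext.mk_mul (a : A) (h : H) (m : M) : Ext.mk φ (a * φ h) m = Ext.mk φ a (h • m) := by
  have h1 : Ext.mk φ (φ h) m = Ext.mk φ 1 (h • m) :=
    (Submodule.Quotient.eq (extRel φ M)).2 (Submodule.subset_span ⟨h, m, rfl⟩)
  rw [← Ext.smul_mk, h1, Ext.smul_mk, mul_one]

variable {φ}

@[elab_as_elim]
theorem Ext.induction {P : Ext φ M → Prop} (x : Ext φ M) (h0 : P 0)
    (h1 : ∀ a m, P (Ext.mk φ a m)) (h2 : ∀ x y, P x → P y → P (x + y)) : P x := by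
  obtain ⟨t, rfl⟩ := Submodule.Quotient.mk_surjective _ x
  induction t using TensorProduct.induction_on with
  | zero => exact h0
  | tmul a m => exact h1 a m
  | add s t hs ht => exact h2 _ _ hs ht

/-- A `k`-linear map on `A ⊗ M` compatible with the relations descends to `A ⊗_H M`. -/
def Ext.descend {Q : Type*} [AddCommGroup Q] [Module k Q] (F : A ⊗[k] M →ₗ[k] Q)
    (hF : ∀ (a : A) (h : H) (m : M), F ((a * φ h) ⊗ₜ m) = F (a ⊗ₜ (h • m))) :
    Ext φ M →ₗ[k] Q :=
  (((extRel φ M).restrictScalars k).liftQ F (by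
    intro x hx
    have key : ∀ x ∈ extRel φ M, ∀ a : A, F (a • x) = 0 := by
      intro x hx
      refine Submodule.span_induction ?_ ?_ ?_ ?_ hx
      · rintro _ ⟨h, m, rfl⟩ a
        rw [smul_sub, TensorProduct.smul_tmul', TensorProduct.smul_tmul', map_sub, smul_eq_mul,
          smul_eq_mul, mul_one, hF, sub_self]
      · intro a; simp
      · intro x y _ _ h1 h2 a; rw [smul_add, map_add, h1, h2, add_zero]
      · intro c x _ h1 a; rw [← mul_smul]; exact h1 _
    simpa using key x hx 1)) ∘ₗ
  (Submodule.Quotient.restrictScalarsEquiv k (extRel φ M)).symm.toLinearMap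

theorem Ext.descend_mk {Q : Type*} [AddCommGroup Q] [Module k Q] (F : A ⊗[k] M →ₗ[k] Q)
    (hF : ∀ (a : A) (h : H) (m : M), F ((a * φ h) ⊗ₜ m) = F (a ⊗ₜ (h • m))) (a : A) (m : M) :
    Ext.descend F hF (Ext.mk φ a m) = F (a ⊗ₜ m) := rfl

/-- For an algebra homomorphism `ψ : A → B`, a `B`-module `Q` and a `k`-linear map `g : M → Q` with
`g (h m) = ψ (φ h) g m`, the map `A ⊗_H M → Q`, `a ⊗_H m ↦ ψ(a) g(m)`. -/
def Ext.lift (ψ : A →ₐ[k] B) {Q : Type*} [AddCommGroup Q] [Module k Q] [Module B Q]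
    [IsScalarTower k B Q] (g : M →ₗ[k] Q) (hg : ∀ h m, g (h • m) = ψ (φ h) • g m) :
    Ext φ M →ₗ[k] Q :=
  Ext.descend
    (TensorProduct.lift (((Algebra.lsmul k k Q).toLinearMap ∘ₗ ψ.toLinearMap).compl₂ g)) (by
    intro a h m
    simp [hg])

theorem Ext.lift_mk (ψ : A →ₐ[k] B) {Q : Type*} [AddCommGroup Q] [Module k Q] [Module B Q]
    [IsScalarTower k B Q] (g : M →ₗ[k] Q) (hg : ∀ h m, g (h • m) = ψ (φ h) • g m) (a : A) (m : M) :
    Ext.lift ψ g hg (Ext.mk φ a m) = ψ a • g m := rfl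

/-- The map `A ⊗_H M → B ⊗_H N`, `a ⊗_H m ↦ ψ(a) ⊗_H f(m)`. -/
def Ext.map {φ' : H →ₐ[k] B} (ψ : A →ₐ[k] B) (hψ : ∀ h, ψ (φ h) = φ' h)
    {N : Type*} [AddCommGroup N] [Module k N] [Module H N] [IsScalarTower k H M]
    [IsScalarTower k H N] (f : M →ₗ[H] N) :
    Ext φ M →ₗ[k] Ext φ' N :=
  Ext.lift ψ (Ext.mk φ' 1 ∘ₗ f.restrictScalars k) (by
    intro h m
    simp only [LinearMap.comp_apply, LinearMap.restrictScalars_apply, map_smul]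
    rw [← Ext.mk_mul, one_mul, Ext.smul_mk, mul_one, hψ])

theorem Ext.map_mk {φ' : H →ₐ[k] B} (ψ : A →ₐ[k] B) (hψ : ∀ h, ψ (φ h) = φ' h)
    {N : Type*} [AddCommGroup N] [Module k N] [Module H N] [IsScalarTower k H M]
    [IsScalarTower k H N] (f : M →ₗ[H] N) (a : A) (m : M) :
    Ext.map ψ hψ f (Ext.mk φ a m) = Ext.mk φ' (ψ a) (f m) := by
  rw [Ext.map, Ext.lift_mk]
  simp only [LinearMap.comp_apply, LinearMap.restrictScalars_apply]
  rw [Ext.smul_mk, mul_one]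

theorem Ext.map_smul {φ' : H →ₐ[k] B} (ψ : A →ₐ[k] B) (hψ : ∀ h, ψ (φ h) = φ' h)
    {N : Type*} [AddCommGroup N] [Module k N] [Module H N] [IsScalarTower k H M]
    [IsScalarTower k H N] (f : M →ₗ[H] N) (a : A) (x : Ext φ M) :
    Ext.map ψ hψ f (a • x) = ψ a • Ext.map (φ' := φ') ψ hψ f x := by
  induction x using Ext.induction with
  | h0 => simp
  | h1 b m => rw [Ext.smul_mk, Ext.map_mk, Ext.map_mk, Ext.smul_mk, map_mul]
  | h2 x y hx hy => rw [smul_add, map_add, hx, hy, map_add, smul_add]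

end Ext

/-! ### The Hopf algebra `H` and the pseudotensor spaces `H^{⊗n} ⊗_H M` -/

section Hopf

open Coalgebra

variable (k : Type uk) [Field k] (H : Type uH) [Ring H] [HopfAlgebra k H]

/-- The comultiplication `Δ : H → H ⊗ H` as an algebra homomorphism. -/
abbrev comul2 : H →ₐ[k] H ⊗[k] H := Bialgebra.comulAlgHom k H

/-- The map `id ⊗ Δ : H ⊗ H → H ⊗ (H ⊗ H)`. -/
def idComul : H ⊗[k] H →ₐ[k] H ⊗[k] (H ⊗[k] H) :=
  Algebra.TensorProduct.map (AlgHom.id k H) (comul2 k H)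

/-- The map `Δ ⊗ id : H ⊗ H → (H ⊗ H) ⊗ H = H ⊗ (H ⊗ H)`. -/
def comulId : H ⊗[k] H →ₐ[k] H ⊗[k] (H ⊗[k] H) :=
  (Algebra.TensorProduct.assoc k k k H H H).toAlgHom.comp
    (Algebra.TensorProduct.map (comul2 k H) (AlgHom.id k H))

/-- The iterated comultiplication `(id ⊗ Δ) Δ : H → H ⊗ (H ⊗ H)`. -/
def comul3 : H →ₐ[k] H ⊗[k] (H ⊗[k] H) := (idComul k H).comp (comul2 k H)

/-- The embedding `x ↦ 1 ⊗ x` of `H ⊗ H` into `H ⊗ (H ⊗ H)`. -/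
def emb23 : H ⊗[k] H →ₐ[k] H ⊗[k] (H ⊗[k] H) := Algebra.TensorProduct.includeRight

/-- The embedding `x ↦ x ⊗ 1` of `H ⊗ H` into `H ⊗ (H ⊗ H)`. -/
def emb12 : H ⊗[k] H →ₐ[k] H ⊗[k] (H ⊗[k] H) :=
  Algebra.TensorProduct.map (AlgHom.id k H) Algebra.TensorProduct.includeLeft

/-- The flip `σ` of `H ⊗ H`. -/
def flip2 : H ⊗[k] H →ₐ[k] H ⊗[k] H := (Algebra.TensorProduct.comm k H H).toAlgHom

/-- The permutation `σ ⊗ id` of the first two factors of `H ⊗ (H ⊗ H)`. -/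
def flip12 : H ⊗[k] (H ⊗[k] H) →ₐ[k] H ⊗[k] (H ⊗[k] H) :=
  (Algebra.TensorProduct.leftComm k H H H).toAlgHom

theorem algHom_id_comul (h : H) :
    AlgHom.id k (H ⊗[k] H) (comul2 k H h) = comul2 k H h := rfl

theorem idComul_comul (h : H) : idComul k H (comul2 k H h) = comul3 k H h := rfl

theorem comulId_comul (h : H) : comulId k H (comul2 k H h) = comul3 k H h :=
  coassoc_apply (R := k) h

theorem flip2_comul [IsCocomm k H] (h : H) : flip2 k H (comul2 k H h) = comul2 k H h :=
  comm_comul k h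

theorem flip12_comul [IsCocomm k H] (h : H) : flip12 k H (comul3 k H h) = comul3 k H h := by
  have key : (flip12 k H).comp (comulId k H) = (comulId k H).comp
      (AlgHom.id k (H ⊗[k] H)) := by
    have h1 : ∀ y : H ⊗[k] H, ∀ g : H,
        flip12 k H (Algebra.TensorProduct.assoc k k k H H H (y ⊗ₜ g)) =
          Algebra.TensorProduct.assoc k k k H H H (flip2 k H y ⊗ₜ g) := by
      intro y g
      induction y using TensorProduct.induction_on with
      | zero => simp
      | tmul a b => rfl
      | add x y hx hy => simp only [TensorProduct.add_tmul, map_add, hx, hy]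
    apply Algebra.TensorProduct.ext
    · ext a
      change flip12 k H (Algebra.TensorProduct.assoc k k k H H H (comul2 k H a ⊗ₜ 1)) =
        Algebra.TensorProduct.assoc k k k H H H (comul2 k H a ⊗ₜ 1)
      rw [h1, flip2_comul]
    · ext a
      change flip12 k H (Algebra.TensorProduct.assoc k k k H H H (comul2 k H 1 ⊗ₜ a)) =
        Algebra.TensorProduct.assoc k k k H H H (comul2 k H 1 ⊗ₜ a)
      rw [h1, flip2_comul]
  rw [← comulId_comul]
  exact DFunLike.congr_fun key (comul2 k H h)

/-- `(H ⊗ H) ⊗_H M`. -/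
abbrev PT2 (M : Type*) [AddCommGroup M] [Module k M] [Module H M] := Ext (comul2 k H) M

/-- `(H ⊗ H ⊗ H) ⊗_H M`. -/
abbrev PT3 (M : Type*) [AddCommGroup M] [Module k M] [Module H M] := Ext (comul3 k H) M

/-- The trivial `H`-module `k`, with `h · c = ε(h) c`. -/
def Triv (k : Type uk) (_H : Type uH) : Type uk := k

instance : AddCommGroup (Triv k H) := inferInstanceAs (AddCommGroup k)
instance Triv.instModuleBase : Module k (Triv k H) := inferInstanceAs (Module k k)
instance : Module H (Triv k H) :=
  Module.compHom (Triv k H) (Bialgebra.counitAlgHom k H).toRingHom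

theorem Triv.smul_def (h : H) (c : Triv k H) : h • c = counit (R := k) h • c := rfl

instance : IsScalarTower k H (Triv k H) where
  smul_assoc c h x := by
    rw [Triv.smul_def, Triv.smul_def, map_smul, smul_eq_mul, mul_smul]

/-- The element `1` of the trivial module `k`. -/
def Triv.one : Triv k H := (1 : k)

variable (M N : Type*) [AddCommGroup M] [Module k M] [Module H M] [IsScalarTower k H M]
  [AddCommGroup N] [Module k N] [Module H N] [IsScalarTower k H N]

/-- The componentwise action of `H ⊗ H` on `M ⊗ N`, `(f ⊗ g) (m ⊗ n) = f m ⊗ g n`. -/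
def act2 : H ⊗[k] H →ₐ[k] Module.End k (M ⊗[k] N) :=
  Module.endTensorEndAlgHom.comp
    (Algebra.TensorProduct.map (Algebra.lsmul k k M) (Algebra.lsmul k k N))

variable {M N} in
theorem act2_tmul (f g : H) (m : M) (n : N) :
    act2 k H M N (f ⊗ₜ g) (m ⊗ₜ n) = (f • m) ⊗ₜ (g • n) := rfl

/-- The tensor product `M ⊗ N` over `k`, as an `H`-module through the comultiplication:
`h (m ⊗ n) = h₁ m ⊗ h₂ n`. -/
def DTensor (k : Type uk) [Field k] (_H : Type uH) (M N : Type*) [AddCommGroup M] [Module k M]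
    [AddCommGroup N] [Module k N] : Type _ := M ⊗[k] N

instance : AddCommGroup (DTensor k H M N) := inferInstanceAs (AddCommGroup (M ⊗[k] N))
instance DTensor.instModuleBase : Module k (DTensor k H M N) :=
  inferInstanceAs (Module k (M ⊗[k] N))
instance : Module H (DTensor k H M N) :=
  Module.compHom (M ⊗[k] N) ((act2 k H M N).comp (comul2 k H)).toRingHom

/-- The identity map from `M ⊗ N` with the diagonal `H`-action to the plain tensor product. -/
def DTensor.plain : DTensor k H M N ≃ₗ[k] M ⊗[k] N := LinearEquiv.refl k (M ⊗[k] N)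

theorem DTensor.plain_smul (h : H) (t : DTensor k H M N) :
    DTensor.plain k H M N (h • t) = act2 k H M N (comul (R := k) h) (DTensor.plain k H M N t) := rfl

instance : IsScalarTower k H (DTensor k H M N) where
  smul_assoc c h x := by
    change act2 k H M N (comul (R := k) (c • h)) x = c • act2 k H M N (comul (R := k) h) x
    rw [map_smul, map_smul]
    rfl

/-- The map `H ⊗ M → M`, `h ⊗ m ↦ h m`. -/
def smulMap : H ⊗[k] M →ₗ[k] M := TensorProduct.lift (Algebra.lsmul k k M).toLinearMap

/-! ### The Fourier transform -/

/-- The Fourier transform `f ⊗ g ↦ (f ⊗ 1) (S ⊗ id)Δ(g)` of `H ⊗ H`. -/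
def fourierHH : H ⊗[k] H →ₗ[k] H ⊗[k] H :=
  TensorProduct.lift ((LinearMap.mul k (H ⊗[k] H)).compl₁₂
    (Algebra.TensorProduct.includeLeft (R := k) (S := k) (A := H) (B := H)).toLinearMap
    (TensorProduct.map (HopfAlgebra.antipode k) LinearMap.id ∘ₗ comul))

theorem fourierHH_tmul (f g : H) : fourierHH k H (f ⊗ₜ g) =
    (f ⊗ₜ 1) * TensorProduct.map (HopfAlgebra.antipode k) LinearMap.id (comul (R := k) g) := rfl

theorem fourierHH_aux (f h : H) (y : H ⊗[k] H) (r : Repr k h (H × H)) :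
    ∑ i ∈ r.index, ((f * r.left i) ⊗ₜ[k] (1 : H)) *
      TensorProduct.map (HopfAlgebra.antipode k) LinearMap.id (y * comul (R := k) (r.right i)) =
    (f ⊗ₜ 1) * TensorProduct.map (HopfAlgebra.antipode k) LinearMap.id y * (1 ⊗ₜ h) := by
  induction y using TensorProduct.induction_on with
  | zero => simp
  | add x y hx hy =>
    simp only [add_mul, mul_add, map_add, Finset.sum_add_distrib, hx, hy]
  | tmul u v =>
    let T : H ⊗[k] (H ⊗[k] H) →ₗ[k] H ⊗[k] H :=
      TensorProduct.map (LinearMap.mulLeft k f ∘ₗ LinearMap.mulRight k (HopfAlgebra.antipode k u) ∘ₗ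
        LinearMap.mul' k H ∘ₗ (HopfAlgebra.antipode k).lTensor H) (LinearMap.mulLeft k v) ∘ₗ
        (TensorProduct.assoc k H H H).symm.toLinearMap
    have hT := congrArg T (sum_tmul_tmul_eq r (fun i => Repr.arbitrary k (r.left i))
      (fun i => Repr.arbitrary k (r.right i)))
    simp only [map_sum, T, LinearMap.comp_apply, LinearEquiv.coe_coe,
      TensorProduct.assoc_symm_tmul, TensorProduct.map_tmul, LinearMap.lTensor_tmul,
      LinearMap.mul'_apply, LinearMap.mulLeft_apply, LinearMap.mulRight_apply] at hT
    have h1 : ∀ i ∈ r.index, ((f * r.left i) ⊗ₜ[k] (1 : H)) *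
        TensorProduct.map (HopfAlgebra.antipode k) LinearMap.id
          ((u ⊗ₜ v) * comul (R := k) (r.right i)) =
        ∑ j ∈ (Repr.arbitrary k (r.right i)).index,
          (f * (r.left i * HopfAlgebra.antipode k ((Repr.arbitrary k (r.right i)).left j) *
            HopfAlgebra.antipode k u)) ⊗ₜ[k] (v * (Repr.arbitrary k (r.right i)).right j) := by
      intro i _
      conv_lhs => rw [← (Repr.arbitrary k (r.right i)).eq]
      simp only [Finset.mul_sum, map_sum, Algebra.TensorProduct.tmul_mul_tmul,
        TensorProduct.map_tmul, HopfAlgebra.antipode_mul_antidistrib, LinearMap.id_apply, one_mul,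
        mul_assoc]
    rw [Finset.sum_congr rfl h1, ← hT]
    have h2 : ∀ i ∈ r.index, ∑ j ∈ (Repr.arbitrary k (r.left i)).index,
        (f * ((Repr.arbitrary k (r.left i)).left j *
          HopfAlgebra.antipode k ((Repr.arbitrary k (r.left i)).right j) *
            HopfAlgebra.antipode k u)) ⊗ₜ[k] (v * r.right i) =
        (f * HopfAlgebra.antipode k u) ⊗ₜ[k] (v * (counit (R := k) (r.left i) • r.right i)) := by
      intro i _
      rw [← TensorProduct.sum_tmul, ← Finset.mul_sum, ← Finset.sum_mul,
        HopfAlgebra.sum_mul_antipode_eq_smul, smul_mul_assoc, one_mul, mul_smul_comm,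
        mul_smul_comm, TensorProduct.smul_tmul]
    rw [Finset.sum_congr rfl h2, ← TensorProduct.tmul_sum, ← Finset.mul_sum, sum_counit_smul]
    simp

theorem fourierHH_mul_comul (x : H ⊗[k] H) (h : H) :
    fourierHH k H (x * comul2 k H h) = fourierHH k H x * (1 ⊗ₜ h) := by
  induction x using TensorProduct.induction_on with
  | zero => simp
  | add x y hx hy => simp only [add_mul, map_add, hx, hy]
  | tmul f g =>
    rw [fourierHH_tmul, ← fourierHH_aux k H f h (comul (R := k) g) (Repr.arbitrary k h)]
    conv_lhs => rw [show comul2 k H h = comul (R := k) h from rfl, ← (Repr.arbitrary k h).eq]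
    simp only [Finset.mul_sum, map_sum, Algebra.TensorProduct.tmul_mul_tmul, fourierHH_tmul,
      Bialgebra.comul_mul]

/-- The identification `(H ⊗ H) ⊗_H M → H ⊗ M`, `(f ⊗ g) ⊗_H m ↦ f S(g₁) ⊗ g₂ m`.  It sends
`(h ⊗ 1) ⊗_H c` to `h ⊗ c`. -/
def fourier : PT2 k H M →ₗ[k] H ⊗[k] M :=
  Ext.descend ((smulMap k H M).lTensor H ∘ₗ (TensorProduct.assoc k H H M).toLinearMap ∘ₗ
    (fourierHH k H).rTensor M) (by
    intro x h m
    simp only [LinearMap.comp_apply, LinearMap.rTensor_tmul, fourierHH_mul_comul,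
      LinearEquiv.coe_coe]
    induction fourierHH k H x using TensorProduct.induction_on with
    | zero => simp
    | add x y hx hy => simp only [add_mul, TensorProduct.add_tmul, map_add, hx, hy]
    | tmul a b => simp [smulMap])

theorem fourier_mk (h : H) (m : M) : fourier k H M (Ext.mk _ (h ⊗ₜ 1) m) = h ⊗ₜ m := by
  rw [fourier, Ext.descend_mk]
  simp [fourierHH_tmul, smulMap, Algebra.TensorProduct.one_def]

end Hopf

/-! ### Polylinear maps of the pseudotensor category and their compositions -/

section PolyLin

open Coalgebra

/-- A polylinear map `M ⊠ N → P`: a `k`-bilinear map `m * n ∈ (H ⊗ H) ⊗_H P` such that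
`f m * g n = ((f ⊗ g) ⊗_H 1) (m * n)`. -/
structure PolyLin (k : Type uk) [Field k] (H : Type uH) [Ring H] [HopfAlgebra k H]
    (M N P : Type*) [AddCommGroup M] [Module k M] [Module H M] [AddCommGroup N] [Module k N]
    [Module H N] [AddCommGroup P] [Module k P] [Module H P] where
  toLin : M →ₗ[k] N →ₗ[k] PT2 k H P
  map_smul_smul : ∀ (f g : H) (m : M) (n : N),
    toLin (f • m) (g • n) = (f ⊗ₜ[k] g : H ⊗[k] H) • toLin m n

variable {k : Type uk} [Field k] {H : Type uH} [Ring H] [HopfAlgebra k H]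
variable {M N P Q L : Type*} [AddCommGroup M] [Module k M] [Module H M] [IsScalarTower k H M]
  [AddCommGroup N] [Module k N] [Module H N] [IsScalarTower k H N]
  [AddCommGroup P] [Module k P] [Module H P] [IsScalarTower k H P]
  [AddCommGroup Q] [Module k Q] [Module H Q] [IsScalarTower k H Q]
  [AddCommGroup L] [Module k L] [Module H L] [IsScalarTower k H L]

/-- The map `id ⊗_H f : (H ⊗ H) ⊗_H M → (H ⊗ H) ⊗_H N` of an `H`-linear map `f : M → N`. -/
def pt2Map (f : M →ₗ[H] N) : PT2 k H M →ₗ[k] PT2 k H N :=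
  Ext.map (φ := comul2 k H) (φ' := comul2 k H) (AlgHom.id k (H ⊗[k] H)) (algHom_id_comul k H) f

variable (M) in
/-- The flip `σ ⊗_H id` of `(H ⊗ H) ⊗_H M`. -/
def swap [IsCocomm k H] : PT2 k H M →ₗ[k] PT2 k H M :=
  Ext.map (flip2 k H) (flip2_comul k H) LinearMap.id

variable (M) in
/-- The permutation `(σ ⊗ id) ⊗_H id` of `(H ⊗ H ⊗ H) ⊗_H M`. -/
def swap12 [IsCocomm k H] : PT3 k H M →ₗ[k] PT3 k H M :=
  Ext.map (flip12 k H) (flip12_comul k H) LinearMap.id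

/-- The composition `q * y` for `y ∈ (H ⊗ H) ⊗_H M`: if `y = Σ (h ⊗ l) ⊗_H d` and
`q * d = Σ (h' ⊗ l') ⊗_H d'`, then `q * y = Σ (h' ⊗ h l'₁ ⊗ l l'₂) ⊗_H d'`. -/
def PolyLin.compRight (γ : PolyLin k H Q M P) (q : Q) : PT2 k H M →ₗ[k] PT3 k H P :=
  Ext.lift (emb23 k H)
    (Ext.map (φ' := comul3 k H) (idComul k H) (idComul_comul k H) LinearMap.id ∘ₗ γ.toLin q) (by
    intro h m
    have h1 := γ.map_smul_smul 1 h q m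
    rw [one_smul] at h1
    rw [LinearMap.comp_apply, h1, Ext.map_smul]
    rfl)

/-- The composition `y * q` for `y ∈ (H ⊗ H) ⊗_H M`: if `y = Σ (f ⊗ g) ⊗_H e` and
`e * q = Σ (f' ⊗ g') ⊗_H e'`, then `y * q = Σ (f f'₁ ⊗ g f'₂ ⊗ g') ⊗_H e'`. -/
def PolyLin.compLeft (γ : PolyLin k H M Q P) (q : Q) : PT2 k H M →ₗ[k] PT3 k H P :=
  Ext.lift (emb12 k H)
    (Ext.map (φ' := comul3 k H) (comulId k H) (comulId_comul k H) LinearMap.id ∘ₗ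
      γ.toLin.flip q) (by
    intro h m
    have h1 := γ.map_smul_smul h 1 m q
    rw [one_smul] at h1
    have h2 : ∀ y : H ⊗[k] H,
        Algebra.TensorProduct.assoc k k k H H H (y ⊗ₜ[k] (1 : H)) = emb12 k H y := by
      intro y
      induction y using TensorProduct.induction_on with
      | zero => simp
      | tmul a b => rfl
      | add x y hx hy => rw [TensorProduct.add_tmul, map_add, map_add, hx, hy]
    rw [LinearMap.comp_apply, LinearMap.flip_apply, h1, Ext.map_smul, ← h2]
    rfl)

theorem PolyLin.compRight_mk (γ : PolyLin k H Q M P) (q : Q) (x : H ⊗[k] H) (m : M) :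
    γ.compRight q (Ext.mk _ x m) = emb23 k H x •
      Ext.map (φ' := comul3 k H) (idComul k H) (idComul_comul k H) LinearMap.id (γ.toLin q m) := rfl

theorem PolyLin.compLeft_mk (γ : PolyLin k H M Q P) (q : Q) (x : H ⊗[k] H) (m : M) :
    γ.compLeft q (Ext.mk _ x m) = emb12 k H x •
      Ext.map (φ' := comul3 k H) (comulId k H) (comulId_comul k H) LinearMap.id (γ.toLin m q) :=
  rfl

variable (k H M) in
/-- The map `H ⊗ M → (H ⊗ H) ⊗_H M`, `h ⊗ m ↦ (h ⊗ 1) ⊗_H m`, inverse to `fourier`. -/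
def unfourier : H ⊗[k] M →ₗ[k] PT2 k H M :=
  TensorProduct.lift (Ext.mk (comul2 k H) ∘ₗ
    (Algebra.TensorProduct.includeLeft (R := k) (S := k) (A := H) (B := H)).toLinearMap)

/-- The action of `a ∈ L` on `M ⊗ N`, given actions of `L` on `M` and on `N`:
`a * (m ⊗ n) = Σ (h ⊗ 1) ⊗_H (m' ⊗ n) + Σ (h' ⊗ 1) ⊗_H (m ⊗ n')` if `a * m = Σ (h ⊗ 1) ⊗_H m'` and
`a * n = Σ (h' ⊗ 1) ⊗_H n'`. -/
def tensorAct (μ : PolyLin k H L M M) (ν : PolyLin k H L N N) (a : L) :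
    DTensor k H M N →ₗ[k] PT2 k H (DTensor k H M N) :=
  unfourier k H (DTensor k H M N) ∘ₗ
    ((DTensor.plain k H M N).symm.toLinearMap.lTensor H) ∘ₗ
    ((TensorProduct.assoc k H M N).toLinearMap ∘ₗ (fourier k H M ∘ₗ μ.toLin a).rTensor N +
      (TensorProduct.leftComm k M H N).toLinearMap ∘ₗ (fourier k H N ∘ₗ ν.toLin a).lTensor M) ∘ₗ
    (DTensor.plain k H M N).toLinearMap

variable (k H M) in
/-- The map `(H ⊗ H) ⊗_H M → M`, `(f ⊗ g) ⊗_H m ↦ f ε(g) m`. -/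
def idCounit : PT2 k H M →ₗ[k] M :=
  Ext.lift ((Algebra.TensorProduct.rid k k H).toAlgHom.comp
    (Algebra.TensorProduct.map (AlgHom.id k H) (Bialgebra.counitAlgHom k H))) LinearMap.id (by
    intro h m
    have h1 : Algebra.TensorProduct.rid k k H (Algebra.TensorProduct.map (AlgHom.id k H)
        (Bialgebra.counitAlgHom k H) (comul2 k H h)) = h := by
      change Algebra.TensorProduct.rid k k H ((counit (R := k)).lTensor H (comul (R := k) h)) = h
      rw [lTensor_counit_comul]
      simp
    change h • m = _ • m
    exact congrArg (· • m) h1.symm)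

end PolyLin

/-! ### Lie pseudoalgebras, Lie coalgebras and Lie pseudo-bialgebras -/

section Lie

open Coalgebra

variable (k : Type uk) [Field k] (H : Type uH) [Ring H] [HopfAlgebra k H]
variable (L : Type*) [AddCommGroup L] [Module k L] [Module H L] [IsScalarTower k H L]

/-- A Lie `H`-pseudoalgebra structure on the `H`-module `L`. -/
structure LiePseudoalgebra [IsCocomm k H] where
  /-- The pseudobracket `[a * b]`. -/
  bracket : PolyLin k H L L L
  skew : ∀ a b : L, bracket.toLin b a = - swap L (bracket.toLin a b)
  jacobi : ∀ a b c : L,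
    bracket.compRight a (bracket.toLin b c) - swap12 L (bracket.compRight b (bracket.toLin a c)) =
      bracket.compLeft c (bracket.toLin a b)

/-- A Lie `H`-coalgebra structure on the `H`-module `L`; the values of the cobracket lie in
the skew-symmetric tensors. -/
structure LieCoalgebra where
  /-- The cobracket `δ : L → L ⊗ L`, an `H`-linear map. -/
  cobracket : L →ₗ[H] DTensor k H L L
  coskew : ∀ a : L, TensorProduct.comm k L L (DTensor.plain k H L L (cobracket a)) =
    - DTensor.plain k H L L (cobracket a)
  cojacobi : ∀ a : L,
    let δ : L →ₗ[k] L ⊗[k] L := (DTensor.plain k H L L).toLinearMap ∘ₗ cobracket.restrictScalars k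
    δ.lTensor L (δ a) - TensorProduct.leftComm k L L L (δ.lTensor L (δ a)) =
      TensorProduct.assoc k L L L (δ.rTensor L (δ a))

/-- A Lie `H`-pseudo-bialgebra structure on the `H`-module `L`: a Lie pseudoalgebra and a Lie
`H`-coalgebra with `a * δ(b) - (σ ⊗_H id) (b * δ(a)) = δ([a * b])`. -/
structure LiePseudoBialgebra [IsCocomm k H] extends LiePseudoalgebra k H L, LieCoalgebra k H L where
  cocycle : ∀ a b : L,
    tensorAct bracket bracket a (cobracket b) -
        swap (DTensor k H L L) (tensorAct bracket bracket b (cobracket a)) =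
      pt2Map cobracket (bracket.toLin a b)

variable {k H L}

/-- The opposite Lie pseudo-bialgebra: same pseudobracket, opposite cobracket. -/
def LiePseudoBialgebra.op [IsCocomm k H] (B : LiePseudoBialgebra k H L) :
    LiePseudoBialgebra k H L where
  toLiePseudoalgebra := B.toLiePseudoalgebra
  cobracket := - B.cobracket
  coskew a := by
    simp only [LinearMap.neg_apply, map_neg, B.coskew a]
  cojacobi a := by
    have h := B.cojacobi a
    have e : (DTensor.plain k H L L).toLinearMap ∘ₗ (-B.cobracket).restrictScalars k =
        - ((DTensor.plain k H L L).toLinearMap ∘ₗ B.cobracket.restrictScalars k) := by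
      ext x
      simp
    dsimp only at h ⊢
    rw [e]
    simpa only [LinearMap.neg_apply, map_neg, LinearMap.lTensor_neg, LinearMap.rTensor_neg,
      neg_neg] using h
  cocycle a b := by
    have h := B.cocycle a b
    have e : pt2Map (k := k) (-B.cobracket) = - pt2Map B.cobracket := by
      ext x
      induction x using Ext.induction with
      | h0 => simp
      | h1 x m => simp [pt2Map, Ext.map_mk]
      | h2 x y hx hy => rw [map_add, map_add, hx, hy]
    rw [e]
    simp only [LinearMap.neg_apply, map_neg, ← h]
    abel

variable {L' : Type*} [AddCommGroup L'] [Module k L'] [Module H L'] [IsScalarTower k H L']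

/-- The map `f ⊗ f : L ⊗ L → L' ⊗ L'`. -/
def dtMap (f : L →ₗ[H] L') : DTensor k H L L →ₗ[k] DTensor k H L' L' :=
  (DTensor.plain k H L' L').symm.toLinearMap ∘ₗ
    TensorProduct.map (f.restrictScalars k) (f.restrictScalars k) ∘ₗ
    (DTensor.plain k H L L).toLinearMap

/-- `f` is a homomorphism of Lie pseudoalgebras: `[f(a) * f(b)] = (id ⊗_H f) [a * b]`. -/
def IsPseudoalgHom [IsCocomm k H] (P : LiePseudoalgebra k H L) (P' : LiePseudoalgebra k H L')
    (f : L →ₗ[H] L') : Prop :=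
  ∀ a b : L, P'.bracket.toLin (f a) (f b) = pt2Map f (P.bracket.toLin a b)

/-- `f` is a homomorphism of Lie pseudo-bialgebras: a homomorphism of Lie pseudoalgebras with
`δ(f(a)) = (f ⊗ f) δ(a)`. -/
def IsBialgHom [IsCocomm k H] (B : LiePseudoBialgebra k H L) (B' : LiePseudoBialgebra k H L')
    (f : L →ₗ[H] L') : Prop :=
  IsPseudoalgHom B.toLiePseudoalgebra B'.toLiePseudoalgebra f ∧
    ∀ a : L, B'.cobracket (f a) = dtMap f (B.cobracket a)

/-! ### Coboundaries, the element `[[r, r]]`, quasitriangular structures -/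

/-- The coboundary `δ_r(a) = (d(1 ⊗_H r))(a)`: if `a * r = Σ (f ⊗ g) ⊗_H m`, then
`δ_r(a) = Σ f ε(g) m`. -/
def coboundary (μ : PolyLin k H L L L) (r : DTensor k H L L) (a : L) : DTensor k H L L :=
  idCounit k H (DTensor k H L L) (tensorAct μ μ a r)

/-- The Fourier transform `[a, b] ∈ H ⊗ L` of the pseudobracket: `[a, b] = Σ h ⊗ c` if
`[a * b] = Σ (h ⊗ 1) ⊗_H c`. -/
def bracketF (μ : PolyLin k H L L L) : L →ₗ[k] L →ₗ[k] H ⊗[k] L :=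
  μ.toLin.compr₂ (fourier k H L)

variable (k H L) in
/-- `(h ⊗ c) ⊗ (x ⊗ y) ↦ c ⊗ (S(h) x ⊗ y)`. -/
def transfer : (H ⊗[k] L) ⊗[k] (L ⊗[k] L) →ₗ[k] L ⊗[k] (L ⊗[k] L) :=
  (((smulMap k H L ∘ₗ (HopfAlgebra.antipode k).rTensor L).rTensor L) ∘ₗ
      (TensorProduct.assoc k H L L).symm.toLinearMap).lTensor L ∘ₗ
    (TensorProduct.assoc k L H (L ⊗[k] L)).toLinearMap ∘ₗ
    (TensorProduct.comm k H L).toLinearMap.rTensor (L ⊗[k] L)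

theorem transfer_tmul (h : H) (c x y : L) :
    transfer k H L ((h ⊗ₜ c) ⊗ₜ (x ⊗ₜ y)) = c ⊗ₜ ((HopfAlgebra.antipode k h • x) ⊗ₜ y) := rfl

/-- First term of `[[r, r]]`: `(a_j ⊗ b_j) ⊗ (a_i ⊗ b_i) ↦ Σ c ⊗ S(h) b_j ⊗ b_i` where
`[a_j, a_i] = Σ h ⊗ c`. -/
def cyb1 (μ : PolyLin k H L L L) : (L ⊗[k] L) ⊗[k] (L ⊗[k] L) →ₗ[k] L ⊗[k] (L ⊗[k] L) :=
  transfer k H L ∘ₗ (TensorProduct.lift (bracketF μ)).rTensor (L ⊗[k] L) ∘ₗ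
    (TensorProduct.tensorTensorTensorComm k L L L L).toLinearMap

/-- Second term of `[[r, r]]`: `(a_j ⊗ b_j) ⊗ (a_i ⊗ b_i) ↦ Σ a_i ⊗ c ⊗ S(h) b_j` where
`[a_j, b_i] = Σ h ⊗ c`. -/
def cyb2 (μ : PolyLin k H L L L) : (L ⊗[k] L) ⊗[k] (L ⊗[k] L) →ₗ[k] L ⊗[k] (L ⊗[k] L) :=
  (TensorProduct.comm k (L ⊗[k] L) L).toLinearMap ∘ₗ
    (TensorProduct.assoc k L L L).symm.toLinearMap ∘ₗ
    transfer k H L ∘ₗ (TensorProduct.lift (bracketF μ)).rTensor (L ⊗[k] L) ∘ₗ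
    (TensorProduct.tensorTensorTensorComm k L L L L).toLinearMap ∘ₗ
    (TensorProduct.comm k L L).toLinearMap.lTensor (L ⊗[k] L)

/-- Third term of `[[r, r]]`: `(a_j ⊗ b_j) ⊗ (a_i ⊗ b_i) ↦ Σ a_i ⊗ S(h) a_j ⊗ c` where
`[b_j, b_i] = Σ h ⊗ c`. -/
def cyb3 (μ : PolyLin k H L L L) : (L ⊗[k] L) ⊗[k] (L ⊗[k] L) →ₗ[k] L ⊗[k] (L ⊗[k] L) :=
  (TensorProduct.assoc k L L L).toLinearMap ∘ₗ
    (TensorProduct.comm k L L).toLinearMap.rTensor L ∘ₗ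
    (TensorProduct.comm k L (L ⊗[k] L)).toLinearMap ∘ₗ
    transfer k H L ∘ₗ (TensorProduct.lift (bracketF μ)).rTensor (L ⊗[k] L) ∘ₗ
    (TensorProduct.comm k (L ⊗[k] L) (L ⊗[k] L)).toLinearMap ∘ₗ
    (TensorProduct.tensorTensorTensorComm k L L L L).toLinearMap

theorem cyb1_tmul (μ : PolyLin k H L L L) (a b a' b' : L) :
    cyb1 μ ((a ⊗ₜ b) ⊗ₜ (a' ⊗ₜ b')) = transfer k H L (bracketF μ a a' ⊗ₜ (b ⊗ₜ b')) := rfl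

theorem cyb2_tmul (μ : PolyLin k H L L L) (a b a' b' : L) (h : H) (c : L)
    (hc : bracketF μ a b' = h ⊗ₜ c) :
    cyb2 μ ((a ⊗ₜ b) ⊗ₜ (a' ⊗ₜ b')) = a' ⊗ₜ (c ⊗ₜ (HopfAlgebra.antipode k h • b)) := by
  simp [cyb2, hc, transfer_tmul]

theorem cyb3_tmul (μ : PolyLin k H L L L) (a b a' b' : L) (h : H) (c : L)
    (hc : bracketF μ b b' = h ⊗ₜ c) :
    cyb3 μ ((a ⊗ₜ b) ⊗ₜ (a' ⊗ₜ b')) = a' ⊗ₜ ((HopfAlgebra.antipode k h • a) ⊗ₜ c) := by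
  simp [cyb3, hc, transfer_tmul]

/-- The element `[[r, r]]` of `L ⊗ L ⊗ L`. -/
def cybe (μ : PolyLin k H L L L) (r : DTensor k H L L) : L ⊗[k] (L ⊗[k] L) :=
  let r' : L ⊗[k] L := DTensor.plain k H L L r
  cyb1 μ (r' ⊗ₜ r') - cyb2 μ (r' ⊗ₜ r') - cyb3 μ (r' ⊗ₜ r')

variable (k H L) in
/-- The identity map from `L ⊗ L ⊗ L` with the diagonal `H`-action to the plain tensor product. -/
def plain3 : DTensor k H L (DTensor k H L L) ≃ₗ[k] L ⊗[k] (L ⊗[k] L) :=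
  (DTensor.plain k H L (DTensor k H L L)).trans
    (TensorProduct.congr (LinearEquiv.refl k L) (DTensor.plain k H L L))

variable (k H L) in
/-- The subspace `H₊ · (L ⊗ L ⊗ L)`, where `H₊` is the kernel of the counit. -/
def augTensor3 : Submodule k (DTensor k H L (DTensor k H L L)) :=
  Submodule.span k {t | ∃ (h : H) (y : DTensor k H L (DTensor k H L L)),
    counit (R := k) h = 0 ∧ t = h • y}

/-- The flip `r ↦ r₂₁` of `L ⊗ L`. -/
def flipTensor (r : DTensor k H L L) : DTensor k H L L :=
  (DTensor.plain k H L L).symm (TensorProduct.comm k L L (DTensor.plain k H L L r))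

/-- The Lie pseudo-bialgebra `B` is quasitriangular with respect to `r ∈ L ⊗ L`. -/
structure IsQuasitriangular [IsCocomm k H] (B : LiePseudoBialgebra k H L) (r : DTensor k H L L) :
    Prop where
  isCoboundary : ∀ a : L, B.cobracket a = coboundary B.bracket r a
  cybe_mem : (plain3 k H L).symm (cybe B.bracket r) ∈ augTensor3 k H L
  invariant : ∀ a : L, coboundary B.bracket (r + flipTensor r) a = 0

end Lie

/-! ### Pseudolinear maps, the dual module, bilinear pseudo-forms, pseudo Manin triples -/

section Dual

open Coalgebra

variable (k : Type uk) [Field k] (H : Type uH) [Ring H] [HopfAlgebra k H]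
variable (V W : Type*) [AddCommGroup V] [Module k V] [Module H V] [IsScalarTower k H V]
  [AddCommGroup W] [Module k W] [Module H W] [IsScalarTower k H W]

/-- The space of `H`-pseudolinear maps: `k`-linear `φ : V → (H ⊗ H) ⊗_H W` with
`φ(h v) = ((1 ⊗ h) ⊗_H 1) φ(v)`. -/
def chomSub : Submodule k (V →ₗ[k] PT2 k H W) where
  carrier := {φ | ∀ (h : H) (v : V), φ (h • v) = ((1 : H) ⊗ₜ[k] h : H ⊗[k] H) • φ v}
  add_mem' hφ hψ h v := by simp only [LinearMap.add_apply, hφ h v, hψ h v, smul_add]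
  zero_mem' h v := by simp
  smul_mem' c φ hφ h v := by
    simp only [LinearMap.smul_apply, hφ h v]
    exact (smul_comm _ _ _).symm

/-- `Chom(V, W)`, with the `H`-action `(h φ)(v) = ((h ⊗ 1) ⊗_H 1) φ(v)`. -/
def Chom : Type _ := chomSub k H V W

instance : AddCommGroup (Chom k H V W) := inferInstanceAs (AddCommGroup (chomSub k H V W))
instance Chom.instModuleBase : Module k (Chom k H V W) :=
  inferInstanceAs (Module k (chomSub k H V W))

variable {k H V W}

/-- The underlying `k`-linear map of a pseudolinear map. -/
def Chom.toLin : Chom k H V W →ₗ[k] V →ₗ[k] PT2 k H W := (chomSub k H V W).subtype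

theorem Chom.map_smul' (φ : Chom k H V W) (h : H) (v : V) :
    φ.toLin (h • v) = ((1 : H) ⊗ₜ[k] h : H ⊗[k] H) • φ.toLin v := φ.2 h v

theorem Chom.ext {φ ψ : Chom k H V W} (h : ∀ v, φ.toLin v = ψ.toLin v) : φ = ψ :=
  Subtype.ext (LinearMap.ext h)

instance : SMul H (Chom k H V W) where
  smul h φ := ⟨Algebra.lsmul k k (PT2 k H W) ((h ⊗ₜ[k] (1 : H) : H ⊗[k] H)) ∘ₗ φ.toLin, by
    intro g v
    simp only [LinearMap.comp_apply, Algebra.lsmul_coe, Chom.map_smul', ← mul_smul,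
      Algebra.TensorProduct.tmul_mul_tmul, one_mul, mul_one]⟩

theorem Chom.smul_toLin (h : H) (φ : Chom k H V W) (v : V) :
    (h • φ).toLin v = (h ⊗ₜ[k] (1 : H) : H ⊗[k] H) • φ.toLin v := rfl

instance : Module H (Chom k H V W) where
  one_smul φ := Chom.ext fun v => by
    rw [Chom.smul_toLin, ← Algebra.TensorProduct.one_def, one_smul]
  mul_smul f g φ := Chom.ext fun v => by
    rw [Chom.smul_toLin, Chom.smul_toLin, Chom.smul_toLin, ← mul_smul,
      Algebra.TensorProduct.tmul_mul_tmul, one_mul]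
  smul_zero h := Chom.ext fun v => by
    rw [Chom.smul_toLin, map_zero, LinearMap.zero_apply, smul_zero]
  smul_add h φ ψ := Chom.ext fun v => by
    rw [Chom.smul_toLin, map_add, map_add, LinearMap.add_apply, LinearMap.add_apply, smul_add,
      Chom.smul_toLin, Chom.smul_toLin]
  add_smul f g φ := Chom.ext fun v => by
    rw [map_add, LinearMap.add_apply, Chom.smul_toLin, Chom.smul_toLin, Chom.smul_toLin,
      TensorProduct.add_tmul, add_smul]
  zero_smul φ := Chom.ext fun v => by
    rw [map_zero, LinearMap.zero_apply, Chom.smul_toLin, TensorProduct.zero_tmul, zero_smul]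

instance : IsScalarTower k H (Chom k H V W) where
  smul_assoc c h φ := Chom.ext fun v => by
    rw [Chom.smul_toLin, _root_.map_smul Chom.toLin, LinearMap.smul_apply, Chom.smul_toLin,
      ← TensorProduct.smul_tmul', smul_assoc]

variable (k H V) in
/-- The dual module `V* = Chom(V, k)`. -/
abbrev PDual : Type _ := Chom k H V (Triv k H)

/-- The dual basis: `eⁱ * (Σ h_j e_j) = (1 ⊗ h_i) ⊗_H 1`, so `eⁱ * e_j = (1 ⊗ 1) ⊗_H δ_ij`. -/
def dualBasis {n : ℕ} (e : Module.Basis (Fin n) H V) (i : Fin n) : PDual k H V :=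
  ⟨((Ext.mk (M := Triv k H) (comul2 k H)).flip (Triv.one k H)) ∘ₗ
      TensorProduct.mk k H H 1 ∘ₗ (e.coord i).restrictScalars k, by
    intro h v
    simp [Ext.smul_mk]⟩

theorem dualBasis_apply {n : ℕ} (e : Module.Basis (Fin n) H V) (i j : Fin n) :
    (dualBasis (k := k) e i).toLin (e j) =
      if i = j then Ext.mk (comul2 k H) (1 ⊗ₜ 1) (Triv.one k H) else 0 := by
  change Ext.mk (comul2 k H) (1 ⊗ₜ (e.repr (e j) i)) (Triv.one k H) = _
  rw [e.repr_self, Finsupp.single_apply]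
  by_cases h : i = j
  · rw [if_pos h, if_pos h.symm]
  · rw [if_neg h, if_neg (Ne.symm h)]
    simp

/-- A bilinear pseudo-form on `V`, with values in `(H ⊗ H) ⊗_H k`. -/
abbrev PseudoForm (k : Type uk) [Field k] (H : Type uH) [Ring H] [HopfAlgebra k H] (V : Type*)
    [AddCommGroup V] [Module k V] [Module H V] := PolyLin k H V V (Triv k H)

/-- The map `V → V*`, `v ↦ ⟨v, ·⟩`, of a bilinear pseudo-form. -/
def PseudoForm.toDual (β : PseudoForm k H V) (v : V) : PDual k H V :=
  ⟨β.toLin v, by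
    intro h w
    have h1 := β.map_smul_smul 1 h v w
    rwa [one_smul] at h1⟩

theorem swap_smul [IsCocomm k H] (f g : H) (x : PT2 k H V) :
    swap V ((f ⊗ₜ[k] g : H ⊗[k] H) • x) = (g ⊗ₜ[k] f : H ⊗[k] H) • swap V x :=
  Ext.map_smul _ _ _ _ _

/-- The bilinear pseudo-form `⟨a + f, b + g⟩ = f * b + (σ ⊗_H id) (g * a)` on `V ⊕ V*`. -/
def canonicalForm (k : Type uk) [Field k] (H : Type uH) [Ring H] [HopfAlgebra k H] (V : Type*)
    [AddCommGroup V] [Module k V] [Module H V] [IsScalarTower k H V] [IsCocomm k H] :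
    PseudoForm k H (V × PDual k H V) where
  toLin := LinearMap.mk₂ k
    (fun x y => x.2.toLin y.1 + swap (Triv k H) (y.2.toLin x.1))
    (by intro x x' y
        simp only [Prod.fst_add, Prod.snd_add, map_add, LinearMap.add_apply]
        abel)
    (by intro c x y
        simp only [Prod.smul_fst, Prod.smul_snd, map_smul, LinearMap.smul_apply, smul_add])
    (by intro x y y'
        simp only [Prod.fst_add, Prod.snd_add, map_add, LinearMap.add_apply]
        abel)
    (by intro c x y
        simp only [Prod.smul_fst, Prod.smul_snd, map_smul, LinearMap.smul_apply, smul_add])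
  map_smul_smul f g x y := by
    simp only [LinearMap.mk₂_apply, Prod.smul_fst, Prod.smul_snd, Chom.smul_toLin,
      Chom.map_smul', ← mul_smul, Algebra.TensorProduct.tmul_mul_tmul, one_mul, mul_one,
      swap_smul, smul_add]

/-- `(R, R₁, R₀)`, with the pseudo-form `β` on the Lie pseudoalgebra `R`, is a pseudo Manin
triple. -/
structure IsPseudoManinTriple [IsCocomm k H] (R : LiePseudoalgebra k H V) (β : PseudoForm k H V)
    (R₁ R₀ : Submodule H V) : Prop where
  finite : Module.Finite H V
  finite_one : Module.Finite H R₁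
  finite_zero : Module.Finite H R₀
  symm : ∀ v w : V, β.toLin v w = swap (Triv k H) (β.toLin w v)
  invariant : ∀ a b c : V,
    β.compLeft c (R.bracket.toLin a b) = β.compRight a (R.bracket.toLin b c)
  nondegenerate : Function.Bijective β.toDual
  subalgebra_one : ∀ a ∈ R₁, ∀ b ∈ R₁,
    R.bracket.toLin a b ∈ LinearMap.range (pt2Map (k := k) R₁.subtype)
  subalgebra_zero : ∀ a ∈ R₀, ∀ b ∈ R₀,
    R.bracket.toLin a b ∈ LinearMap.range (pt2Map (k := k) R₀.subtype)
  isCompl : IsCompl R₀ R₁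
  isotropic_one : ∀ a ∈ R₁, ∀ b ∈ R₁, β.toLin a b = 0
  isotropic_zero : ∀ a ∈ R₀, ∀ b ∈ R₀, β.toLin a b = 0

/-- The pseudobracket of `V` and the cobracket of `V'` have dual structure constants in the
families `e` and `e'`: if `[e_i * e_j] = Σ_s x_s^{ij} ⊗_H e_s` with `x_s^{ij} ∈ H ⊗ H`, then
`δ(e'_s) = Σ_{i,j} (S ⊗ S)(x_s^{ij}) (e'_i ⊗ e'_j)`. -/
def HasDualConstants {n : ℕ} (μ : PolyLin k H V V V) (e : Fin n → V)
    (δ : W →ₗ[H] DTensor k H W W) (e' : Fin n → W) : Prop :=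
  ∃ x : Fin n → Fin n → Fin n → H ⊗[k] H,
    (∀ i j, μ.toLin (e i) (e j) = ∑ s, Ext.mk (comul2 k H) (x i j s) (e s)) ∧
    ∀ s, DTensor.plain k H W W (δ (e' s)) = ∑ i, ∑ j,
      act2 k H W W (TensorProduct.map (HopfAlgebra.antipode k) (HopfAlgebra.antipode k) (x i j s))
        (e' i ⊗ₜ e' j)

/-- `B'` is the Lie pseudo-bialgebra structure on `V*` dual to `B`: with respect to every finite
basis of `V` and its dual basis, the cobracket of `V*` is dual to the pseudobracket of `V` and
the pseudobracket of `V*` is dual to the cobracket of `V`. -/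
def IsDualBialgebra [IsCocomm k H] (B : LiePseudoBialgebra k H V)
    (B' : LiePseudoBialgebra k H (PDual k H V)) : Prop :=
  ∀ (n : ℕ) (e : Module.Basis (Fin n) H V),
    HasDualConstants B.bracket e B'.cobracket (dualBasis (k := k) e) ∧
    HasDualConstants B'.bracket (dualBasis (k := k) e) B.cobracket e

/-- `R` is the Lie pseudoalgebra structure on `V ⊕ V*` of the pseudo Manin triple
`(V ⊕ V*, V, V*)` associated to the Lie pseudo-bialgebra `B` and its dual `B'`: the brackets of
`V` and `V*` are those of `B` and `B'`, and `(V ⊕ V*, V, V*)` with the canonical pseudo-form is a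
pseudo Manin triple. -/
structure IsAssociatedManinTriple [IsCocomm k H] (B : LiePseudoBialgebra k H V)
    (B' : LiePseudoBialgebra k H (PDual k H V)) (R : LiePseudoalgebra k H (V × PDual k H V)) :
    Prop where
  hom_inl : IsPseudoalgHom B.toLiePseudoalgebra R (LinearMap.inl H V (PDual k H V))
  hom_inr : IsPseudoalgHom B'.toLiePseudoalgebra R (LinearMap.inr H V (PDual k H V))
  isManinTriple : IsPseudoManinTriple R (canonicalForm k H V)
    (LinearMap.range (LinearMap.inl H V (PDual k H V)))
    (LinearMap.range (LinearMap.inr H V (PDual k H V)))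

/-- The element `r = Σ e_i ⊗ eⁱ` of `(V ⊕ V*) ⊗ (V ⊕ V*)`. -/
def canonicalTensor {n : ℕ} (e : Module.Basis (Fin n) H V) :
    DTensor k H (V × PDual k H V) (V × PDual k H V) :=
  (DTensor.plain k H (V × PDual k H V) (V × PDual k H V)).symm
    (∑ i, (LinearMap.inl H V (PDual k H V) (e i)) ⊗ₜ[k]
      (LinearMap.inr H V (PDual k H V) (dualBasis (k := k) e i)))

end Dual

end PseudoBialg

end

/-!
Over a basis `e_i` of `L` and the dual basis of `L*`, everything is encoded by two tables of
elements of `H ⊗ H`: the structure constants `c` of the pseudobracket of `L` (`PolyLin.table`) and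
the structure constants `f` of the pseudobracket of `L*`, which are the antipodes of the
coordinates of the cobracket of `L` (`dualTable`).  The Lie axioms for `c` and for `f` have the same
form, because the antipode intertwines the composition of cobrackets with that of pseudobrackets
(`jacobi_iff_table`, `coJacobi_iff_table`).  That the tables of two dual structures agree does not
depend on the basis: it says that the pairing of `φ` with `[a * b]` is the value of `a ⊗ b` on
`δ(φ)` (`isDualPair_iff_table`).

The double is best described by the trilinear pseudo-form `Φ(a, b, c) = ⟨a, [b * c]⟩` on `L ⊕ L*`,
with values in `H^{⊗3} ⊗_H k`, on which the symmetric group permutes the arguments.  For an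
invariant symmetric pseudo-form and a skew-symmetric pseudobracket, `Φ` is alternating.  It
vanishes when all arguments are in `L`, or all in `L*`, since these are isotropic subalgebras; and
when two arguments are in `L` it is given by `c`, when two are in `L*` by `f`.  Hence it is the
form `doubleForm c f`, which proves uniqueness (`IsAssociatedManinTriple.table_eq`), and conversely
this form defines an invariant skew-symmetric pseudobracket (`alternatingTable`).

The Jacobi identity of the double, paired with a fourth element, becomes the vanishing of the
quadrilinear form `jacobiator` (`tableJacobi_iff`), which is again alternating.  By alternation only
the distribution of the four arguments over `L` and `L*` matters.  With three arguments in `L` it is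
the Jacobi identity of `L`, with three in `L*` the co-Jacobi identity of `L`, with two in each it is
the cocycle condition of `L`, and with four in `L` or in `L*` it is trivial
(`jacobiator_eq_zero`, `IsBialgTable.jacobiator`).

For the cobracket `δ_L - δ_{L*}` the defect of the cocycle condition on the double is a multiple of
the jacobiator (`cocycleDefect_double`): the coefficient is the number of components in `L` minus
that in `L*` of the two output indices, halved.  So the double is a Lie pseudo-bialgebra, and
restricting its cocycle condition to `L*` shows that `L*` is one (`IsBialgTable.double`,
`IsBialgTable.dual`).

Finally let `r = ∑ e_i ⊗ e_i*`.  Its coboundary is `δ_L - δ_{L*}` by comparison of coordinates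
(`cobracket_eq_coboundary`).  The coboundary of `r₂₁` is the flip of that of `r`
(`plain_coboundary_flipTensor`), that is, its negative, whence the coboundary of `r + r₂₁` vanishes.
Modulo `H₊ · V^{⊗3}`, where `V = L ⊕ L*`, each of the three sums in `[[r, r]]` is the image of the
values of `Φ` under maps `realize x y z : H^{⊗3} ⊗_H k → V^{⊗3} / H₊ V^{⊗3}` indexed by the basis,
and the sums cancel by type of the arguments (`augProj_cybe`).
-/

open scoped TensorProduct

noncomputable section

namespace PseudoBialg

set_option linter.unusedSectionVars false
set_option maxSynthPendingDepth 3

/-! ### Identities in a cocommutative Hopf algebra -/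

section Cocommutative

open Coalgebra HopfAlgebra WithConv

variable {k : Type*} [Field k] {H : Type*} [Ring H] [HopfAlgebra k H]

theorem sum_counit_right_smul {h : H} {ι : Type*} (r : Repr k h ι) :
    ∑ i ∈ r.index, counit (R := k) (r.right i) • r.left i = h := by
  have h1 := congrArg (TensorProduct.rid k H) (sum_tmul_counit_eq r)
  simpa only [map_sum, TensorProduct.rid_tmul, one_smul] using h1

theorem conv_comp_algHom {A B : Type*} [Ring A] [Algebra k A] [Ring B] [Algebra k B]
    (φ : A →ₐ[k] B) (f g : H →ₗ[k] A) :
    toConv (φ.toLinearMap ∘ₗ f) * toConv (φ.toLinearMap ∘ₗ g) =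
      toConv (φ.toLinearMap ∘ₗ (toConv f * toConv g).ofConv) := by
  apply ofConv_injective
  rw [LinearMap.algHom_comp_convMul_distrib]

/-- For an algebra homomorphism `φ`, the map `φ S` is the left convolution inverse of `φ`. -/
theorem conv_antipode_left {A : Type*} [Ring A] [Algebra k A] (φ : H →ₐ[k] A) :
    toConv (φ.toLinearMap ∘ₗ antipode k) * toConv φ.toLinearMap = 1 := by
  have h1 := conv_comp_algHom φ (antipode k) (LinearMap.id : H →ₗ[k] H)
  rw [LinearMap.comp_id] at h1
  rw [h1, LinearMap.antipode_mul_id]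
  apply ofConv_injective
  ext h
  simp [LinearMap.convOne_def]

/-- For an algebra homomorphism `φ`, the map `φ S` is the right convolution inverse of `φ`. -/
theorem conv_antipode_right {A : Type*} [Ring A] [Algebra k A] (φ : H →ₐ[k] A) :
    toConv φ.toLinearMap * toConv (φ.toLinearMap ∘ₗ antipode k) = 1 := by
  have h1 := conv_comp_algHom φ (LinearMap.id : H →ₗ[k] H) (antipode k)
  rw [LinearMap.comp_id] at h1
  rw [h1, LinearMap.id_mul_antipode]
  apply ofConv_injective
  ext h
  simp [LinearMap.convOne_def]

variable (k H) in
/-- The embedding `h ↦ h ⊗ 1` of `H` into `H ⊗ H`. -/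
abbrev inc1 : H →ₐ[k] H ⊗[k] H := Algebra.TensorProduct.includeLeft

variable (k H) in
/-- The embedding `h ↦ 1 ⊗ h` of `H` into `H ⊗ H`. -/
abbrev inc2 : H →ₐ[k] H ⊗[k] H := Algebra.TensorProduct.includeRight

/-- In the convolution algebra, the comultiplication is the product of the two embeddings of `H` in
`H ⊗ H`. -/
theorem conv_inc1_inc2 :
    toConv (inc1 k H).toLinearMap * toConv (inc2 k H).toLinearMap = toConv comul := by
  apply ofConv_injective
  ext h
  change LinearMap.mul' k _ (TensorProduct.map _ _ (comul (R := k) h)) = comul h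
  have key : ∀ y : H ⊗[k] H, LinearMap.mul' k _
      (TensorProduct.map (inc1 k H).toLinearMap (inc2 k H).toLinearMap y) = y := by
    intro y
    induction y using TensorProduct.induction_on with
    | zero => simp
    | tmul a b => simp
    | add x y hx hy => rw [map_add, map_add, hx, hy]
  exact key _

/-- By cocommutativity the order of the factors does not matter. -/
theorem conv_inc2_inc1 [IsCocomm k H] :
    toConv (inc2 k H).toLinearMap * toConv (inc1 k H).toLinearMap = toConv comul := by
  apply ofConv_injective
  ext h
  change LinearMap.mul' k _ (TensorProduct.map _ _ (comul (R := k) h)) = comul h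
  have key : ∀ y : H ⊗[k] H, LinearMap.mul' k _
      (TensorProduct.map (inc2 k H).toLinearMap (inc1 k H).toLinearMap y) =
        TensorProduct.comm k H H y := by
    intro y
    induction y using TensorProduct.induction_on with
    | zero => simp
    | tmul a b => simp
    | add x y hx hy => rw [map_add, map_add, hx, hy, map_add]
  rw [key, comm_comul]

/-- `Σ (1 ⊗ S(h₁)) Δ(h₂) = h ⊗ 1`. -/
theorem sum_one_tmul_antipode_mul_comul [IsCocomm k H] {h : H} {ι : Type*} (r : Repr k h ι) :
    ∑ i ∈ r.index, ((1 : H) ⊗ₜ[k] antipode k (r.left i)) * comul (R := k) (r.right i) =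
      h ⊗ₜ 1 := by
  have h1 : toConv ((inc2 k H).toLinearMap ∘ₗ antipode k) * toConv comul =
      toConv (inc1 k H).toLinearMap := by
    rw [← conv_inc2_inc1, ← mul_assoc, conv_antipode_left, one_mul]
  have h2 := congrArg (fun f => f.ofConv h) h1
  exact (r.convMul_apply _ _).symm.trans h2

/-- `Σ (S(h₁) ⊗ 1) Δ(h₂) = 1 ⊗ h`. -/
theorem sum_antipode_tmul_one_mul_comul {h : H} {ι : Type*} (r : Repr k h ι) :
    ∑ i ∈ r.index, (antipode k (r.left i) ⊗ₜ[k] (1 : H)) * comul (R := k) (r.right i) =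
      1 ⊗ₜ h := by
  have h1 : toConv ((inc1 k H).toLinearMap ∘ₗ antipode k) * toConv comul =
      toConv (inc2 k H).toLinearMap := by
    rw [← conv_inc1_inc2, ← mul_assoc, conv_antipode_left, one_mul]
  have h2 := congrArg (fun f => f.ofConv h) h1
  exact (r.convMul_apply _ _).symm.trans h2

/-- `Δ S = (S ⊗ S) Δ` in the cocommutative case. -/
theorem comul_antipode [IsCocomm k H] (h : H) : comul (R := k) (antipode k h) =
    TensorProduct.map (antipode k) (antipode k) (comul (R := k) h) := by
  have h1 : toConv ((comul2 k H).toLinearMap ∘ₗ antipode k) =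
      toConv ((inc1 k H).toLinearMap ∘ₗ antipode k) *
        toConv ((inc2 k H).toLinearMap ∘ₗ antipode k) := by
    refine left_inv_eq_right_inv (conv_antipode_left (comul2 k H)) ?_
    have h2 : toConv (comul2 k H).toLinearMap =
        toConv (inc2 k H).toLinearMap * toConv (inc1 k H).toLinearMap := conv_inc2_inc1.symm
    rw [h2, mul_assoc, ← mul_assoc (toConv (inc1 k H).toLinearMap), conv_antipode_right, one_mul,
      conv_antipode_right]
  have h3 := congrArg (fun f => f.ofConv h) h1
  refine h3.trans ?_
  change LinearMap.mul' k _ (TensorProduct.map _ _ (comul (R := k) h)) = _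
  induction comul (R := k) h using TensorProduct.induction_on with
  | zero => simp
  | tmul a b => simp
  | add x y hx hy => rw [map_add, map_add, hx, hy, map_add]

/-- `Σ h₂ S(h₁) = ε(h)` in the cocommutative case. -/
theorem sum_right_mul_antipode_left [IsCocomm k H] {h : H} {ι : Type*} (r : Repr k h ι) :
    ∑ i ∈ r.index, r.right i * antipode k (r.left i) = counit (R := k) h • 1 := by
  have h1 := congrArg (fun y => LinearMap.mul' k H ((antipode k).lTensor H y)) (comm_comul k h)
  simp only [HopfAlgebra.mul_antipode_lTensor_comul_apply] at h1
  rw [← r.eq] at h1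
  simpa [Algebra.algebraMap_eq_smul_one] using h1

/-- `Σ S(h₂) h₁ = ε(h)` in the cocommutative case. -/
theorem sum_antipode_right_mul_left [IsCocomm k H] {h : H} {ι : Type*} (r : Repr k h ι) :
    ∑ i ∈ r.index, antipode k (r.right i) * r.left i = counit (R := k) h • 1 := by
  have h1 := congrArg (fun y => LinearMap.mul' k H ((antipode k).rTensor H y)) (comm_comul k h)
  simp only [HopfAlgebra.mul_antipode_rTensor_comul_apply] at h1
  rw [← r.eq] at h1
  simpa [Algebra.algebraMap_eq_smul_one] using h1

/-- The antipode of a cocommutative Hopf algebra is an involution. -/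
theorem antipode_antipode [IsCocomm k H] (h : H) : antipode k (antipode k h) = h := by
  have h1 : (toConv (antipode k) * toConv (antipode k ∘ₗ antipode k) : WithConv (H →ₗ[k] H)) =
      1 := by
    apply ofConv_injective
    ext h
    refine ((ℛ k h).convMul_apply (toConv (antipode k) : WithConv (H →ₗ[k] H))
      (toConv (antipode k ∘ₗ antipode k))).trans ?_
    change ∑ i ∈ (ℛ k h).index, antipode k ((ℛ k h).left i) *
      antipode k (antipode k ((ℛ k h).right i)) = _
    simp only [← HopfAlgebra.antipode_mul_antidistrib]
    rw [← map_sum, sum_antipode_right_mul_left, map_smul, antipode_one]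
    simp [LinearMap.convOne_def, Algebra.algebraMap_eq_smul_one]
  have h2 := left_inv_eq_right_inv (LinearMap.id_mul_antipode (R := k) (C := H)) h1
  exact (congrArg (fun f => f.ofConv h) h2).symm

variable (k H) in
/-- `S ⊗ S` on `H ⊗ H`. -/
abbrev antipode2 : H ⊗[k] H →ₗ[k] H ⊗[k] H := TensorProduct.map (antipode k) (antipode k)

variable (k H) in
/-- `S ⊗ S ⊗ S` on `H ⊗ H ⊗ H`. -/
abbrev antipode3 : H ⊗[k] (H ⊗[k] H) →ₗ[k] H ⊗[k] (H ⊗[k] H) :=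
  TensorProduct.map (antipode k) (antipode2 k H)

theorem map_antimul {A B : Type*} [Ring A] [Algebra k A] [Ring B] [Algebra k B]
    {f : A →ₗ[k] A} {g : B →ₗ[k] B} (hf : ∀ a b, f (a * b) = f b * f a)
    (hg : ∀ a b, g (a * b) = g b * g a) (x y : A ⊗[k] B) :
    TensorProduct.map f g (x * y) = TensorProduct.map f g y * TensorProduct.map f g x := by
  induction x using TensorProduct.induction_on with
  | zero => simp
  | add x x' hx hx' => rw [add_mul, map_add, hx, hx', map_add, mul_add]
  | tmul a b =>
    induction y using TensorProduct.induction_on with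
    | zero => simp
    | add y y' hy hy' => rw [mul_add, map_add, hy, hy', map_add, add_mul]
    | tmul a' b' => simp [hf, hg]

theorem antipode2_mul (x y : H ⊗[k] H) :
    antipode2 k H (x * y) = antipode2 k H y * antipode2 k H x :=
  map_antimul HopfAlgebra.antipode_mul_antidistrib HopfAlgebra.antipode_mul_antidistrib x y

theorem antipode3_mul (x y : H ⊗[k] (H ⊗[k] H)) :
    antipode3 k H (x * y) = antipode3 k H y * antipode3 k H x :=
  map_antimul HopfAlgebra.antipode_mul_antidistrib antipode2_mul x y

theorem antipode2_antipode2 [IsCocomm k H] (x : H ⊗[k] H) :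
    antipode2 k H (antipode2 k H x) = x := by
  induction x using TensorProduct.induction_on with
  | zero => simp
  | tmul a b => simp [antipode_antipode]
  | add x y hx hy => rw [map_add, map_add, hx, hy]

theorem antipode2_comul2 [IsCocomm k H] (h : H) :
    antipode2 k H (comul2 k H h) = comul2 k H (antipode k h) := (comul_antipode h).symm

theorem antipode3_idComul [IsCocomm k H] (x : H ⊗[k] H) :
    antipode3 k H (idComul k H x) = idComul k H (antipode2 k H x) := by
  induction x using TensorProduct.induction_on with
  | zero => simp
  | add x y hx hy => simp only [map_add, hx, hy]
  | tmul a b =>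
    change antipode k a ⊗ₜ antipode2 k H (comul2 k H b) =
      antipode k a ⊗ₜ comul2 k H (antipode k b)
    rw [antipode2_comul2]

theorem antipode3_emb23 (x : H ⊗[k] H) :
    antipode3 k H (emb23 k H x) = emb23 k H (antipode2 k H x) := by
  simp [emb23]

theorem antipode3_assoc (x : H ⊗[k] H) (h : H) :
    antipode3 k H (Algebra.TensorProduct.assoc k k k H H H (x ⊗ₜ h)) =
      Algebra.TensorProduct.assoc k k k H H H (antipode2 k H x ⊗ₜ antipode k h) := by
  induction x using TensorProduct.induction_on with
  | zero => simp
  | add x y hx hy => simp only [map_add, TensorProduct.add_tmul, hx, hy]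
  | tmul a b => rfl

theorem comulId_tmul (a b : H) : comulId k H (a ⊗ₜ b) =
    Algebra.TensorProduct.assoc k k k H H H (comul2 k H a ⊗ₜ b) := rfl

theorem emb12_eq_assoc (x : H ⊗[k] H) :
    emb12 k H x = Algebra.TensorProduct.assoc k k k H H H (x ⊗ₜ 1) := by
  induction x using TensorProduct.induction_on with
  | zero => simp
  | add x y hx hy => simp only [map_add, TensorProduct.add_tmul, hx, hy]
  | tmul a b => rfl

theorem antipode3_comulId [IsCocomm k H] (x : H ⊗[k] H) :
    antipode3 k H (comulId k H x) = comulId k H (antipode2 k H x) := by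
  induction x using TensorProduct.induction_on with
  | zero => simp
  | add x y hx hy => simp only [map_add, hx, hy]
  | tmul a b =>
    rw [comulId_tmul, antipode3_assoc, antipode2_comul2, TensorProduct.map_tmul, comulId_tmul]

theorem antipode3_emb12 (x : H ⊗[k] H) :
    antipode3 k H (emb12 k H x) = emb12 k H (antipode2 k H x) := by
  rw [emb12_eq_assoc, antipode3_assoc, emb12_eq_assoc, antipode_one]

theorem antipode3_flip12 (x : H ⊗[k] (H ⊗[k] H)) :
    antipode3 k H (flip12 k H x) = flip12 k H (antipode3 k H x) := by
  induction x using TensorProduct.induction_on with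
  | zero => simp
  | add x y hx hy => simp only [map_add, hx, hy]
  | tmul a x =>
    induction x using TensorProduct.induction_on with
    | zero => simp
    | add x y hx hy => simp only [map_add, TensorProduct.tmul_add, hx, hy]
    | tmul a b => rfl

theorem antipode2_flip2 (x : H ⊗[k] H) :
    antipode2 k H (flip2 k H x) = flip2 k H (antipode2 k H x) := by
  induction x using TensorProduct.induction_on with
  | zero => simp
  | add x y hx hy => simp only [map_add, hx, hy]
  | tmul a x => rfl

theorem flip2_flip2 (x : H ⊗[k] H) : flip2 k H (flip2 k H x) = x := by
  induction x using TensorProduct.induction_on with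
  | zero => simp
  | add x y hx hy => simp only [map_add, hx, hy]
  | tmul a x => rfl

end Cocommutative

/-! ### Coordinates in `A ⊗_H M` and the spaces `A ⊗_H k` -/

section ExtCoord

open Coalgebra HopfAlgebra

variable {k : Type*} [Field k] {H : Type*} [Ring H]

section General

variable [Algebra k H]
variable {A : Type*} [Ring A] [Algebra k A] {B : Type*} [Ring B] [Algebra k B]
  {C : Type*} [Ring C] [Algebra k C]
variable {φ : H →ₐ[k] A} {φ' : H →ₐ[k] B} {φ'' : H →ₐ[k] C}
variable {M N : Type*} [AddCommGroup M] [Module k M] [Module H M] [IsScalarTower k H M]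
  [AddCommGroup N] [Module k N] [Module H N] [IsScalarTower k H N]

variable {ι : Type*} [Fintype ι] (e : Module.Basis ι H M)

theorem basis_coord_smul_base (e : Module.Basis ι H M) (s : ι) (c : k) (m : M) :
    e.coord s (c • m) = c • e.coord s m := by
  rw [← algebraMap_smul H c m, map_smul, smul_eq_mul, Algebra.smul_def]

/-- The coordinates `A ⊗_H M → A` with respect to an `H`-basis of `M`. -/
def Ext.coef (φ : H →ₐ[k] A) (e : Module.Basis ι H M) (s : ι) : Ext φ M →ₗ[k] A :=
  Ext.descend (TensorProduct.lift ((LinearMap.mul k A).compl₂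
    (φ.toLinearMap ∘ₗ (e.coord s).restrictScalars k))) (by
    intro a h m
    simp [mul_assoc])

theorem Ext.coef_mk (s : ι) (a : A) (m : M) :
    Ext.coef φ e s (Ext.mk φ a m) = a * φ (e.repr m s) := rfl

theorem Ext.coef_smul (s : ι) (a : A) (x : Ext φ M) :
    Ext.coef φ e s (a • x) = a * Ext.coef φ e s x := by
  induction x using Ext.induction with
  | h0 => simp
  | h1 b m => rw [Ext.smul_mk, Ext.coef_mk, Ext.coef_mk, mul_assoc]
  | h2 x y hx hy => rw [smul_add, map_add, hx, hy, map_add, mul_add]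

theorem Ext.coef_mk_basis [DecidableEq ι] (s t : ι) (a : A) :
    Ext.coef φ e s (Ext.mk φ a (e t)) = if t = s then a else 0 := by
  rw [Ext.coef_mk, e.repr_self, Finsupp.single_apply]
  split_ifs <;> simp

theorem Ext.coef_sum (s : ι) (x : ι → A) :
    Ext.coef φ e s (∑ t, Ext.mk φ (x t) (e t)) = x s := by
  classical
  simp [Ext.coef_mk_basis]

theorem Ext.sum_coef (x : Ext φ M) : ∑ s, Ext.mk φ (Ext.coef φ e s x) (e s) = x := by
  induction x using Ext.induction with
  | h0 => simp
  | h1 a m =>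
    simp only [Ext.coef_mk, Ext.mk_mul]
    rw [← map_sum, e.sum_repr]
  | h2 x y hx hy =>
    simp only [map_add, LinearMap.add_apply, Finset.sum_add_distrib, hx, hy]

theorem Ext.ext_coef {x y : Ext φ M} (h : ∀ s, Ext.coef φ e s x = Ext.coef φ e s y) : x = y := by
  rw [← Ext.sum_coef e x, ← Ext.sum_coef e y]
  simp only [h]

end General

variable [HopfAlgebra k H]
variable {A : Type*} [Ring A] [Algebra k A] {B : Type*} [Ring B] [Algebra k B]
variable {φ : H →ₐ[k] A} {φ' : H →ₐ[k] B}

/-- The class of `a` in `A ⊗_H k`. -/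
def cls (φ : H →ₐ[k] A) : A →ₗ[k] Ext φ (Triv k H) := (Ext.mk φ).flip (Triv.one k H)

theorem cls_eq_mk (a : A) : cls φ a = Ext.mk φ a (Triv.one k H) := rfl

theorem smul_cls (a b : A) : a • cls φ b = cls φ (a * b) := rfl

variable (k H) in
/-- The identity map of the trivial module, as a map to the base field. -/
def Triv.val : Triv k H →ₗ[k] k := LinearMap.id

theorem Triv.val_one : Triv.val k H (Triv.one k H) = 1 := rfl

theorem Triv.eq_smul_one (c : Triv k H) : ∃ d : k, c = d • Triv.one k H :=
  ⟨Triv.val k H c, (mul_one (Triv.val k H c)).symm⟩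

theorem cls_surjective (x : Ext φ (Triv k H)) : ∃ a, cls φ a = x := by
  induction x using Ext.induction with
  | h0 => exact ⟨0, map_zero _⟩
  | h1 a c =>
    obtain ⟨d, rfl⟩ := Triv.eq_smul_one c
    exact ⟨d • a, by rw [map_smul, map_smul]; rfl⟩
  | h2 x y hx hy =>
    obtain ⟨a, rfl⟩ := hx
    obtain ⟨b, rfl⟩ := hy
    exact ⟨a + b, map_add _ _ _⟩

theorem cls_mul (a : A) (h : H) : cls φ (a * φ h) = counit (R := k) h • cls φ a := by
  rw [cls_eq_mk, Ext.mk_mul, Triv.smul_def, map_smul]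
  rfl

/-- A linear map on `A` with `F (a φ(h)) = ε(h) F(a)` descends to `A ⊗_H k`. -/
def clsLift (φ : H →ₐ[k] A) {Q : Type*} [AddCommGroup Q] [Module k Q] (F : A →ₗ[k] Q)
    (hF : ∀ a h, F (a * φ h) = counit (R := k) h • F a) : Ext φ (Triv k H) →ₗ[k] Q :=
  Ext.descend (TensorProduct.lift
    ((LinearMap.lsmul k Q).flip.compl₁₂ F (Triv.val k H))) (by
    intro a h c
    simp [hF, Triv.smul_def, smul_comm (counit (R := k) h)])

theorem clsLift_cls {Q : Type*} [AddCommGroup Q] [Module k Q] (F : A →ₗ[k] Q)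
    (hF : ∀ a h, F (a * φ h) = counit (R := k) h • F a) (a : A) :
    clsLift φ F hF (cls φ a) = F a := by
  rw [clsLift, cls_eq_mk, Ext.descend_mk]
  simp [Triv.val_one]

theorem map_cls (ψ : A →ₐ[k] B) (hψ : ∀ h, ψ (φ h) = φ' h) (a : A) :
    Ext.map (φ' := φ') ψ hψ (LinearMap.id : Triv k H →ₗ[H] Triv k H) (cls φ a) =
      cls φ' (ψ a) := Ext.map_mk _ _ _ _ _

variable {C : Type*} [Ring C] [Algebra k C] {φAB : H →ₐ[k] A ⊗[k] B}

/-- In `(A ⊗ B) ⊗_H k`, a right factor `h` of the first component moves to the second one as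
`S(h)`. -/
theorem cls_mul_tmul [IsCocomm k H]
    (hφ : ∀ h, φAB h = Algebra.TensorProduct.map φ φ' (comul2 k H h)) (a : A) (b : B) (h : H) :
    cls φAB ((a * φ h) ⊗ₜ b) = cls φAB (a ⊗ₜ (b * φ' (antipode k h))) := by
  have h1 := congrArg (fun y => cls φAB ((a ⊗ₜ b) * Algebra.TensorProduct.map φ φ' y))
    (sum_one_tmul_antipode_mul_comul (ℛ k h))
  simp only [map_sum, map_mul, Finset.mul_sum, ← mul_assoc] at h1
  have h2 : ∀ y : H, Algebra.TensorProduct.map φ φ' (comul (R := k) y) = φAB y :=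
    fun y => (hφ y).symm
  simp only [h2, cls_mul, Algebra.TensorProduct.map_tmul, map_one,
    Algebra.TensorProduct.tmul_mul_tmul, mul_one] at h1
  rw [← h1]
  simp only [← map_smul, ← TensorProduct.tmul_smul, ← mul_smul_comm]
  rw [← map_sum, ← TensorProduct.tmul_sum, ← Finset.mul_sum, ← map_sum]
  rw [← map_sum, sum_counit_right_smul]

variable {φ₁ : H →ₐ[k] H ⊗[k] A}

/-- The isomorphism `(H ⊗ A) ⊗_H k → A`, `(h ⊗ a) ⊗_H 1 ↦ a φ(S(h))`, inverse to
`a ↦ (1 ⊗ a) ⊗_H 1`. -/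
def nrm [IsCocomm k H] (φ : H →ₐ[k] A) (φ₁ : H →ₐ[k] H ⊗[k] A)
    (hφ : ∀ h, φ₁ h = Algebra.TensorProduct.map (AlgHom.id k H) φ (comul2 k H h)) :
    Ext φ₁ (Triv k H) →ₗ[k] A :=
  clsLift φ₁ (TensorProduct.lift ((LinearMap.mul k A).flip ∘ₗ (φ.toLinearMap ∘ₗ antipode k))) (by
    intro y h
    induction y using TensorProduct.induction_on with
    | zero => simp
    | add x y hx hy => rw [add_mul, map_add, hx, hy, map_add, smul_add]
    | tmul g a =>
      rw [hφ, show comul2 k H h = comul (R := k) h from rfl, ← (ℛ k h).eq]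
      simp only [map_sum, Finset.mul_sum, Algebra.TensorProduct.map_tmul,
        Algebra.TensorProduct.tmul_mul_tmul, TensorProduct.lift.tmul, LinearMap.comp_apply,
        LinearMap.flip_apply, LinearMap.mul_apply', AlgHom.toLinearMap_apply, AlgHom.coe_id, id,
        HopfAlgebra.antipode_mul_antidistrib, map_mul, mul_assoc]
      rw [← Finset.mul_sum]
      simp only [← mul_assoc]
      rw [← Finset.sum_mul]
      simp only [← map_mul]
      rw [← map_sum, sum_right_mul_antipode_left]
      simp)

theorem nrm_cls [IsCocomm k H]
    (hφ : ∀ h, φ₁ h = Algebra.TensorProduct.map (AlgHom.id k H) φ (comul2 k H h)) (h : H) (a : A) :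
    nrm φ φ₁ hφ (cls φ₁ (h ⊗ₜ a)) = a * φ (antipode k h) := by
  rw [nrm, clsLift_cls]
  rfl

theorem nrm_cls_one [IsCocomm k H]
    (hφ : ∀ h, φ₁ h = Algebra.TensorProduct.map (AlgHom.id k H) φ (comul2 k H h)) (a : A) :
    nrm φ φ₁ hφ (cls φ₁ (1 ⊗ₜ a)) = a := by
  rw [nrm_cls, antipode_one, map_one, mul_one]

theorem cls_nrm [IsCocomm k H]
    (hφ : ∀ h, φ₁ h = Algebra.TensorProduct.map (AlgHom.id k H) φ (comul2 k H h))
    (x : Ext φ₁ (Triv k H)) : cls φ₁ (1 ⊗ₜ nrm φ φ₁ hφ x) = x := by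
  obtain ⟨y, rfl⟩ := cls_surjective x
  induction y using TensorProduct.induction_on with
  | zero => simp
  | add x y hx hy => rw [map_add, map_add, TensorProduct.tmul_add, map_add, hx, hy]
  | tmul h a =>
    have h1 := cls_mul_tmul (φ := AlgHom.id k H) (φ' := φ) (φAB := φ₁) hφ 1 a h
    rw [nrm_cls, ← h1, one_mul]
    rfl

theorem nrm_injective [IsCocomm k H]
    (hφ : ∀ h, φ₁ h = Algebra.TensorProduct.map (AlgHom.id k H) φ (comul2 k H h)) :
    Function.Injective (nrm φ φ₁ hφ) := fun x y h => by
  rw [← cls_nrm hφ x, h, cls_nrm]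

/-- The map `nrm` is equivariant in both components. -/
theorem nrm_smul [IsCocomm k H]
    (hφ : ∀ h, φ₁ h = Algebra.TensorProduct.map (AlgHom.id k H) φ (comul2 k H h))
    (h : H) (a : A) (x : Ext φ₁ (Triv k H)) :
    nrm φ φ₁ hφ ((h ⊗ₜ[k] a : H ⊗[k] A) • x) = a * nrm φ φ₁ hφ x * φ (antipode k h) := by
  obtain ⟨a', rfl⟩ : ∃ a', cls φ₁ (1 ⊗ₜ a') = x := ⟨_, cls_nrm hφ x⟩
  rw [smul_cls, Algebra.TensorProduct.tmul_mul_tmul, mul_one, nrm_cls, nrm_cls_one]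

end ExtCoord

/-! ### Permutations of the factors of `H^{⊗n} ⊗_H k`, and gluing -/

section Forms

open Coalgebra HopfAlgebra

@[elab_as_elim]
theorem tensor3_induction {k A B C : Type*} [Field k] [AddCommGroup A] [Module k A]
    [AddCommGroup B] [Module k B] [AddCommGroup C] [Module k C] {P : A ⊗[k] (B ⊗[k] C) → Prop}
    (y : A ⊗[k] (B ⊗[k] C)) (zero : P 0) (tmul : ∀ a b c, P (a ⊗ₜ (b ⊗ₜ c)))
    (add : ∀ x y, P x → P y → P (x + y)) : P y := by
  induction y using TensorProduct.induction_on with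
  | zero => exact zero
  | add x y hx hy => exact add x y hx hy
  | tmul a y =>
    induction y using TensorProduct.induction_on with
    | zero => rwa [TensorProduct.tmul_zero]
    | add x y hx hy => rw [TensorProduct.tmul_add]; exact add _ _ hx hy
    | tmul b c => exact tmul a b c

@[elab_as_elim]
theorem tensor4_induction {k A B C D : Type*} [Field k] [AddCommGroup A] [Module k A]
    [AddCommGroup B] [Module k B] [AddCommGroup C] [Module k C] [AddCommGroup D] [Module k D]
    {P : A ⊗[k] (B ⊗[k] (C ⊗[k] D)) → Prop}
    (y : A ⊗[k] (B ⊗[k] (C ⊗[k] D))) (zero : P 0)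
    (tmul : ∀ a b c d, P (a ⊗ₜ (b ⊗ₜ (c ⊗ₜ d))))
    (add : ∀ x y, P x → P y → P (x + y)) : P y := by
  induction y using tensor3_induction with
  | zero => exact zero
  | add x y hx hy => exact add x y hx hy
  | tmul a b y =>
    induction y using TensorProduct.induction_on with
    | zero => rwa [TensorProduct.tmul_zero, TensorProduct.tmul_zero]
    | add x y hx hy => rw [TensorProduct.tmul_add, TensorProduct.tmul_add]; exact add _ _ hx hy
    | tmul c d => exact tmul a b c d

variable (k : Type*) [Field k] (H : Type*) [Ring H] [HopfAlgebra k H]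

/-- The permutation `id ⊗ σ` of the last two factors of `H ⊗ (H ⊗ H)`. -/
def flip23 : H ⊗[k] (H ⊗[k] H) →ₐ[k] H ⊗[k] (H ⊗[k] H) :=
  Algebra.TensorProduct.map (AlgHom.id k H) (flip2 k H)

/-- The iterated comultiplication `H → H ⊗ (H ⊗ (H ⊗ H))`. -/
def comul4 : H →ₐ[k] H ⊗[k] (H ⊗[k] (H ⊗[k] H)) :=
  (Algebra.TensorProduct.map (AlgHom.id k H) (comul3 k H)).comp (comul2 k H)

/-- The permutation of the first two factors of `H ⊗ (H ⊗ (H ⊗ H))`. -/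
def perm12 : H ⊗[k] (H ⊗[k] (H ⊗[k] H)) →ₐ[k] H ⊗[k] (H ⊗[k] (H ⊗[k] H)) :=
  (Algebra.TensorProduct.leftComm k H H (H ⊗[k] H)).toAlgHom

/-- The permutation of the second and third factor of `H ⊗ (H ⊗ (H ⊗ H))`. -/
def perm23 : H ⊗[k] (H ⊗[k] (H ⊗[k] H)) →ₐ[k] H ⊗[k] (H ⊗[k] (H ⊗[k] H)) :=
  Algebra.TensorProduct.map (AlgHom.id k H) (flip12 k H)

/-- The permutation of the last two factors of `H ⊗ (H ⊗ (H ⊗ H))`. -/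
def perm34 : H ⊗[k] (H ⊗[k] (H ⊗[k] H)) →ₐ[k] H ⊗[k] (H ⊗[k] (H ⊗[k] H)) :=
  Algebra.TensorProduct.map (AlgHom.id k H) (flip23 k H)

/-- The associativity isomorphism `(H ⊗ H) ⊗ (H ⊗ H) → H ⊗ (H ⊗ (H ⊗ H))`. -/
def assoc4 : (H ⊗[k] H) ⊗[k] (H ⊗[k] H) →ₐ[k] H ⊗[k] (H ⊗[k] (H ⊗[k] H)) :=
  (Algebra.TensorProduct.assoc k k k H H (H ⊗[k] H)).toAlgHom

/-- `(Δ ⊗ Δ) Δ`. -/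
def comul22 : H →ₐ[k] (H ⊗[k] H) ⊗[k] (H ⊗[k] H) :=
  (Algebra.TensorProduct.map (comul2 k H) (comul2 k H)).comp (comul2 k H)

/-- `H^{⊗3} ⊗_H k`, in which the trilinear pseudo-forms take their values. -/
abbrev F3 := PT3 k H (Triv k H)

/-- `H^{⊗4} ⊗_H k`, in which the quadrilinear pseudo-forms take their values. -/
abbrev F4 := Ext (comul4 k H) (Triv k H)

variable {k H}

theorem comul3_def (h : H) : comul3 k H h =
    Algebra.TensorProduct.map (AlgHom.id k H) (comul2 k H) (comul2 k H h) := rfl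

theorem comul4_def (h : H) : comul4 k H h =
    Algebra.TensorProduct.map (AlgHom.id k H) (comul3 k H) (comul2 k H h) := rfl

theorem map_id_comp_apply {A B : Type*} [Ring A] [Algebra k A] [Ring B] [Algebra k B]
    (f : A →ₐ[k] B) (g : H →ₐ[k] A) (y : H ⊗[k] H) :
    Algebra.TensorProduct.map (AlgHom.id k H) f (Algebra.TensorProduct.map (AlgHom.id k H) g y) =
      Algebra.TensorProduct.map (AlgHom.id k H) (f.comp g) y := by
  induction y using TensorProduct.induction_on with
  | zero => simp
  | add x y hx hy => simp only [map_add, hx, hy]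
  | tmul a b => rfl

theorem flip23_comul [IsCocomm k H] (h : H) : flip23 k H (comul3 k H h) = comul3 k H h := by
  have h1 : (flip2 k H).comp (comul2 k H) = comul2 k H := AlgHom.ext (flip2_comul k H)
  exact (map_id_comp_apply _ _ _).trans (by rw [h1]; rfl)

theorem perm23_comul [IsCocomm k H] (h : H) : perm23 k H (comul4 k H h) = comul4 k H h := by
  have h1 : (flip12 k H).comp (comul3 k H) = comul3 k H := AlgHom.ext (flip12_comul k H)
  exact (map_id_comp_apply _ _ _).trans (by rw [h1]; rfl)

theorem perm34_comul [IsCocomm k H] (h : H) : perm34 k H (comul4 k H h) = comul4 k H h := by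
  have h1 : (flip23 k H).comp (comul3 k H) = comul3 k H := AlgHom.ext flip23_comul
  exact (map_id_comp_apply _ _ _).trans (by rw [h1]; rfl)

theorem comul4_eq (h : H) : comul4 k H h = Algebra.TensorProduct.map (AlgHom.id k H)
    (Algebra.TensorProduct.map (AlgHom.id k H) (comul2 k H)) (comul3 k H h) :=
  (map_id_comp_apply (k := k) (H := H) _ _ _).symm

theorem perm12_comul [IsCocomm k H] (h : H) : perm12 k H (comul4 k H h) = comul4 k H h := by
  have key : ∀ y, perm12 k H (Algebra.TensorProduct.map (AlgHom.id k H)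
      (Algebra.TensorProduct.map (AlgHom.id k H) (comul2 k H)) y) =
      Algebra.TensorProduct.map (AlgHom.id k H)
      (Algebra.TensorProduct.map (AlgHom.id k H) (comul2 k H)) (flip12 k H y) := by
    intro y
    induction y using tensor3_induction with
    | zero => simp
    | add x y hx hy => simp only [map_add, hx, hy]
    | tmul a b c => rfl
  rw [comul4_eq, key, flip12_comul]

theorem assoc4_comul (h : H) : assoc4 k H (comul22 k H h) = comul4 k H h := by
  have key : ∀ y : H ⊗[k] H, assoc4 k H (Algebra.TensorProduct.map (comul2 k H) (comul2 k H) y) =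
      Algebra.TensorProduct.map (AlgHom.id k H)
      (Algebra.TensorProduct.map (AlgHom.id k H) (comul2 k H)) (comulId k H y) := by
    intro y
    induction y using TensorProduct.induction_on with
    | zero => simp
    | add x y hx hy => simp only [map_add, hx, hy]
    | tmul a b =>
      rw [comulId_tmul, Algebra.TensorProduct.map_tmul]
      induction comul2 k H a using TensorProduct.induction_on with
      | zero => simp
      | add x y hx hy => simp only [map_add, TensorProduct.add_tmul, hx, hy]
      | tmul c d => rfl
  rw [comul4_eq, ← comulId_comul, ← key]
  rfl

variable [IsCocomm k H]

variable (k H) in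
/-- The transposition of the first two arguments, on values of trilinear pseudo-forms. -/
def tau12 : F3 k H →ₗ[k] F3 k H := Ext.map (flip12 k H) (flip12_comul k H) LinearMap.id

variable (k H) in
/-- The transposition of the last two arguments, on values of trilinear pseudo-forms. -/
def tau23 : F3 k H →ₗ[k] F3 k H := Ext.map (flip23 k H) flip23_comul LinearMap.id

variable (k H) in
/-- The transposition of the first two arguments, on values of quadrilinear pseudo-forms. -/
def rho12 : F4 k H →ₗ[k] F4 k H := Ext.map (perm12 k H) perm12_comul LinearMap.id

variable (k H) in
/-- The transposition of the middle arguments, on values of quadrilinear pseudo-forms. -/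
def rho23 : F4 k H →ₗ[k] F4 k H := Ext.map (perm23 k H) perm23_comul LinearMap.id

variable (k H) in
/-- The transposition of the last two arguments, on values of quadrilinear pseudo-forms. -/
def rho34 : F4 k H →ₗ[k] F4 k H := Ext.map (perm34 k H) perm34_comul LinearMap.id

variable (k H) in
/-- The class in `H^{⊗3} ⊗_H k`. -/
abbrev cls3 : H ⊗[k] (H ⊗[k] H) →ₗ[k] F3 k H := cls (comul3 k H)

variable (k H) in
/-- The class in `H^{⊗4} ⊗_H k`. -/
abbrev cls4 : H ⊗[k] (H ⊗[k] (H ⊗[k] H)) →ₗ[k] F4 k H := cls (comul4 k H)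

theorem tau12_cls (y) : tau12 k H (cls3 k H y) = cls3 k H (flip12 k H y) := map_cls _ _ _
theorem tau23_cls (y) : tau23 k H (cls3 k H y) = cls3 k H (flip23 k H y) := map_cls _ _ _
theorem rho12_cls (y) : rho12 k H (cls4 k H y) = cls4 k H (perm12 k H y) := map_cls _ _ _
theorem rho23_cls (y) : rho23 k H (cls4 k H y) = cls4 k H (perm23 k H y) := map_cls _ _ _
theorem rho34_cls (y) : rho34 k H (cls4 k H y) = cls4 k H (perm34 k H y) := map_cls _ _ _

@[elab_as_elim]
theorem F3.induction {P : F3 k H → Prop} (x : F3 k H) (zero : P 0)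
    (tmul : ∀ a b c, P (cls3 k H (a ⊗ₜ (b ⊗ₜ c)))) (add : ∀ x y, P x → P y → P (x + y)) : P x := by
  obtain ⟨y, rfl⟩ := cls_surjective x
  induction y using tensor3_induction with
  | zero => rwa [map_zero]
  | add x y hx hy => rw [map_add]; exact add _ _ hx hy
  | tmul a b c => exact tmul a b c

@[elab_as_elim]
theorem F4.induction {P : F4 k H → Prop} (x : F4 k H) (zero : P 0)
    (tmul : ∀ a b c d, P (cls4 k H (a ⊗ₜ (b ⊗ₜ (c ⊗ₜ d)))))
    (add : ∀ x y, P x → P y → P (x + y)) : P x := by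
  obtain ⟨y, rfl⟩ := cls_surjective x
  induction y using tensor4_induction with
  | zero => rwa [map_zero]
  | add x y hx hy => rw [map_add]; exact add _ _ hx hy
  | tmul a b c d => exact tmul a b c d

theorem tau12_tau12 (x : F3 k H) : tau12 k H (tau12 k H x) = x := by
  induction x using F3.induction with
  | zero => simp
  | add x y hx hy => simp only [map_add, hx, hy]
  | tmul a b c => rw [tau12_cls, tau12_cls]; rfl

theorem tau23_tau23 (x : F3 k H) : tau23 k H (tau23 k H x) = x := by
  induction x using F3.induction with
  | zero => simp
  | add x y hx hy => simp only [map_add, hx, hy]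
  | tmul a b c => rw [tau23_cls, tau23_cls]; rfl

theorem tau_braid (x : F3 k H) : tau12 k H (tau23 k H (tau12 k H x)) =
    tau23 k H (tau12 k H (tau23 k H x)) := by
  induction x using F3.induction with
  | zero => simp
  | add x y hx hy => simp only [map_add, hx, hy]
  | tmul a b c => simp only [tau23_cls, tau12_cls]; rfl

theorem rho12_rho12 (x : F4 k H) : rho12 k H (rho12 k H x) = x := by
  induction x using F4.induction with
  | zero => simp
  | add x y hx hy => simp only [map_add, hx, hy]
  | tmul a b c d => rw [rho12_cls, rho12_cls]; rfl

theorem rho23_rho23 (x : F4 k H) : rho23 k H (rho23 k H x) = x := by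
  induction x using F4.induction with
  | zero => simp
  | add x y hx hy => simp only [map_add, hx, hy]
  | tmul a b c d => rw [rho23_cls, rho23_cls]; rfl

theorem rho34_rho34 (x : F4 k H) : rho34 k H (rho34 k H x) = x := by
  induction x using F4.induction with
  | zero => simp
  | add x y hx hy => simp only [map_add, hx, hy]
  | tmul a b c d => rw [rho34_cls, rho34_cls]; rfl

theorem rho12_rho34 (x : F4 k H) : rho12 k H (rho34 k H x) = rho34 k H (rho12 k H x) := by
  induction x using F4.induction with
  | zero => simp
  | add x y hx hy => simp only [map_add, hx, hy]
  | tmul a b c d => simp only [rho12_cls, rho34_cls]; rfl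

theorem rho_braid (x : F4 k H) : rho34 k H (rho23 k H (rho34 k H x)) =
    rho23 k H (rho34 k H (rho23 k H x)) := by
  induction x using F4.induction with
  | zero => simp
  | add x y hx hy => simp only [map_add, hx, hy]
  | tmul a b c d => simp only [rho23_cls, rho34_cls]; rfl

variable (k H) in
/-- The isomorphism `H^{⊗3} ⊗_H k → H ⊗ H` inverse to `x ↦ (1 ⊗ x) ⊗_H 1`. -/
def nrm3 : F3 k H →ₗ[k] H ⊗[k] H := nrm (comul2 k H) (comul3 k H) comul3_def

theorem nrm3_cls (h : H) (a : H ⊗[k] H) :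
    nrm3 k H (cls3 k H (h ⊗ₜ a)) = a * comul2 k H (antipode k h) := nrm_cls _ _ _

theorem nrm3_cls_one (a : H ⊗[k] H) : nrm3 k H (cls3 k H (1 ⊗ₜ a)) = a := nrm_cls_one _ _

theorem cls_nrm3 (x : F3 k H) : cls3 k H (1 ⊗ₜ nrm3 k H x) = x := cls_nrm _ _

theorem nrm3_injective : Function.Injective (nrm3 k H) := nrm_injective _

/-- The normal form `(1 ⊗ x) ⊗_H 1` is stable under the transposition of the last two arguments; for
the other transpositions it has to be restored by means of the antipode. -/
theorem nrm3_tau23 (x : F3 k H) : nrm3 k H (tau23 k H x) = flip2 k H (nrm3 k H x) := by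
  obtain ⟨w, rfl⟩ : ∃ w, cls3 k H (1 ⊗ₜ w) = x := ⟨_, cls_nrm3 x⟩
  rw [tau23_cls, nrm3_cls_one]
  exact nrm3_cls_one _

variable (k H) in
/-- The injection `H^{⊗3} → H^{⊗4} ⊗_H k`, `y ↦ (1 ⊗ y) ⊗_H 1`. -/
def nu4 : H ⊗[k] (H ⊗[k] H) →ₗ[k] F4 k H := cls4 k H ∘ₗ TensorProduct.mk k H _ 1

theorem nu4_apply (y : H ⊗[k] (H ⊗[k] H)) : nu4 k H y = cls4 k H (1 ⊗ₜ y) := rfl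

theorem nu4_injective : Function.Injective (nu4 k H) := fun x y h => by
  have h1 := congrArg (nrm (comul3 k H) (comul4 k H) comul4_def) h
  rwa [nu4_apply, nu4_apply, nrm_cls_one, nrm_cls_one] at h1

theorem nu4_flip12 (y : H ⊗[k] (H ⊗[k] H)) : nu4 k H (flip12 k H y) = rho23 k H (nu4 k H y) := by
  rw [nu4_apply, nu4_apply, rho23_cls]
  rfl

/-- Moving the first tensor factor to the others. -/
theorem nu4_mul_comul3 (y : H ⊗[k] (H ⊗[k] H)) (h : H) :
    nu4 k H (y * comul3 k H (antipode k h)) = cls4 k H (h ⊗ₜ y) := by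
  have h1 := cls_mul_tmul (φ := AlgHom.id k H) (φ' := comul3 k H) (φAB := comul4 k H)
    comul4_def 1 y h
  rw [nu4_apply, ← h1, one_mul]
  rfl

variable (k H) in
/-- The gluing `(p ⊗ q, a ⊗ b) ↦ (p ⊗ q ⊗ a ⊗ b) ⊗_H 1` of the trilinear values
`(1 ⊗ p ⊗ q) ⊗_H 1` and `(1 ⊗ a ⊗ b) ⊗_H 1` along their first arguments. -/
def glue : H ⊗[k] H →ₗ[k] H ⊗[k] H →ₗ[k] F4 k H :=
  TensorProduct.curry (cls4 k H ∘ₗ (assoc4 k H).toLinearMap)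

theorem glue_tmul (p q a b : H) :
    glue k H (p ⊗ₜ q) (a ⊗ₜ b) = cls4 k H (p ⊗ₜ (q ⊗ₜ (a ⊗ₜ b))) := rfl

@[elab_as_elim]
theorem tensor22_induction {P : H ⊗[k] H → H ⊗[k] H → Prop} (u w : H ⊗[k] H)
    (zl : ∀ w, P 0 w) (zr : ∀ u, P u 0) (tmul : ∀ p q a b, P (p ⊗ₜ q) (a ⊗ₜ b))
    (addl : ∀ u u' w, P u w → P u' w → P (u + u') w)
    (addr : ∀ u w w', P u w → P u w' → P u (w + w')) : P u w := by
  induction u using TensorProduct.induction_on with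
  | zero => exact zl w
  | add x y hx hy => exact addl _ _ _ hx hy
  | tmul p q =>
    induction w using TensorProduct.induction_on with
    | zero => exact zr _
    | add x y hx hy => exact addr _ _ _ hx hy
    | tmul a b => exact tmul p q a b

theorem glue_flip_left (u w : H ⊗[k] H) : glue k H (flip2 k H u) w = rho12 k H (glue k H u w) := by
  induction u, w using tensor22_induction with
  | zl w => simp
  | zr u => simp
  | addl u u' w h h' => simp only [map_add, LinearMap.add_apply, h, h']
  | addr u w w' h h' => simp only [map_add, h, h']
  | tmul p q a b => rw [glue_tmul, rho12_cls]; rfl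

theorem glue_flip_right (u w : H ⊗[k] H) : glue k H u (flip2 k H w) = rho34 k H (glue k H u w) := by
  induction u, w using tensor22_induction with
  | zl w => simp
  | zr u => simp
  | addl u u' w h h' => simp only [map_add, LinearMap.add_apply, h, h']
  | addr u w w' h h' => simp only [map_add, h, h']
  | tmul p q a b => rw [glue_tmul, rho34_cls]; rfl

/-- Exchanging the two glued values permutes the four arguments by two disjoint transpositions. -/
theorem glue_symm (u w : H ⊗[k] H) : glue k H w u =
    rho23 k H (rho12 k H (rho34 k H (rho23 k H (glue k H u w)))) := by
  induction u, w using tensor22_induction with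
  | zl w => simp
  | zr u => simp
  | addl u u' w h h' => simp only [map_add, LinearMap.add_apply, h, h']
  | addr u w w' h h' => simp only [map_add, LinearMap.add_apply, h, h']
  | tmul p q a b => rw [glue_tmul, glue_tmul, rho23_cls, rho34_cls, rho12_cls, rho23_cls]; rfl

/-- Gluing is balanced over `H`. -/
theorem glue_mul_comul (u w : H ⊗[k] H) (h : H) :
    glue k H (u * comul2 k H h) w = glue k H u (w * comul2 k H (antipode k h)) := by
  have h1 := cls_mul_tmul (φ := comul2 k H) (φ' := comul2 k H) (φAB := comul22 k H)
    (fun _ => rfl) u w h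
  have h2 := congrArg (Ext.map (φ' := comul4 k H) (assoc4 k H) assoc4_comul LinearMap.id) h1
  rwa [map_cls, map_cls] at h2

/-- The composition in the second argument, as a gluing. -/
theorem nu4_compRight (u w : H ⊗[k] H) :
    nu4 k H (emb23 k H u * idComul k H (nrm3 k H (tau23 k H (tau12 k H (cls3 k H (1 ⊗ₜ w)))))) =
      glue k H w u := by
  induction u, w using tensor22_induction with
  | zl w => simp
  | zr u => simp
  | addl u u' w h h' => simp only [map_add, add_mul, h, h']
  | addr u w w' h h' => simp only [map_add, TensorProduct.tmul_add, mul_add,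
      LinearMap.add_apply, h, h']
  | tmul p q b a =>
    have h1 : tau23 k H (tau12 k H (cls3 k H (1 ⊗ₜ (b ⊗ₜ a)))) = cls3 k H (b ⊗ₜ (a ⊗ₜ 1)) := by
      rw [tau12_cls, tau23_cls]; rfl
    have h2 : emb23 k H (p ⊗ₜ q) * idComul k H (a ⊗ₜ 1) = a ⊗ₜ (p ⊗ₜ q) := by
      simp [emb23, idComul]
    rw [h1, nrm3_cls, map_mul (idComul k H), ← mul_assoc, h2, idComul_comul, nu4_mul_comul3, glue_tmul]

/-- The composition in the first argument, as a gluing. -/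
theorem nu4_compLeft (u w : H ⊗[k] H) :
    nu4 k H (emb12 k H u * comulId k H (nrm3 k H (tau12 k H (cls3 k H (1 ⊗ₜ w))))) =
      rho34 k H (rho23 k H (glue k H w u)) := by
  induction u, w using tensor22_induction with
  | zl w => simp
  | zr u => simp
  | addl u u' w h h' => simp only [map_add, add_mul, h, h']
  | addr u w w' h h' => simp only [map_add, TensorProduct.tmul_add, mul_add,
      LinearMap.add_apply, h, h']
  | tmul p q b c =>
    have h1 : tau12 k H (cls3 k H (1 ⊗ₜ (b ⊗ₜ c))) = cls3 k H (b ⊗ₜ (1 ⊗ₜ c)) := by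
      rw [tau12_cls]; rfl
    have h2 : emb12 k H (p ⊗ₜ q) * comulId k H (1 ⊗ₜ c) = p ⊗ₜ (q ⊗ₜ c) := by
      rw [comulId_tmul, map_one, Algebra.TensorProduct.one_def, Algebra.TensorProduct.assoc_tmul]
      simp [emb12]
    rw [h1, nrm3_cls, map_mul (comulId k H), ← mul_assoc, h2, comulId_comul, nu4_mul_comul3, glue_tmul,
      rho23_cls, rho34_cls]
    rfl

end Forms

/-! ### Alternating trilinear pseudo-forms in coordinates -/

section Alternating

open Coalgebra HopfAlgebra

variable {k : Type*} [Field k] {H : Type*} [Ring H] [HopfAlgebra k H]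

/-- The Jacobi identity for the structure constants `x i j s ∈ H ⊗ H` of a pseudobracket
`[e_i * e_j] = Σ_s x_{ij}^s ⊗_H e_s`. -/
def TableJacobi {ι : Type*} [Fintype ι] (x : ι → ι → ι → H ⊗[k] H) : Prop :=
  ∀ a b c s, ∑ m, emb23 k H (x b c m) * idComul k H (x a m s) -
    flip12 k H (∑ m, emb23 k H (x a c m) * idComul k H (x b m s)) =
      ∑ m, emb12 k H (x a b m) * comulId k H (x m c s)

variable [IsCocomm k H] {I : Type*} [Fintype I]

/-- The coordinates `Φ a b c ∈ H^{⊗3} ⊗_H k` of an alternating trilinear pseudo-form. -/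
structure IsAlternating (Φ : I → I → I → F3 k H) : Prop where
  swap_left : ∀ a b c, Φ b a c = - tau12 k H (Φ a b c)
  swap_right : ∀ a b c, Φ a c b = - tau23 k H (Φ a b c)

theorem IsAlternating.nrm3_swap {Φ : I → I → I → F3 k H} (hΦ : IsAlternating Φ) (a b c : I) :
    nrm3 k H (Φ a c b) = - flip2 k H (nrm3 k H (Φ a b c)) := by
  rw [hΦ.swap_right, map_neg, nrm3_tau23]

/-- The gluing of an alternating trilinear pseudo-form with itself along dual bases `E_σ`,
`E_{bar σ}`. -/
def selfGlue (bar : I → I) (Φ : I → I → I → F3 k H) (a b c d : I) : F4 k H :=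
  ∑ σ, glue k H (nrm3 k H (Φ σ a b)) (nrm3 k H (Φ (bar σ) c d))

/-- The sum of the gluings over the three ways to split four arguments into two pairs.  It is
the pairing of `E_a` with the Jacobiator of `E_b, E_c, E_d`. -/
def jacobiator (bar : I → I) (Φ : I → I → I → F3 k H) (a b c d : I) : F4 k H :=
  selfGlue bar Φ a b c d - rho23 k H (selfGlue bar Φ a c b d) +
    rho34 k H (rho23 k H (selfGlue bar Φ a d b c))

variable {bar : I → I} {Φ : I → I → I → F3 k H}

theorem selfGlue_swap_left (hΦ : IsAlternating Φ) (a b c d : I) :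
    selfGlue bar Φ b a c d = - rho12 k H (selfGlue bar Φ a b c d) := by
  simp only [selfGlue, hΦ.nrm3_swap _ a b, map_neg, LinearMap.neg_apply, glue_flip_left, map_sum,
    Finset.sum_neg_distrib]

theorem selfGlue_swap_right (hΦ : IsAlternating Φ) (a b c d : I) :
    selfGlue bar Φ a b d c = - rho34 k H (selfGlue bar Φ a b c d) := by
  simp only [selfGlue, hΦ.nrm3_swap _ c d, map_neg, glue_flip_right, map_sum,
    Finset.sum_neg_distrib]

/-- The involution `bar` of the summation index exchanges the two glued values. -/
theorem selfGlue_symm (hbar : Function.Involutive bar) (a b c d : I) :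
    selfGlue bar Φ c d a b =
      rho23 k H (rho12 k H (rho34 k H (rho23 k H (selfGlue bar Φ a b c d)))) := by
  simp only [selfGlue, map_sum, ← glue_symm]
  refine Fintype.sum_equiv hbar.toPerm _ _ fun σ => ?_
  simp [hbar σ]

theorem jacobiator_swap_left (hbar : Function.Involutive bar) (hΦ : IsAlternating Φ)
    (a b c d : I) : jacobiator bar Φ b a c d = - rho12 k H (jacobiator bar Φ a b c d) := by
  have h1 := selfGlue_symm (Φ := Φ) hbar a d b c
  have h2 := selfGlue_symm (Φ := Φ) hbar a c b d
  simp only [jacobiator, selfGlue_swap_left hΦ a b, h1, h2, rho23_rho23, map_add, map_sub,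
    rho12_rho34, rho34_rho34]
  abel

theorem jacobiator_swap_mid (hΦ : IsAlternating Φ)
    (a b c d : I) : jacobiator bar Φ a c b d = - rho23 k H (jacobiator bar Φ a b c d) := by
  simp only [jacobiator, selfGlue_swap_right hΦ a d b c, rho23_rho23, map_add, map_sub,
    map_neg, rho_braid]
  abel

theorem jacobiator_swap_right (hΦ : IsAlternating Φ)
    (a b c d : I) : jacobiator bar Φ a b d c = - rho34 k H (jacobiator bar Φ a b c d) := by
  simp only [jacobiator, selfGlue_swap_right hΦ a b c d, rho34_rho34, map_add, map_sub]
  abel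

/-- The structure constants of the pseudobracket `[E_a * E_b] = Σ_g x_{ab}^g ⊗_H E_g` with
`⟨E_c, [E_a * E_b]⟩ = Φ c a b`. -/
def alternatingTable (bar : I → I) (Φ : I → I → I → F3 k H) (a b g : I) : H ⊗[k] H :=
  nrm3 k H (Φ (bar g) a b)

theorem IsAlternating.rotate (hΦ : IsAlternating Φ) (a b c : I) :
    Φ b c a = tau23 k H (tau12 k H (Φ a b c)) := by
  rw [hΦ.swap_right b a c, hΦ.swap_left a b c, map_neg, neg_neg]

/-- In the coordinates of an alternating form the Jacobi identity is the vanishing of the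
jacobiator. -/
theorem tableJacobi_iff (hΦ : IsAlternating Φ) (a b c s : I) :
    (∑ m, emb23 k H (alternatingTable bar Φ b c m) * idComul k H (alternatingTable bar Φ a m s) -
      flip12 k H (∑ m, emb23 k H (alternatingTable bar Φ a c m) *
        idComul k H (alternatingTable bar Φ b m s)) =
      ∑ m, emb12 k H (alternatingTable bar Φ a b m) * comulId k H (alternatingTable bar Φ m c s)) ↔
      jacobiator bar Φ (bar s) a b c = 0 := by
  have h1 : ∀ a b c : I, nu4 k H (∑ m, emb23 k H (alternatingTable bar Φ b c m) *
      idComul k H (alternatingTable bar Φ a m s)) = selfGlue bar Φ (bar s) a b c := by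
    intro a b c
    rw [map_sum, selfGlue]
    refine Finset.sum_congr rfl fun m _ => ?_
    rw [alternatingTable, alternatingTable, hΦ.rotate m (bar s) a, ← cls_nrm3 (Φ m (bar s) a),
      nu4_compRight, cls_nrm3]
  have h2 : nu4 k H (∑ m, emb12 k H (alternatingTable bar Φ a b m) *
      comulId k H (alternatingTable bar Φ m c s)) =
      - rho34 k H (rho23 k H (selfGlue bar Φ (bar s) c a b)) := by
    rw [map_sum, selfGlue, map_sum, map_sum, ← Finset.sum_neg_distrib]
    refine Finset.sum_congr rfl fun m _ => ?_
    rw [alternatingTable, alternatingTable, hΦ.swap_left m (bar s) c,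
      ← cls_nrm3 (Φ m (bar s) c), map_neg, map_neg, mul_neg, map_neg, nu4_compLeft, cls_nrm3]
  rw [← nu4_injective.eq_iff, map_sub, nu4_flip12, h1, h1, h2, ← sub_eq_zero, sub_neg_eq_add]
  rfl

section Double

variable {ι : Type*} [Fintype ι]

/-- An alternating form on `L ⊕ L*` vanishing on `L` and on `L*` satisfies the Jacobi identity as
soon as its jacobiator vanishes on one sample of each of the three mixed types of arguments. -/
theorem jacobiator_eq_zero {Φ : ι ⊕ ι → ι ⊕ ι → ι ⊕ ι → F3 k H} (hΦ : IsAlternating Φ)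
    (hl : ∀ a b c, Φ (.inl a) (.inl b) (.inl c) = 0)
    (hr : ∀ a b c, Φ (.inr a) (.inr b) (.inr c) = 0)
    (h1 : ∀ s a b c, jacobiator Sum.swap Φ (.inr s) (.inl a) (.inl b) (.inl c) = 0)
    (h2 : ∀ a b s t, jacobiator Sum.swap Φ (.inl a) (.inl b) (.inr s) (.inr t) = 0)
    (h3 : ∀ s a b c, jacobiator Sum.swap Φ (.inl s) (.inr a) (.inr b) (.inr c) = 0)
    (a b c d : ι ⊕ ι) : jacobiator Sum.swap Φ a b c d = 0 := by
  have h12 : ∀ a b c d, jacobiator Sum.swap Φ a b c d = 0 → jacobiator Sum.swap Φ b a c d = 0 := by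
    intro a b c d h
    rw [jacobiator_swap_left Sum.swap_swap hΦ, h, map_zero, neg_zero]
  have h23 : ∀ a b c d, jacobiator Sum.swap Φ a b c d = 0 → jacobiator Sum.swap Φ a c b d = 0 := by
    intro a b c d h
    rw [jacobiator_swap_mid hΦ, h, map_zero, neg_zero]
  have h34 : ∀ a b c d, jacobiator Sum.swap Φ a b c d = 0 → jacobiator Sum.swap Φ a b d c = 0 := by
    intro a b c d h
    rw [jacobiator_swap_right hΦ, h, map_zero, neg_zero]
  have hll : ∀ a b c d, jacobiator Sum.swap Φ (.inl a) (.inl b) (.inl c) (.inl d) = 0 := by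
    intro a b c d
    simp [jacobiator, selfGlue, hl]
  have hrr : ∀ a b c d, jacobiator Sum.swap Φ (.inr a) (.inr b) (.inr c) (.inr d) = 0 := by
    intro a b c d
    simp [jacobiator, selfGlue, hr]
  rcases a with a | a <;> rcases b with b | b <;> rcases c with c | c <;> rcases d with d | d
  · exact hll _ _ _ _
  · exact h34 _ _ _ _ (h23 _ _ _ _ (h12 _ _ _ _ (h1 _ _ _ _)))
  · exact h23 _ _ _ _ (h12 _ _ _ _ (h1 _ _ _ _))
  · exact h2 _ _ _ _
  · exact h12 _ _ _ _ (h1 _ _ _ _)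
  · exact h23 _ _ _ _ (h2 _ _ _ _)
  · exact h34 _ _ _ _ (h23 _ _ _ _ (h2 _ _ _ _))
  · exact h3 _ _ _ _
  · exact h1 _ _ _ _
  · exact h12 _ _ _ _ (h23 _ _ _ _ (h2 _ _ _ _))
  · exact h12 _ _ _ _ (h34 _ _ _ _ (h23 _ _ _ _ (h2 _ _ _ _)))
  · exact h12 _ _ _ _ (h3 _ _ _ _)
  · exact h23 _ _ _ _ (h12 _ _ _ _ (h34 _ _ _ _ (h23 _ _ _ _ (h2 _ _ _ _))))
  · exact h23 _ _ _ _ (h12 _ _ _ _ (h3 _ _ _ _))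
  · exact h34 _ _ _ _ (h23 _ _ _ _ (h12 _ _ _ _ (h3 _ _ _ _)))
  · exact hrr _ _ _ _

/-- The alternating form on `L ⊕ L*` determined by the structure constants `c` of a pseudobracket
on `L` and `f` of a pseudobracket on `L*`. -/
def doubleForm (c f : ι → ι → ι → H ⊗[k] H) : ι ⊕ ι → ι ⊕ ι → ι ⊕ ι → F3 k H
  | .inr m, .inl i, .inl j => cls3 k H (1 ⊗ₜ c i j m)
  | .inl i, .inr m, .inl j => - tau12 k H (cls3 k H (1 ⊗ₜ c i j m))
  | .inl i, .inl j, .inr m => tau23 k H (tau12 k H (cls3 k H (1 ⊗ₜ c i j m)))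
  | .inl m, .inr i, .inr j => cls3 k H (1 ⊗ₜ f i j m)
  | .inr i, .inl m, .inr j => - tau12 k H (cls3 k H (1 ⊗ₜ f i j m))
  | .inr i, .inr j, .inl m => tau23 k H (tau12 k H (cls3 k H (1 ⊗ₜ f i j m)))
  | .inl _, .inl _, .inl _ => 0
  | .inr _, .inr _, .inr _ => 0

theorem cls3_one_tmul_flip (x : H ⊗[k] H) :
    cls3 k H (1 ⊗ₜ flip2 k H x) = tau23 k H (cls3 k H (1 ⊗ₜ x)) := by
  rw [tau23_cls]
  rfl

theorem doubleForm_isAlternating {c f : ι → ι → ι → H ⊗[k] H}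
    (hc : ∀ i j m, c j i m = - flip2 k H (c i j m))
    (hf : ∀ i j m, f j i m = - flip2 k H (f i j m)) : IsAlternating (doubleForm c f) where
  swap_left a b d := by
    rcases a with a | a <;> rcases b with b | b <;> rcases d with d | d <;>
      simp only [doubleForm, map_zero, neg_zero, map_neg, neg_neg, tau12_tau12]
    · rw [hc a b, TensorProduct.tmul_neg, map_neg, map_neg, map_neg, cls3_one_tmul_flip, tau_braid]
    · rw [hf a b, TensorProduct.tmul_neg, map_neg, map_neg, map_neg, cls3_one_tmul_flip, tau_braid]
  swap_right a b d := by
    rcases a with a | a <;> rcases b with b | b <;> rcases d with d | d <;>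
      simp only [doubleForm, map_zero, neg_zero, map_neg, neg_neg, tau23_tau23]
    · rw [hf b d, TensorProduct.tmul_neg, map_neg, cls3_one_tmul_flip]
    · rw [hc b d, TensorProduct.tmul_neg, map_neg, cls3_one_tmul_flip]

end Double

end Alternating

/-! ### Polylinear maps in coordinates -/

section Coordinates

open Coalgebra HopfAlgebra

variable {k : Type*} [Field k] {H : Type*} [Ring H] [HopfAlgebra k H]
variable {M N P Q V : Type*} [AddCommGroup M] [Module k M] [Module H M] [IsScalarTower k H M]
  [AddCommGroup N] [Module k N] [Module H N] [IsScalarTower k H N]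
  [AddCommGroup P] [Module k P] [Module H P] [IsScalarTower k H P]
  [AddCommGroup Q] [Module k Q] [Module H Q] [IsScalarTower k H Q]
  [AddCommGroup V] [Module k V] [Module H V] [IsScalarTower k H V]

@[elab_as_elim]
theorem basis_induction {ι : Type*} (e : Module.Basis ι H V) {p : V → Prop} (v : V)
    (zero : p 0) (add : ∀ v w, p v → p w → p (v + w)) (smul : ∀ (h : H) v, p v → p (h • v))
    (basis : ∀ i, p (e i)) : p v := by
  have hv : v ∈ Submodule.span H (Set.range e) := by rw [e.span_eq]; trivial
  induction hv using Submodule.span_induction with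
  | mem x hx => obtain ⟨i, rfl⟩ := hx; exact basis i
  | zero => exact zero
  | add x y _ _ hx hy => exact add x y hx hy
  | smul a x _ hx => exact smul a x hx

theorem PolyLin.smul_left (γ : PolyLin k H M N P) (h : H) (m : M) (n : N) :
    γ.toLin (h • m) n = (h ⊗ₜ[k] (1 : H) : H ⊗[k] H) • γ.toLin m n := by
  have h1 := γ.map_smul_smul h 1 m n
  rwa [one_smul] at h1

theorem PolyLin.smul_right (γ : PolyLin k H M N P) (h : H) (m : M) (n : N) :
    γ.toLin m (h • n) = ((1 : H) ⊗ₜ[k] h : H ⊗[k] H) • γ.toLin m n := by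
  have h1 := γ.map_smul_smul 1 h m n
  rwa [one_smul] at h1

theorem PolyLin.ext' {γ γ' : PolyLin k H M N P} (h : ∀ m n, γ.toLin m n = γ'.toLin m n) :
    γ = γ' := by
  obtain ⟨l, hl⟩ := γ
  obtain ⟨l', hl'⟩ := γ'
  obtain rfl : l = l' := LinearMap.ext fun m => LinearMap.ext fun n => h m n
  rfl

theorem PolyLin.ext_basis {ι κ : Type*} (e : Module.Basis ι H M) (e' : Module.Basis κ H N)
    {γ γ' : PolyLin k H M N P} (h : ∀ i j, γ.toLin (e i) (e' j) = γ'.toLin (e i) (e' j)) :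
    γ = γ' := by
  refine PolyLin.ext' fun m n => ?_
  induction m using basis_induction e with
  | zero => simp
  | add v w hv hw => rw [map_add, LinearMap.add_apply, hv, hw, map_add, LinearMap.add_apply]
  | smul a v hv => rw [γ.smul_left, γ'.smul_left, hv]
  | basis i =>
    induction n using basis_induction e' with
    | zero => simp
    | add v w hv hw => rw [map_add, hv, hw, map_add]
    | smul a v hv => rw [γ.smul_right, γ'.smul_right, hv]
    | basis j => exact h i j

/-- The polylinear map with given values on bases. -/
def PolyLin.ofBasis {ι κ : Type*} [Fintype ι] [Fintype κ] (e : Module.Basis ι H M)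
    (e' : Module.Basis κ H N) (y : ι → κ → PT2 k H P) : PolyLin k H M N P where
  toLin := ∑ i, ∑ j, LinearMap.mk₂ k
    (fun m n => ((e.repr m i) ⊗ₜ[k] (e'.repr n j) : H ⊗[k] H) • y i j)
    (fun m m' n => by simp [TensorProduct.add_tmul, add_smul])
    (fun c m n => by
      have h1 := basis_coord_smul_base (k := k) e i c m
      rw [e.coord_apply, e.coord_apply] at h1
      rw [h1, ← TensorProduct.smul_tmul', smul_assoc])
    (fun m n n' => by simp [TensorProduct.tmul_add, add_smul])
    (fun c m n => by
      have h1 := basis_coord_smul_base (k := k) e' j c n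
      rw [e'.coord_apply, e'.coord_apply] at h1
      rw [h1, TensorProduct.tmul_smul, smul_assoc])
  map_smul_smul f g m n := by
    simp only [LinearMap.sum_apply, LinearMap.mk₂_apply, map_smul, Finsupp.smul_apply,
      smul_eq_mul, ← Algebra.TensorProduct.tmul_mul_tmul, mul_smul, Finset.smul_sum]

theorem PolyLin.ofBasis_apply {ι κ : Type*} [Fintype ι] [Fintype κ] (e : Module.Basis ι H M)
    (e' : Module.Basis κ H N) (y : ι → κ → PT2 k H P) (i : ι) (j : κ) :
    (PolyLin.ofBasis e e' y).toLin (e i) (e' j) = y i j := by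
  classical
  simp only [PolyLin.ofBasis, LinearMap.sum_apply, LinearMap.mk₂_apply, Module.Basis.repr_self]
  rw [Finset.sum_eq_single i, Finset.sum_eq_single j]
  · simp [← Algebra.TensorProduct.one_def]
  · intro j' _ hj'
    simp [Ne.symm hj']
  · simp
  · intro i' _ hi'
    simp [Finsupp.single_apply, Ne.symm hi']
  · simp

theorem PolyLin.compRight_smul (γ : PolyLin k H Q M P) (q : Q) (x : H ⊗[k] H) (y : PT2 k H M) :
    γ.compRight q (x • y) = emb23 k H x • γ.compRight q y := by
  induction y using Ext.induction with
  | h0 => simp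
  | h1 a m => rw [Ext.smul_mk, PolyLin.compRight_mk, PolyLin.compRight_mk, map_mul, mul_smul]
  | h2 x y hx hy => rw [smul_add, map_add, hx, hy, map_add, smul_add]

theorem PolyLin.compRight_smul_left (γ : PolyLin k H Q M P) (h : H) (q : Q) (y : PT2 k H M) :
    γ.compRight (h • q) y =
      (h ⊗ₜ[k] (1 : H ⊗[k] H) : H ⊗[k] (H ⊗[k] H)) • γ.compRight q y := by
  induction y using Ext.induction with
  | h0 => simp
  | h1 a m =>
    rw [PolyLin.compRight_mk, PolyLin.compRight_mk, γ.smul_left, Ext.map_smul, ← mul_smul,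
      ← mul_smul]
    congr 1
    simp [emb23, idComul]
  | h2 x y hx hy => rw [map_add, hx, hy, map_add, smul_add]

theorem PolyLin.compRight_add_left (γ : PolyLin k H Q M P) (q q' : Q) (y : PT2 k H M) :
    γ.compRight (q + q') y = γ.compRight q y + γ.compRight q' y := by
  induction y using Ext.induction with
  | h0 => simp
  | h1 a m => simp only [PolyLin.compRight_mk, map_add, LinearMap.add_apply, smul_add]
  | h2 x y hx hy => rw [map_add, hx, hy, map_add, map_add]; abel

theorem PolyLin.compRight_zero_left (γ : PolyLin k H Q M P) (y : PT2 k H M) :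
    γ.compRight 0 y = 0 := by
  have h := γ.compRight_add_left 0 0 y
  rw [add_zero] at h
  exact left_eq_add.mp h

theorem PolyLin.compLeft_smul (γ : PolyLin k H M Q P) (q : Q) (x : H ⊗[k] H) (y : PT2 k H M) :
    γ.compLeft q (x • y) = emb12 k H x • γ.compLeft q y := by
  induction y using Ext.induction with
  | h0 => simp
  | h1 a m => rw [Ext.smul_mk, PolyLin.compLeft_mk, PolyLin.compLeft_mk, map_mul, mul_smul]
  | h2 x y hx hy => rw [smul_add, map_add, hx, hy, map_add, smul_add]

theorem comulId_one_tmul (h : H) :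
    comulId k H ((1 : H) ⊗ₜ h) = (1 : H) ⊗ₜ[k] ((1 : H) ⊗ₜ[k] h) := by
  rw [comulId_tmul, map_one, Algebra.TensorProduct.one_def, Algebra.TensorProduct.assoc_tmul]

theorem PolyLin.compLeft_smul_left (γ : PolyLin k H M Q P) (h : H) (q : Q) (y : PT2 k H M) :
    γ.compLeft (h • q) y =
      ((1 : H) ⊗ₜ[k] ((1 : H) ⊗ₜ[k] h) : H ⊗[k] (H ⊗[k] H)) • γ.compLeft q y := by
  induction y using Ext.induction with
  | h0 => simp
  | h1 a m =>
    rw [PolyLin.compLeft_mk, PolyLin.compLeft_mk, γ.smul_right, Ext.map_smul, ← mul_smul,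
      ← mul_smul, comulId_one_tmul]
    congr 1
    induction a using TensorProduct.induction_on with
    | zero => simp
    | tmul f g => simp [emb12]
    | add x y hx hy => rw [map_add, add_mul, hx, hy, mul_add]
  | h2 x y hx hy => rw [map_add, hx, hy, map_add, smul_add]

theorem PolyLin.compLeft_add_left (γ : PolyLin k H M Q P) (q q' : Q) (y : PT2 k H M) :
    γ.compLeft (q + q') y = γ.compLeft q y + γ.compLeft q' y := by
  induction y using Ext.induction with
  | h0 => simp
  | h1 a m => simp only [PolyLin.compLeft_mk, map_add, smul_add]
  | h2 x y hx hy => rw [map_add, hx, hy, map_add, map_add]; abel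

theorem PolyLin.compLeft_zero_left (γ : PolyLin k H M Q P) (y : PT2 k H M) :
    γ.compLeft 0 y = 0 := by
  have h := γ.compLeft_add_left 0 0 y
  rw [add_zero] at h
  exact left_eq_add.mp h

section Swap

variable [IsCocomm k H]

theorem swap_mk (x : H ⊗[k] H) (m : M) :
    swap M (Ext.mk (comul2 k H) x m) = Ext.mk (comul2 k H) (flip2 k H x) m := Ext.map_mk _ _ _ _ _

theorem swap_swap (y : PT2 k H M) : swap M (swap M y) = y := by
  induction y using Ext.induction with
  | h0 => simp
  | h1 a m => rw [swap_mk, swap_mk, flip2_flip2]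
  | h2 x y hx hy => rw [map_add, map_add, hx, hy]

theorem swap12_smul (x : H ⊗[k] (H ⊗[k] H)) (y : PT3 k H M) :
    swap12 M (x • y) = flip12 k H x • swap12 M y := Ext.map_smul _ _ _ _ _

theorem flip12_emb12 (x : H ⊗[k] H) : flip12 k H (emb12 k H x) = emb12 k H (flip2 k H x) := by
  induction x using TensorProduct.induction_on with
  | zero => simp
  | tmul a b => rfl
  | add x y hx hy => simp only [map_add, hx, hy]

theorem flip12_comulId (x : H ⊗[k] H) : flip12 k H (comulId k H x) = comulId k H x := by
  induction x using TensorProduct.induction_on with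
  | zero => simp
  | add x y hx hy => simp only [map_add, hx, hy]
  | tmul a b =>
    have h1 : ∀ y : H ⊗[k] H, flip12 k H (Algebra.TensorProduct.assoc k k k H H H (y ⊗ₜ b)) =
        Algebra.TensorProduct.assoc k k k H H H (flip2 k H y ⊗ₜ b) := by
      intro y
      induction y using TensorProduct.induction_on with
      | zero => simp
      | tmul a b => rfl
      | add x y hx hy => simp only [TensorProduct.add_tmul, map_add, hx, hy]
    rw [comulId_tmul, h1, flip2_comul]

/-- `(y₂₁) * q` is obtained from `y * q` by flipping the first two factors. -/
theorem PolyLin.compLeft_swap (γ : PolyLin k H M Q P) (q : Q) (y : PT2 k H M) :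
    γ.compLeft q (swap M y) = swap12 P (γ.compLeft q y) := by
  induction y using Ext.induction with
  | h0 => simp
  | h2 x y hx hy => simp only [map_add, hx, hy]
  | h1 a m =>
    rw [swap_mk, PolyLin.compLeft_mk, PolyLin.compLeft_mk, swap12_smul, flip12_emb12]
    congr 1
    induction γ.toLin m q using Ext.induction with
    | h0 => simp
    | h2 x y hx hy => simp only [map_add, ← hx, ← hy]
    | h1 b p =>
      rw [Ext.map_mk]
      change _ = Ext.map _ _ _ _
      rw [Ext.map_mk, flip12_comulId]
      rfl

/-- The Jacobi identity follows from its instances on an `H`-basis. -/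
theorem jacobi_of_basis {ι : Type*} (e : Module.Basis ι H V) (μ : PolyLin k H V V V)
    (h : ∀ i j l, μ.compRight (e i) (μ.toLin (e j) (e l)) -
      swap12 V (μ.compRight (e j) (μ.toLin (e i) (e l))) =
        μ.compLeft (e l) (μ.toLin (e i) (e j))) (a b c : V) :
    μ.compRight a (μ.toLin b c) - swap12 V (μ.compRight b (μ.toLin a c)) =
      μ.compLeft c (μ.toLin a b) := by
  induction a using basis_induction e with
  | zero => simp [PolyLin.compRight_zero_left]
  | add v w hv hw =>
    simp only [map_add, LinearMap.add_apply, PolyLin.compRight_add_left, ← hv, ← hw]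
    abel
  | smul f v hv =>
    rw [μ.smul_left, μ.smul_left, PolyLin.compRight_smul_left, PolyLin.compRight_smul,
      PolyLin.compLeft_smul, ← hv, swap12_smul, smul_sub]
    rfl
  | basis i =>
    induction b using basis_induction e with
    | zero => simp [PolyLin.compRight_zero_left]
    | add v w hv hw =>
      simp only [map_add, LinearMap.add_apply, PolyLin.compRight_add_left, ← hv, ← hw]
      abel
    | smul f v hv =>
      rw [μ.smul_left, μ.smul_right, PolyLin.compRight_smul_left, PolyLin.compRight_smul,
        PolyLin.compLeft_smul, ← hv, swap12_smul, smul_sub]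
      rfl
    | basis j =>
      induction c using basis_induction e with
      | zero => simp [PolyLin.compLeft_zero_left]
      | add v w hv hw =>
        simp only [map_add, PolyLin.compLeft_add_left, ← hv, ← hw]
        abel
      | smul f v hv =>
        rw [μ.smul_right, μ.smul_right, PolyLin.compLeft_smul_left, PolyLin.compRight_smul,
          PolyLin.compRight_smul, ← hv, swap12_smul, smul_sub]
        rfl
      | basis l => exact h i j l

theorem skew_of_basis {ι : Type*} (e : Module.Basis ι H V) (μ : PolyLin k H V V V)
    (h : ∀ i j, μ.toLin (e j) (e i) = - swap V (μ.toLin (e i) (e j))) (a b : V) :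
    μ.toLin b a = - swap V (μ.toLin a b) := by
  induction a using basis_induction e with
  | zero => simp
  | add v w hv hw => rw [map_add, hv, hw, map_add, LinearMap.add_apply, map_add]; abel
  | smul f v hv => rw [μ.smul_right, μ.smul_left, hv, swap_smul, smul_neg]
  | basis i =>
    induction b using basis_induction e with
    | zero => simp
    | add v w hv hw => rw [map_add, LinearMap.add_apply, hv, hw, map_add, map_add]; abel
    | smul f v hv => rw [μ.smul_right, μ.smul_left, hv, swap_smul, smul_neg]
    | basis j => exact h i j

variable {ι : Type*} [Fintype ι] (e : Module.Basis ι H V)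

theorem Ext.coef_map {A B : Type*} [Ring A] [Algebra k A] [Ring B] [Algebra k B]
    {φ : H →ₐ[k] A} {φ' : H →ₐ[k] B} (ψ : A →ₐ[k] B) (hψ : ∀ h, ψ (φ h) = φ' h) (s : ι)
    (x : Ext φ V) :
    Ext.coef φ' e s (Ext.map (φ' := φ') ψ hψ LinearMap.id x) = ψ (Ext.coef φ e s x) := by
  induction x using Ext.induction with
  | h0 => simp
  | h1 a m => rw [Ext.map_mk, Ext.coef_mk, Ext.coef_mk, map_mul, hψ]; rfl
  | h2 x y hx hy => simp only [_root_.map_add, hx, hy]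

/-- The structure constants of a pseudobracket. -/
def PolyLin.table (μ : PolyLin k H V V V) (i j s : ι) : H ⊗[k] H :=
  Ext.coef (comul2 k H) e s (μ.toLin (e i) (e j))

theorem PolyLin.sum_table (μ : PolyLin k H V V V) (i j : ι) :
    ∑ s, Ext.mk (comul2 k H) (μ.table e i j s) (e s) = μ.toLin (e i) (e j) := Ext.sum_coef e _

theorem PolyLin.table_eq {μ : PolyLin k H V V V} {x : ι → ι → ι → H ⊗[k] H}
    (h : ∀ i j, μ.toLin (e i) (e j) = ∑ s, Ext.mk (comul2 k H) (x i j s) (e s)) :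
    μ.table e = x := by
  funext i j s
  rw [PolyLin.table, h, Ext.coef_sum]

theorem PolyLin.coef_compRight (μ : PolyLin k H V V V) (a b c s : ι) :
    Ext.coef (comul3 k H) e s (μ.compRight (e a) (μ.toLin (e b) (e c))) =
      ∑ m, emb23 k H (μ.table e b c m) * idComul k H (μ.table e a m s) := by
  rw [← μ.sum_table e b c, map_sum, map_sum]
  simp only [PolyLin.compRight_mk, Ext.coef_smul, Ext.coef_map]
  rfl

theorem PolyLin.coef_compLeft (μ : PolyLin k H V V V) (a b c s : ι) :
    Ext.coef (comul3 k H) e s (μ.compLeft (e c) (μ.toLin (e a) (e b))) =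
      ∑ m, emb12 k H (μ.table e a b m) * comulId k H (μ.table e m c s) := by
  rw [← μ.sum_table e a b, map_sum, map_sum]
  simp only [PolyLin.compLeft_mk, Ext.coef_smul, Ext.coef_map]
  rfl

theorem Ext.coef_swap12 (s : ι) (x : PT3 k H V) : Ext.coef (comul3 k H) e s (swap12 V x) =
    flip12 k H (Ext.coef (comul3 k H) e s x) := Ext.coef_map e _ _ _ _

theorem Ext.coef_swap (s : ι) (x : PT2 k H V) : Ext.coef (comul2 k H) e s (swap V x) =
    flip2 k H (Ext.coef (comul2 k H) e s x) := Ext.coef_map e _ _ _ _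

/-- The Jacobi identity need only be checked on a basis, where it is an identity of tables. -/
theorem jacobi_iff_table (μ : PolyLin k H V V V) :
    (∀ a b c : V, μ.compRight a (μ.toLin b c) - swap12 V (μ.compRight b (μ.toLin a c)) =
      μ.compLeft c (μ.toLin a b)) ↔ TableJacobi (μ.table e) := by
  constructor
  · intro h a b c s
    have h1 := congrArg (Ext.coef (comul3 k H) e s) (h (e a) (e b) (e c))
    rwa [map_sub, Ext.coef_swap12, PolyLin.coef_compRight, PolyLin.coef_compRight,
      PolyLin.coef_compLeft] at h1
  · intro h
    refine jacobi_of_basis e μ fun a b c => Ext.ext_coef e fun s => ?_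
    rw [map_sub, Ext.coef_swap12, PolyLin.coef_compRight, PolyLin.coef_compRight,
      PolyLin.coef_compLeft]
    exact h a b c s

theorem skew_iff_table (μ : PolyLin k H V V V) :
    (∀ a b : V, μ.toLin b a = - swap V (μ.toLin a b)) ↔
      ∀ i j s, μ.table e j i s = - flip2 k H (μ.table e i j s) := by
  constructor
  · intro h i j s
    rw [PolyLin.table, h, map_neg, Ext.coef_swap]
    rfl
  · intro h
    refine skew_of_basis e μ fun i j => Ext.ext_coef e fun s => ?_
    rw [map_neg, Ext.coef_swap]
    exact h i j s

end Swap

end Coordinates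

/-! ### Cobrackets in coordinates -/

section Cobracket

open Coalgebra HopfAlgebra

variable {k : Type*} [Field k] {H : Type*} [Ring H] [HopfAlgebra k H]
variable {V W : Type*} [AddCommGroup V] [Module k V] [Module H V] [IsScalarTower k H V]
  [AddCommGroup W] [Module k W] [Module H W] [IsScalarTower k H W]
variable {ι κ : Type*} [Fintype ι] [Fintype κ] (e : Module.Basis ι H V) (e' : Module.Basis κ H W)

/-- The coordinate functions of a basis, as `k`-linear maps. -/
def kcoord (k : Type*) [Field k] [HopfAlgebra k H] [Module k V] [IsScalarTower k H V]
    (e : Module.Basis ι H V) (i : ι) : V →ₗ[k] H := (e.coord i).restrictScalars k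

theorem kcoord_apply (i : ι) (v : V) : kcoord k e i v = e.repr v i := rfl

theorem sum_kcoord (v : V) : ∑ i, kcoord k e i v • e i = v := e.sum_repr v

/-- Coordinates on two factors, in the form of families of projections and sections, give coordinates
on the tensor product. -/
theorem map_ext_of_families {k A B C D : Type*} [Field k] [AddCommGroup A] [Module k A]
    [AddCommGroup B] [Module k B] [AddCommGroup C] [Module k C] [AddCommGroup D] [Module k D]
    {ι κ : Type*} [Fintype ι] [Fintype κ] (P : ι → A →ₗ[k] C) (R : ι → C →ₗ[k] A)
    (hPR : ∀ a, ∑ i, R i (P i a) = a) (P' : κ → B →ₗ[k] D) (R' : κ → D →ₗ[k] B)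
    (hPR' : ∀ b, ∑ j, R' j (P' j b) = b) (t : A ⊗[k] B) :
    ∑ i, ∑ j, TensorProduct.map (R i) (R' j) (TensorProduct.map (P i) (P' j) t) = t := by
  induction t using TensorProduct.induction_on with
  | zero => simp
  | add x y hx hy => simp only [map_add, Finset.sum_add_distrib, hx, hy]
  | tmul a b =>
    simp only [TensorProduct.map_tmul]
    simp only [← TensorProduct.tmul_sum, ← TensorProduct.sum_tmul, hPR, hPR']

/-- The coordinates `V ⊗ W → H ⊗ H` of a tensor with respect to `H`-bases of `V` and `W`. -/
def tcoef (i : ι) (j : κ) : V ⊗[k] W →ₗ[k] H ⊗[k] H :=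
  TensorProduct.map (kcoord k e i) (kcoord k e' j)

theorem tcoef_tmul (i : ι) (j : κ) (v : V) (w : W) :
    tcoef (k := k) e e' i j (v ⊗ₜ w) = e.repr v i ⊗ₜ e'.repr w j := rfl

theorem tcoef_act2 (i : ι) (j : κ) (x : H ⊗[k] H) (t : V ⊗[k] W) :
    tcoef e e' i j (act2 k H V W x t) = x * tcoef e e' i j t := by
  induction x using TensorProduct.induction_on with
  | zero => simp
  | add x y hx hy => simp only [map_add, LinearMap.add_apply, hx, hy, add_mul]
  | tmul f g =>
    induction t using TensorProduct.induction_on with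
    | zero => simp
    | add x y hx hy => simp only [map_add, hx, hy, mul_add]
    | tmul v w =>
      rw [act2_tmul, tcoef_tmul, tcoef_tmul]
      simp

theorem sum_act2_tcoef (t : V ⊗[k] W) :
    ∑ i, ∑ j, act2 k H V W (tcoef e e' i j t) (e i ⊗ₜ e' j) = t := by
  have h := map_ext_of_families (fun i => kcoord k e i)
    (fun i => (Algebra.lsmul k k V).toLinearMap.flip (e i)) (sum_kcoord e)
    (fun j => kcoord k e' j)
    (fun j => (Algebra.lsmul k k W).toLinearMap.flip (e' j)) (sum_kcoord e') t
  refine Eq.trans (Finset.sum_congr rfl fun i _ => Finset.sum_congr rfl fun j _ => ?_) h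
  change _ = TensorProduct.map _ _ (tcoef e e' i j t)
  induction tcoef e e' i j t using TensorProduct.induction_on with
  | zero => simp
  | add x y hx hy => simp only [map_add, LinearMap.add_apply, hx, hy]
  | tmul f g => rfl

theorem tcoef_ext {t t' : V ⊗[k] W} (h : ∀ i j, tcoef e e' i j t = tcoef e e' i j t') :
    t = t' := by
  rw [← sum_act2_tcoef e e' t, ← sum_act2_tcoef e e' t']
  simp only [h]

theorem tcoef_basis [DecidableEq ι] [DecidableEq κ] (i a : ι) (j b : κ) :
    tcoef (k := k) e e' i j (e a ⊗ₜ e' b) = if a = i ∧ b = j then 1 else 0 := by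
  rw [tcoef_tmul, e.repr_self, e'.repr_self, Finsupp.single_apply, Finsupp.single_apply]
  by_cases h1 : a = i <;> by_cases h2 : b = j <;> simp [h1, h2, Algebra.TensorProduct.one_def]

theorem tcoef_sum (x : ι → κ → H ⊗[k] H) (i : ι) (j : κ) :
    tcoef e e' i j (∑ a, ∑ b, act2 k H V W (x a b) (e a ⊗ₜ e' b)) = x i j := by
  classical
  simp only [map_sum, tcoef_act2, tcoef_basis]
  rw [Finset.sum_eq_single i, Finset.sum_eq_single j]
  · simp
  · intro b _ hb
    simp [hb]
  · simp
  · intro a _ ha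
    simp [ha]
  · simp

/-- The coordinates `V ⊗ V ⊗ V → H ⊗ H ⊗ H`. -/
def tcoef3 (i j l : ι) : V ⊗[k] (V ⊗[k] V) →ₗ[k] H ⊗[k] (H ⊗[k] H) :=
  TensorProduct.map (kcoord k e i) (tcoef e e j l)

theorem tcoef3_ext {t t' : V ⊗[k] (V ⊗[k] V)}
    (h : ∀ i j l, tcoef3 e i j l t = tcoef3 e i j l t') : t = t' := by
  have key := fun t => map_ext_of_families (fun i => kcoord k e i)
    (fun i => (Algebra.lsmul k k V).toLinearMap.flip (e i)) (sum_kcoord e)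
    (fun p : ι × ι => tcoef (k := k) e e p.1 p.2)
    (fun p : ι × ι => (act2 k H V V).toLinearMap.flip (e p.1 ⊗ₜ e p.2))
    (fun t => (Fintype.sum_prod_type _).trans (sum_act2_tcoef e e t)) t
  rw [← key t, ← key t']
  refine Finset.sum_congr rfl fun i _ => Finset.sum_congr rfl fun p _ => ?_
  exact congrArg _ (h i p.1 p.2)

theorem tcoef3_leftComm (i j l : ι) (t : V ⊗[k] (V ⊗[k] V)) :
    tcoef3 e i j l (TensorProduct.leftComm k V V V t) = flip12 k H (tcoef3 e j i l t) := by
  induction t using tensor3_induction with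
  | zero => simp
  | add x y hx hy => simp only [map_add, hx, hy]
  | tmul a b c => rfl

theorem tcoef_comm (i j : ι) (t : V ⊗[k] V) :
    tcoef e e i j (TensorProduct.comm k V V t) = flip2 k H (tcoef e e j i t) := by
  induction t using TensorProduct.induction_on with
  | zero => simp
  | add x y hx hy => simp only [map_add, hx, hy]
  | tmul a b => rfl

section Cojacobi

variable (δ : V →ₗ[H] DTensor k H V V)

/-- A cobracket, as a map to the plain tensor product. -/
def plainCobracket : V →ₗ[k] V ⊗[k] V :=
  (DTensor.plain k H V V).toLinearMap ∘ₗ δ.restrictScalars k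

theorem plainCobracket_smul (h : H) (v : V) :
    plainCobracket δ (h • v) = act2 k H V V (comul2 k H h) (plainCobracket δ v) := by
  change DTensor.plain k H V V (δ (h • v)) = _
  rw [map_smul, DTensor.plain_smul]
  rfl

/-- The coefficients `d s i j` of a cobracket: `δ(e_s) = Σ d_s^{ij} (e_i ⊗ e_j)`. -/
def cotable (s i j : ι) : H ⊗[k] H := tcoef e e i j (plainCobracket δ (e s))

theorem plainCobracket_eq (v : V) :
    plainCobracket δ v =
      ∑ m, act2 k H V V (comul2 k H (e.repr v m)) (plainCobracket δ (e m)) := by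
  conv_lhs => rw [← e.sum_repr v, map_sum]
  simp only [plainCobracket_smul]

theorem tcoef_plainCobracket (v : V) (i j : ι) :
    tcoef e e i j (plainCobracket δ v) = ∑ m, comul2 k H (e.repr v m) * cotable e δ m i j := by
  rw [plainCobracket_eq e, map_sum]
  simp only [tcoef_act2]
  rfl

theorem tcoef3_lTensor (i j l : ι) (t : V ⊗[k] V) :
    tcoef3 e i j l ((plainCobracket δ).lTensor V t) =
      ∑ m, idComul k H (tcoef e e i m t) * emb23 k H (cotable e δ m j l) := by
  induction t using TensorProduct.induction_on with
  | zero => simp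
  | add x y hx hy => simp only [map_add, hx, hy, add_mul, Finset.sum_add_distrib]
  | tmul a b =>
    rw [LinearMap.lTensor_tmul, tcoef3, TensorProduct.map_tmul, tcoef_plainCobracket,
      TensorProduct.tmul_sum]
    refine Finset.sum_congr rfl fun m _ => ?_
    rw [tcoef_tmul, kcoord_apply]
    simp [idComul, emb23]

theorem tcoef3_rTensor (i j l : ι) (t : V ⊗[k] V) :
    tcoef3 e i j l (TensorProduct.assoc k V V V ((plainCobracket δ).rTensor V t)) =
      ∑ m, comulId k H (tcoef e e m l t) * emb12 k H (cotable e δ m i j) := by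
  induction t using TensorProduct.induction_on with
  | zero => simp
  | add x y hx hy => simp only [map_add, hx, hy, add_mul, Finset.sum_add_distrib]
  | tmul a b =>
    have key : ∀ y : V ⊗[k] V, tcoef3 e i j l (TensorProduct.assoc k V V V (y ⊗ₜ b)) =
        Algebra.TensorProduct.assoc k k k H H H (tcoef e e i j y ⊗ₜ e.repr b l) := by
      intro y
      induction y using TensorProduct.induction_on with
      | zero => simp
      | add x y hx hy => simp only [map_add, TensorProduct.add_tmul, hx, hy]
      | tmul a b => rfl
    rw [LinearMap.rTensor_tmul, key, tcoef_plainCobracket, TensorProduct.sum_tmul, map_sum]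
    refine Finset.sum_congr rfl fun m _ => ?_
    rw [tcoef_tmul, comulId_tmul, emb12_eq_assoc, ← map_mul]
    simp

theorem antipode3_antipode3 [IsCocomm k H] (x : H ⊗[k] (H ⊗[k] H)) :
    antipode3 k H (antipode3 k H x) = x := by
  induction x using tensor3_induction with
  | zero => simp
  | tmul a b c => simp [antipode_antipode]
  | add x y hx hy => rw [map_add, map_add, hx, hy]

/-- The structure constants of the pseudobracket dual to a cobracket. -/
def dualTable (i j s : ι) : H ⊗[k] H := antipode2 k H (cotable e δ s i j)

/-- The value at `v` of the left hand side minus the right hand side of the co-Jacobi identity. -/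
def coJacobiator (v : V) : V ⊗[k] (V ⊗[k] V) :=
  (plainCobracket δ).lTensor V (plainCobracket δ v) -
    TensorProduct.leftComm k V V V ((plainCobracket δ).lTensor V (plainCobracket δ v)) -
    TensorProduct.assoc k V V V ((plainCobracket δ).rTensor V (plainCobracket δ v))

/-- The antipode turns the coordinates of the co-Jacobi identity of a cobracket into those of the
Jacobi identity of the dual pseudobracket. -/
theorem antipode3_tcoef3_coJacobiator [IsCocomm k H] (a b c s : ι) :
    antipode3 k H (tcoef3 e a b c (coJacobiator δ (e s))) =
      ∑ m, emb23 k H (dualTable e δ b c m) * idComul k H (dualTable e δ a m s) -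
      flip12 k H (∑ m, emb23 k H (dualTable e δ a c m) * idComul k H (dualTable e δ b m s)) -
      ∑ m, emb12 k H (dualTable e δ a b m) * comulId k H (dualTable e δ m c s) := by
  simp only [coJacobiator, map_sub, tcoef3_leftComm, tcoef3_lTensor, tcoef3_rTensor,
    antipode3_flip12, map_sum, antipode3_mul, antipode3_emb23, antipode3_emb12, antipode3_idComul,
    antipode3_comulId]
  rfl

theorem tcoef3_coJacobiator [IsCocomm k H] (a b c : ι) (v : V) :
    tcoef3 e a b c (coJacobiator δ v) =
      ∑ s, comul3 k H (e.repr v s) * tcoef3 e a b c (coJacobiator δ (e s)) := by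
  simp only [coJacobiator, map_sub, tcoef3_leftComm, tcoef3_lTensor, tcoef3_rTensor, mul_sub,
    Finset.sum_sub_distrib, map_sum, map_mul]
  simp only [tcoef_plainCobracket e δ v, map_sum, map_mul, Finset.sum_mul, Finset.mul_sum,
    idComul_comul, comulId_comul, flip12_comul, mul_assoc]
  congr 1
  · congr 1
    · exact Finset.sum_comm
    · exact Finset.sum_comm
  · exact Finset.sum_comm

/-- The co-Jacobi identity for a cobracket is the Jacobi identity for the dual structure
constants. -/
theorem coJacobi_iff_table [IsCocomm k H] :
    (∀ v, coJacobiator δ v = 0) ↔ TableJacobi (dualTable e δ) := by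
  constructor
  · intro h a b c s
    have h1 := antipode3_tcoef3_coJacobiator e δ a b c s
    rw [h, map_zero, map_zero] at h1
    exact sub_eq_zero.mp h1.symm
  · intro h v
    refine tcoef3_ext e fun a b c => ?_
    rw [tcoef3_coJacobiator, map_zero]
    refine Finset.sum_eq_zero fun s _ => ?_
    rw [← antipode3_antipode3 (tcoef3 e a b c _), antipode3_tcoef3_coJacobiator, h a b c s,
      sub_self, map_zero, mul_zero]

theorem coskew_iff_table [IsCocomm k H] :
    (∀ v, TensorProduct.comm k V V (plainCobracket δ v) = - plainCobracket δ v) ↔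
      ∀ i j s, dualTable e δ j i s = - flip2 k H (dualTable e δ i j s) := by
  constructor
  · intro h i j s
    have h1 := congrArg (tcoef e e i j) (h (e s))
    rw [tcoef_comm, map_neg] at h1
    have h2 : cotable e δ s j i = - flip2 k H (cotable e δ s i j) := by
      change tcoef e e j i _ = - flip2 k H (tcoef e e i j _)
      rw [← neg_eq_iff_eq_neg] at h1
      rw [← h1, map_neg, neg_neg, flip2_flip2]
    rw [dualTable, h2, map_neg, antipode2_flip2]
    rfl
  · intro h v
    have h2 : ∀ i j s, cotable e δ s j i = - flip2 k H (cotable e δ s i j) := by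
      intro i j s
      have h3 := congrArg (antipode2 k H) (h i j s)
      rwa [dualTable, dualTable, map_neg, antipode2_flip2, antipode2_antipode2,
        antipode2_antipode2] at h3
    refine tcoef_ext e e fun i j => ?_
    rw [tcoef_comm, map_neg, tcoef_plainCobracket, tcoef_plainCobracket, map_sum,
      ← Finset.sum_neg_distrib]
    refine Finset.sum_congr rfl fun m _ => ?_
    rw [map_mul, flip2_comul, h2 j i, mul_neg, neg_neg]

/-- The cobracket whose dual structure constants are `x`:
`δ(e_s) = Σ (S ⊗ S)(x_{ij}^s) (e_i ⊗ e_j)`. -/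
def cobracketOfTable (x : ι → ι → ι → H ⊗[k] H) : V →ₗ[H] DTensor k H V V :=
  e.constr ℕ fun s => (DTensor.plain k H V V).symm
    (∑ i, ∑ j, act2 k H V V (antipode2 k H (x i j s)) (e i ⊗ₜ e j))

theorem plainCobracket_cobracketOfTable (x : ι → ι → ι → H ⊗[k] H) (s : ι) :
    plainCobracket (cobracketOfTable e x) (e s) =
      ∑ i, ∑ j, act2 k H V V (antipode2 k H (x i j s)) (e i ⊗ₜ e j) := by
  change DTensor.plain k H V V (cobracketOfTable e x (e s)) = _
  rw [cobracketOfTable, e.constr_basis, LinearEquiv.apply_symm_apply]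

theorem dualTable_eq [IsCocomm k H] {δ : V →ₗ[H] DTensor k H V V} {x : ι → ι → ι → H ⊗[k] H}
    (h : ∀ s, plainCobracket δ (e s) =
      ∑ i, ∑ j, act2 k H V V (antipode2 k H (x i j s)) (e i ⊗ₜ e j)) : dualTable e δ = x := by
  funext i j s
  rw [dualTable, cotable, h, tcoef_sum, antipode2_antipode2]

theorem sum_dualTable [IsCocomm k H] (s : ι) : plainCobracket δ (e s) =
      ∑ i, ∑ j, act2 k H V V (antipode2 k H (dualTable e δ i j s)) (e i ⊗ₜ e j) := by
  simp only [dualTable, antipode2_antipode2]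
  exact (sum_act2_tcoef e e _).symm

/-- A cobracket is determined by its structure constants. -/
theorem cobracket_ext_table [IsCocomm k H] {δ δ' : V →ₗ[H] DTensor k H V V}
    (h : dualTable e δ = dualTable e δ') : δ = δ' := by
  refine e.ext fun s => ?_
  change plainCobracket δ (e s) = plainCobracket δ' (e s)
  rw [sum_dualTable, sum_dualTable, h]

end Cojacobi

end Cobracket

/-! ### The Fourier transform and the action on tensor products -/

section Fourier

open Coalgebra HopfAlgebra

variable {k : Type*} [Field k] {H : Type*} [Ring H] [HopfAlgebra k H]
variable {M N V V' : Type*} [AddCommGroup M] [Module k M] [Module H M] [IsScalarTower k H M]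
  [AddCommGroup N] [Module k N] [Module H N] [IsScalarTower k H N]
  [AddCommGroup V] [Module k V] [Module H V] [IsScalarTower k H V]
  [AddCommGroup V'] [Module k V'] [Module H V'] [IsScalarTower k H V']

variable (k H) in
/-- The map `h ⊗ z ↦ (h ⊗ 1) Δ(z)`, inverse to the Fourier transform of `H ⊗ H`. -/
def unfourierHH : H ⊗[k] H →ₗ[k] H ⊗[k] H :=
  TensorProduct.lift ((LinearMap.mul k (H ⊗[k] H)).compl₁₂ (inc1 k H).toLinearMap comul)

theorem unfourierHH_tmul (h z : H) :
    unfourierHH k H (h ⊗ₜ z) = (h ⊗ₜ 1) * comul2 k H z := rfl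

theorem unfourierHH_mul (f : H) (y : H ⊗[k] H) :
    unfourierHH k H ((f ⊗ₜ 1) * y) = (f ⊗ₜ 1) * unfourierHH k H y := by
  induction y using TensorProduct.induction_on with
  | zero => simp
  | add x y hx hy => simp only [mul_add, map_add, hx, hy]
  | tmul a b =>
    rw [Algebra.TensorProduct.tmul_mul_tmul, one_mul, unfourierHH_tmul, unfourierHH_tmul,
      ← mul_assoc, Algebra.TensorProduct.tmul_mul_tmul, one_mul]

theorem unfourierHH_antipode_comul (h : H) :
    unfourierHH k H (TensorProduct.map (antipode k) LinearMap.id (comul (R := k) h)) =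
      1 ⊗ₜ h := by
  conv_lhs => rw [← (ℛ k h).eq]
  simp only [map_sum, TensorProduct.map_tmul, LinearMap.id_apply, unfourierHH_tmul]
  exact sum_antipode_tmul_one_mul_comul (ℛ k h)

theorem unfourierHH_fourierHH (x : H ⊗[k] H) : unfourierHH k H (fourierHH k H x) = x := by
  induction x using TensorProduct.induction_on with
  | zero => simp
  | add x y hx hy => simp only [map_add, hx, hy]
  | tmul f g =>
    rw [fourierHH_tmul, unfourierHH_mul, unfourierHH_antipode_comul,
      Algebra.TensorProduct.tmul_mul_tmul, one_mul, mul_one]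

theorem unfourier_tmul (h : H) (m : M) :
    unfourier k H M (h ⊗ₜ m) = Ext.mk (comul2 k H) (h ⊗ₜ 1) m := rfl

/-- The action of `y ∈ H ⊗ H` on `H ⊗ M`: `(p ⊗ q) (f ⊗ m) = f p ⊗ q m`. -/
def twist (y : H ⊗[k] H) : H ⊗[k] M →ₗ[k] H ⊗[k] M :=
  TensorProduct.lift ((TensorProduct.mapBilinear (RingHom.id k) H M H M).compl₁₂
    (LinearMap.mul k H).flip (Algebra.lsmul k k M).toLinearMap) y

theorem twist_tmul (p q f : H) (m : M) :
    twist (k := k) (p ⊗ₜ q) (f ⊗ₜ m) = (f * p) ⊗ₜ (q • m) := rfl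

theorem twist_add (y y' : H ⊗[k] H) (z : H ⊗[k] M) :
    twist (y + y') z = twist y z + twist y' z := by
  simp only [twist, map_add, LinearMap.add_apply]

theorem twist_zero (z : H ⊗[k] M) : twist (0 : H ⊗[k] H) z = 0 := by
  simp only [twist, map_zero, LinearMap.zero_apply]

theorem unfourier_twist (y : H ⊗[k] H) (f : H) (m : M) :
    unfourier k H M (twist y (f ⊗ₜ m)) =
      Ext.mk (comul2 k H) ((f ⊗ₜ 1) * unfourierHH k H y) m := by
  induction y using TensorProduct.induction_on with
  | zero => simp [twist_zero]
  | add x y hx hy => simp only [twist_add, map_add, mul_add, hx, hy, LinearMap.add_apply]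
  | tmul p q =>
    rw [twist_tmul, unfourier_tmul, unfourierHH_tmul, ← mul_assoc, Ext.mk_mul,
      Algebra.TensorProduct.tmul_mul_tmul, one_mul]

theorem fourier_unfourier (z : H ⊗[k] M) : fourier k H M (unfourier k H M z) = z := by
  induction z using TensorProduct.induction_on with
  | zero => simp
  | add x y hx hy => simp only [map_add, hx, hy]
  | tmul h m => rw [unfourier_tmul, fourier_mk]

theorem fourier_mk_eq (x : H ⊗[k] H) (m : M) :
    fourier k H M (Ext.mk (comul2 k H) x m) = (smulMap k H M).lTensor H
      (TensorProduct.assoc k H H M (fourierHH k H x ⊗ₜ m)) := rfl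

theorem unfourier_fourier (x : PT2 k H M) : unfourier k H M (fourier k H M x) = x := by
  induction x using Ext.induction with
  | h0 => simp
  | h2 x y hx hy => simp only [map_add, hx, hy]
  | h1 x m =>
    have key : ∀ y : H ⊗[k] H, unfourier k H M ((smulMap k H M).lTensor H
        (TensorProduct.assoc k H H M (y ⊗ₜ m))) =
          Ext.mk (comul2 k H) (unfourierHH k H y) m := by
      intro y
      induction y using TensorProduct.induction_on with
      | zero => simp
      | add x y hx hy => simp only [map_add, TensorProduct.add_tmul, LinearMap.add_apply, hx, hy]
      | tmul a b =>
        rw [unfourierHH_tmul, Ext.mk_mul, ← unfourier_tmul]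
        rfl
    rw [fourier_mk_eq, key, unfourierHH_fourierHH]

theorem unfourier_twist_antipode (h : H) (z : H ⊗[k] M) :
    unfourier k H M (twist (TensorProduct.map (antipode k) LinearMap.id (comul (R := k) h)) z) =
      ((1 : H) ⊗ₜ[k] h : H ⊗[k] H) • unfourier k H M z := by
  induction z using TensorProduct.induction_on with
  | zero => simp
  | add x y hx hy => simp only [map_add, hx, hy, smul_add]
  | tmul f m =>
    rw [unfourier_twist, unfourierHH_antipode_comul, unfourier_tmul, Ext.smul_mk,
      Algebra.TensorProduct.tmul_mul_tmul, Algebra.TensorProduct.tmul_mul_tmul, one_mul, mul_one,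
      one_mul, mul_one]

theorem fourier_one_tmul_smul (h : H) (x : PT2 k H M) :
    fourier k H M (((1 : H) ⊗ₜ[k] h : H ⊗[k] H) • x) =
      twist (TensorProduct.map (antipode k) LinearMap.id (comul (R := k) h))
        (fourier k H M x) := by
  rw [← fourier_unfourier (twist _ (fourier k H M x)), unfourier_twist_antipode,
    unfourier_fourier]

variable {ι : Type*} [Fintype ι] (e : Module.Basis ι H M)

theorem lTensor_kcoord_fourier (s : ι) (x : PT2 k H M) :
    (kcoord k e s).lTensor H (fourier k H M x) =
      fourierHH k H (Ext.coef (comul2 k H) e s x) := by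
  induction x using Ext.induction with
  | h0 => simp
  | h2 x y hx hy => simp only [map_add, hx, hy]
  | h1 x m =>
    rw [fourier_mk_eq, Ext.coef_mk, fourierHH_mul_comul]
    induction fourierHH k H x using TensorProduct.induction_on with
    | zero => simp
    | add x y hx hy => simp only [map_add, TensorProduct.add_tmul, hx, hy, add_mul]
    | tmul a b => simp [smulMap, kcoord_apply]

/-! #### The Fourier transform of an action -/

/-- The Fourier transform `m ↦ Σ h ⊗ m'` of an action `a * m = Σ (h ⊗ 1) ⊗_H m'`. -/
def adF (μ : PolyLin k H V M M) (a : V) : M →ₗ[k] H ⊗[k] M := fourier k H M ∘ₗ μ.toLin a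

theorem unfourier_adF (μ : PolyLin k H V M M) (a : V) (m : M) :
    unfourier k H M (adF μ a m) = μ.toLin a m := unfourier_fourier _

/-- The action of `H` on the argument `m` of `a * m` is the twisted action on its Fourier transform. -/
theorem adF_smul (μ : PolyLin k H V M M) (a : V) (h : H) (m : M) :
    adF μ a (h • m) = twist (TensorProduct.map (antipode k) LinearMap.id (comul (R := k) h))
      (adF μ a m) := by
  rw [adF, LinearMap.comp_apply, μ.smul_right, fourier_one_tmul_smul]
  rfl

/-- The Leibniz rule: the map `M ⊗ N → X ⊗ (M ⊗ N)` built from `M → X ⊗ M` and `N → X ⊗ N`. -/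
def leibniz {X : Type*} [AddCommGroup X] [Module k X] (f : M →ₗ[k] X ⊗[k] M)
    (g : N →ₗ[k] X ⊗[k] N) : M ⊗[k] N →ₗ[k] X ⊗[k] (M ⊗[k] N) :=
  (TensorProduct.assoc k X M N).toLinearMap ∘ₗ f.rTensor N +
    (TensorProduct.leftComm k M X N).toLinearMap ∘ₗ g.lTensor M

theorem leibniz_tmul {X : Type*} [AddCommGroup X] [Module k X] (f : M →ₗ[k] X ⊗[k] M)
    (g : N →ₗ[k] X ⊗[k] N) (m : M) (n : N) : leibniz f g (m ⊗ₜ n) =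
      TensorProduct.assoc k X M N (f m ⊗ₜ n) + TensorProduct.leftComm k M X N (m ⊗ₜ g n) := rfl

/-- The Fourier transform of the action on `M ⊗ N`. -/
def tensorAd (μ : PolyLin k H V M M) (ν : PolyLin k H V N N) (a : V) :
    DTensor k H M N →ₗ[k] H ⊗[k] DTensor k H M N :=
  ((DTensor.plain k H M N).symm.toLinearMap.lTensor H) ∘ₗ leibniz (adF μ a) (adF ν a) ∘ₗ
    (DTensor.plain k H M N).toLinearMap

theorem tensorAct_eq (μ : PolyLin k H V M M) (ν : PolyLin k H V N N) (a : V)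
    (t : DTensor k H M N) :
    tensorAct μ ν a t = unfourier k H (DTensor k H M N) (tensorAd μ ν a t) := rfl

/-- The map `a ⊗ (b ⊗ c) ↦ f S(a) ⊗ (b m ⊗ c n)`. -/
def spread (f : H) (m : M) (n : N) : H ⊗[k] (H ⊗[k] H) →ₗ[k] H ⊗[k] (M ⊗[k] N) :=
  TensorProduct.map (LinearMap.mulLeft k f ∘ₗ antipode k)
    (TensorProduct.map ((Algebra.lsmul k k M).toLinearMap.flip m)
      ((Algebra.lsmul k k N).toLinearMap.flip n))

theorem twist_spread (f : H) (m : M) (n : N) (h : H) :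
    TensorProduct.map LinearMap.id (DTensor.plain k H M N).toLinearMap
      (twist (TensorProduct.map (antipode k) LinearMap.id (comul (R := k) h))
        (f ⊗ₜ[k] (DTensor.plain k H M N).symm (m ⊗ₜ n))) = spread f m n (comul3 k H h) := by
  have key : ∀ y : H ⊗[k] H, TensorProduct.map LinearMap.id (DTensor.plain k H M N).toLinearMap
      (twist (TensorProduct.map (antipode k) LinearMap.id y)
        (f ⊗ₜ[k] (DTensor.plain k H M N).symm (m ⊗ₜ n))) = spread f m n (idComul k H y) := by
    intro y
    induction y using TensorProduct.induction_on with
    | zero => simp [twist_zero]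
    | add x y hx hy => simp only [map_add, twist_add, hx, hy]
    | tmul p q =>
      rw [TensorProduct.map_tmul, LinearMap.id_apply, twist_tmul, TensorProduct.map_tmul]
      change (f * antipode k p) ⊗ₜ act2 k H M N (comul2 k H q) (m ⊗ₜ n) =
        spread f m n (p ⊗ₜ comul2 k H q)
      induction comul2 k H q using TensorProduct.induction_on with
      | zero => simp
      | add x y hx hy => simp only [map_add, LinearMap.add_apply, TensorProduct.tmul_add, hx, hy]
      | tmul b c => rfl
  exact key _

theorem assoc_twist_tmul (p q f : H) (m : M) (n : N) :
    TensorProduct.assoc k H M N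
      (twist (TensorProduct.map (antipode k) LinearMap.id (comul (R := k) p)) (f ⊗ₜ m) ⊗ₜ
        (q • n)) = spread f m n (comulId k H (p ⊗ₜ q)) := by
  rw [comulId_tmul]
  change _ = spread f m n (Algebra.TensorProduct.assoc k k k H H H (comul p ⊗ₜ q))
  induction comul (R := k) p using TensorProduct.induction_on with
  | zero => simp [twist_zero]
  | add x y hx hy => simp only [map_add, twist_add, TensorProduct.add_tmul, hx, hy]
  | tmul b c => rfl

theorem leftComm_tmul_twist (p q f : H) (m : M) (n : N) :
    TensorProduct.leftComm k M H N ((p • m) ⊗ₜ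
      (twist (TensorProduct.map (antipode k) LinearMap.id (comul (R := k) q)) (f ⊗ₜ n))) =
        spread f m n (flip12 k H (idComul k H (p ⊗ₜ q))) := by
  change _ = spread f m n (flip12 k H (p ⊗ₜ comul q))
  induction comul (R := k) q using TensorProduct.induction_on with
  | zero => simp [twist_zero]
  | add x y hx hy => simp only [map_add, twist_add, TensorProduct.tmul_add, hx, hy]
  | tmul b c => rfl

/-- The Leibniz rule is compatible with the componentwise action: an element `w` of `H ⊗ H` acts on
the first summand through `(Δ ⊗ id) w` and on the second through the flip of `(id ⊗ Δ) w`.  For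
`w = Δ(h)` the two agree by coassociativity and cocommutativity. -/
theorem leibniz_act2 (μ : PolyLin k H V M M) (ν : PolyLin k H V N N) (a : V) (m : M) (n : N)
    {S : Finset (H × M)} (hS : adF μ a m = ∑ i ∈ S, i.1 ⊗ₜ i.2)
    {T : Finset (H × N)} (hT : adF ν a n = ∑ i ∈ T, i.1 ⊗ₜ i.2) (w : H ⊗[k] H) :
    leibniz (adF μ a) (adF ν a) (act2 k H M N w (m ⊗ₜ n)) =
      ∑ i ∈ S, spread i.1 i.2 n (comulId k H w) +
        ∑ i ∈ T, spread i.1 m i.2 (flip12 k H (idComul k H w)) := by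
  induction w using TensorProduct.induction_on with
  | zero => simp
  | add x y hx hy =>
    simp only [map_add, LinearMap.add_apply, hx, hy, Finset.sum_add_distrib]
    abel
  | tmul p q =>
    rw [act2_tmul, leibniz_tmul, adF_smul, adF_smul, hS, hT]
    simp only [map_sum, TensorProduct.sum_tmul, TensorProduct.tmul_sum, assoc_twist_tmul,
      leftComm_tmul_twist]

theorem tensorAd_smul [IsCocomm k H] (μ : PolyLin k H V M M) (ν : PolyLin k H V N N) (a : V)
    (h : H) (t : DTensor k H M N) :
    tensorAd μ ν a (h • t) =
      twist (TensorProduct.map (antipode k) LinearMap.id (comul (R := k) h))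
        (tensorAd μ ν a t) := by
  obtain ⟨t, rfl⟩ := (DTensor.plain k H M N).symm.surjective t
  have hinj : Function.Injective (TensorProduct.map (LinearMap.id : H →ₗ[k] H)
      (DTensor.plain k H M N).toLinearMap) :=
    (TensorProduct.congr (LinearEquiv.refl k H) (DTensor.plain k H M N)).injective
  apply hinj
  induction t using TensorProduct.induction_on with
  | zero => simp
  | add x y hx hy => simp only [map_add, smul_add, hx, hy]
  | tmul m n =>
    obtain ⟨S, hS⟩ := TensorProduct.exists_finset (adF μ a m)
    obtain ⟨T, hT⟩ := TensorProduct.exists_finset (adF ν a n)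
    have h1 : tensorAd μ ν a ((DTensor.plain k H M N).symm (m ⊗ₜ n)) =
        ∑ i ∈ S, i.1 ⊗ₜ[k] (DTensor.plain k H M N).symm (i.2 ⊗ₜ n) +
          ∑ i ∈ T, i.1 ⊗ₜ[k] (DTensor.plain k H M N).symm (m ⊗ₜ i.2) := by
      change (DTensor.plain k H M N).symm.toLinearMap.lTensor H
        (leibniz (adF μ a) (adF ν a) (m ⊗ₜ n)) = _
      rw [leibniz_tmul, hS, hT]
      simp [TensorProduct.sum_tmul, TensorProduct.tmul_sum]
    rw [h1, map_add, map_add, map_sum, map_sum, map_sum, map_sum]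
    simp only [twist_spread]
    have h2 := leibniz_act2 μ ν a m n hS hT (comul2 k H h)
    rw [comulId_comul, idComul_comul, flip12_comul] at h2
    rw [← h2]
    change TensorProduct.map LinearMap.id (DTensor.plain k H M N).toLinearMap
      (TensorProduct.map LinearMap.id (DTensor.plain k H M N).symm.toLinearMap
        (leibniz (adF μ a) (adF ν a) (act2 k H M N (comul2 k H h) (m ⊗ₜ n)))) = _
    rw [← LinearMap.comp_apply, ← TensorProduct.map_comp]
    simp

/-- The action on a tensor product is `H`-linear in the argument. -/
theorem tensorAct_smul [IsCocomm k H] (μ : PolyLin k H V M M) (ν : PolyLin k H V N N) (a : V)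
    (h : H) (t : DTensor k H M N) :
    tensorAct μ ν a (h • t) = ((1 : H) ⊗ₜ[k] h : H ⊗[k] H) • tensorAct μ ν a t := by
  rw [tensorAct_eq, tensorAct_eq, tensorAd_smul, unfourier_twist_antipode]

/-! #### The map `f ⊗ f` -/

/-- The map `f ⊗ f`, as an `H`-linear map. -/
def dtMapH (f : V →ₗ[H] V') : DTensor k H V V →ₗ[H] DTensor k H V' V' where
  toFun := dtMap f
  map_add' := map_add _
  map_smul' h t := by
    change dtMap f (act2 k H V V (comul2 k H h) t) = act2 k H V' V' (comul2 k H h) (dtMap f t)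
    have key : ∀ (y : H ⊗[k] H) (t : V ⊗[k] V),
        TensorProduct.map (f.restrictScalars k) (f.restrictScalars k) (act2 k H V V y t) =
          act2 k H V' V' y
            (TensorProduct.map (f.restrictScalars k) (f.restrictScalars k) t) := by
      intro y t
      induction y using TensorProduct.induction_on with
      | zero => simp
      | add x y hx hy => simp only [map_add, LinearMap.add_apply, hx, hy]
      | tmul p q =>
        induction t using TensorProduct.induction_on with
        | zero => simp
        | add x y hx hy => simp only [map_add, hx, hy]
        | tmul m n => simp [act2_tmul]
    exact key _ t

theorem dtMapH_apply (f : V →ₗ[H] V') (t : DTensor k H V V) : dtMapH f t = dtMap f t := rfl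

end Fourier

/-! ### The cocycle condition in coordinates -/

section Cocycle

open Coalgebra HopfAlgebra

variable {k : Type*} [Field k] {H : Type*} [Ring H] [HopfAlgebra k H] [IsCocomm k H]
variable {V : Type*} [AddCommGroup V] [Module k V] [Module H V] [IsScalarTower k H V]
variable {ι : Type*} [Fintype ι] (e : Module.Basis ι H V)

/-- The quadrilinear coordinates of an element of `(H ⊗ H) ⊗_H (V ⊗ V)`, the last two arguments
running through the dual basis. -/
def quadCoef (s t : ι) : PT2 k H (DTensor k H V V) →ₗ[k] F4 k H :=
  Ext.descend (TensorProduct.lift ((glue k H).compl₂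
    (antipode2 k H ∘ₗ tcoef e e s t ∘ₗ (DTensor.plain k H V V).toLinearMap))) (by
    intro y h τ
    simp only [TensorProduct.lift.tmul, LinearMap.compl₂_apply, LinearMap.comp_apply,
      LinearEquiv.coe_coe, DTensor.plain_smul, tcoef_act2]
    rw [antipode2_mul, glue_mul_comul]
    congr 2
    exact (antipode2_comul2 h).symm)

theorem quadCoef_mk (s t : ι) (y : H ⊗[k] H) (τ : DTensor k H V V) :
    quadCoef e s t (Ext.mk (comul2 k H) y τ) =
      glue k H y (antipode2 k H (tcoef e e s t (DTensor.plain k H V V τ))) := rfl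

/-- The map `h ⊗ x ⊗ y ↦ (h ⊗ 1 ⊗ S(x) ⊗ S(y)) ⊗_H 1`. -/
def quadEmb : H ⊗[k] (H ⊗[k] H) →ₗ[k] F4 k H :=
  cls4 k H ∘ₗ (TensorProduct.mk k H _ 1 ∘ₗ antipode2 k H).lTensor H

theorem quadEmb_tmul (h : H) (x : H ⊗[k] H) :
    quadEmb (h ⊗ₜ x) = cls4 k H (h ⊗ₜ (1 ⊗ₜ antipode2 k H x)) := rfl

theorem quadEmb_injective : Function.Injective (quadEmb (k := k) (H := H)) := by
  have key : ∀ z, rho12 k H (quadEmb z) = nu4 k H ((antipode2 k H).lTensor H z) := by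
    intro z
    induction z using TensorProduct.induction_on with
    | zero => simp
    | add x y hx hy => simp only [map_add, hx, hy]
    | tmul h x => rw [quadEmb_tmul, rho12_cls]; rfl
  intro z z' h
  have h1 := nu4_injective ((key z).symm.trans ((congrArg (rho12 k H) h).trans (key z')))
  have h2 := congrArg ((antipode2 k H).lTensor H) h1
  have h3 : antipode2 k H ∘ₗ antipode2 k H = LinearMap.id :=
    LinearMap.ext antipode2_antipode2
  rwa [← LinearMap.comp_apply, ← LinearMap.comp_apply, ← LinearMap.lTensor_comp, h3,
    LinearMap.lTensor_id, LinearMap.id_apply, LinearMap.id_apply] at h2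

theorem quadCoef_unfourier (s t : ι) (z : H ⊗[k] (V ⊗[k] V)) :
    quadCoef e s t (unfourier k H (DTensor k H V V)
      ((DTensor.plain k H V V).symm.toLinearMap.lTensor H z)) =
      quadEmb ((tcoef e e s t).lTensor H z) := by
  induction z using TensorProduct.induction_on with
  | zero => simp
  | add x y hx hy => simp only [map_add, hx, hy]
  | tmul h τ =>
    rw [LinearMap.lTensor_tmul, unfourier_tmul, quadCoef_mk]
    rfl

theorem lTensor_tcoef_ext {z z' : H ⊗[k] (V ⊗[k] V)}
    (h : ∀ s t, (tcoef e e s t).lTensor H z = (tcoef e e s t).lTensor H z') : z = z' := by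
  have key := map_ext_of_families (fun _ : Unit => (LinearMap.id : H →ₗ[k] H))
    (fun _ => LinearMap.id) (by simp) (fun p : ι × ι => tcoef (k := k) e e p.1 p.2)
    (fun p : ι × ι => (act2 k H V V).toLinearMap.flip (e p.1 ⊗ₜ e p.2))
    (fun t => (Fintype.sum_prod_type _).trans (sum_act2_tcoef e e t))
  rw [← key z, ← key z']
  have h' : ∀ s t, TensorProduct.map (LinearMap.id : H →ₗ[k] H) (tcoef e e s t) z =
    TensorProduct.map LinearMap.id (tcoef e e s t) z' := h
  simp only [h']

theorem quadCoef_ext {y y' : PT2 k H (DTensor k H V V)}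
    (h : ∀ s t, quadCoef e s t y = quadCoef e s t y') : y = y' := by
  have key : ∀ y : PT2 k H (DTensor k H V V), ∃ z, y = unfourier k H (DTensor k H V V)
      ((DTensor.plain k H V V).symm.toLinearMap.lTensor H z) := fun y =>
    ⟨(DTensor.plain k H V V).toLinearMap.lTensor H (fourier k H _ y), by
      rw [← LinearMap.comp_apply (LinearMap.lTensor _ _), ← LinearMap.lTensor_comp]
      simp [unfourier_fourier]⟩
  obtain ⟨z, rfl⟩ := key y
  obtain ⟨z', rfl⟩ := key y'
  have hz : z = z' := lTensor_tcoef_ext e fun s t => quadEmb_injective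
    (by rw [← quadCoef_unfourier, h, quadCoef_unfourier])
  rw [hz]

theorem quadCoef_swap (s t : ι) (y : PT2 k H (DTensor k H V V)) :
    quadCoef e s t (swap _ y) = rho12 k H (quadCoef e s t y) := by
  induction y using Ext.induction with
  | h0 => simp
  | h2 x y hx hy => simp only [map_add, hx, hy]
  | h1 a m => rw [swap_mk, quadCoef_mk, quadCoef_mk, glue_flip_left]

theorem quadCoef_pt2Map (μ : PolyLin k H V V V) (δ : V →ₗ[H] DTensor k H V V) (i j s t : ι) :
    quadCoef e s t (pt2Map δ (μ.toLin (e i) (e j))) =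
      ∑ m, glue k H (μ.table e i j m) (dualTable e δ s t m) := by
  rw [← μ.sum_table e i j, map_sum, map_sum]
  refine Finset.sum_congr rfl fun m _ => ?_
  rw [pt2Map, Ext.map_mk]
  rfl

variable (k H) in
/-- The transposition of the outer arguments of a trilinear value, on `(1 ⊗ x) ⊗_H 1`. -/
def flip13 (x : H ⊗[k] H) : H ⊗[k] H :=
  nrm3 k H (tau12 k H (tau23 k H (tau12 k H (cls3 k H (1 ⊗ₜ x)))))

theorem lTensor_antipode_fourierHH (u g : H) :
    (antipode k).lTensor H (fourierHH k H (u ⊗ₜ g)) = (u ⊗ₜ 1) * comul2 k H (antipode k g) := by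
  rw [← antipode2_comul2]
  change (antipode k).lTensor H ((u ⊗ₜ 1) *
    TensorProduct.map (antipode k) LinearMap.id (comul2 k H g)) = _
  induction comul2 k H g using TensorProduct.induction_on with
  | zero => simp
  | add x y hx hy => simp only [map_add, mul_add, hx, hy]
  | tmul a b => simp

/-- Up to an antipode, the Fourier transform is the transposition of the outer arguments.  This is
what makes the action on `V ⊗ V`, defined through `(h ⊗ 1) ⊗_H m`, visible on trilinear forms. -/
theorem flip13_eq (x : H ⊗[k] H) : flip13 k H x = (antipode k).lTensor H (fourierHH k H x) := by
  rw [flip13]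
  induction x using TensorProduct.induction_on with
  | zero => simp
  | add x y hx hy => simp only [map_add, TensorProduct.tmul_add, hx, hy]
  | tmul u g =>
    have h1 : tau12 k H (tau23 k H (tau12 k H (cls3 k H (1 ⊗ₜ (u ⊗ₜ g))))) =
        cls3 k H (g ⊗ₜ (u ⊗ₜ 1)) := by
      rw [tau12_cls, tau23_cls, tau12_cls]; rfl
    rw [h1, nrm3_cls, lTensor_antipode_fourierHH]

theorem lTensor_antipode_fourierHH_mul (p : H) (x : H ⊗[k] H) :
    (antipode k).lTensor H (fourierHH k H ((1 ⊗ₜ p) * x)) =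
      flip13 k H x * comul2 k H (antipode k p) := by
  rw [flip13_eq]
  induction x using TensorProduct.induction_on with
  | zero => simp
  | add x y hx hy => simp only [map_add, mul_add, add_mul, hx, hy]
  | tmul u g =>
    rw [Algebra.TensorProduct.tmul_mul_tmul, one_mul, lTensor_antipode_fourierHH,
      lTensor_antipode_fourierHH, antipode_mul_antidistrib, map_mul, mul_assoc]

/-- The part of the action of `a` on `V ⊗ V` that acts on the first factor. -/
def firstLeg (μ : PolyLin k H V V V) (a : V) : V ⊗[k] V →ₗ[k] H ⊗[k] (V ⊗[k] V) :=
  (TensorProduct.assoc k H V V).toLinearMap ∘ₗ (adF μ a).rTensor V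

theorem leibniz_eq (μ : PolyLin k H V V V) (a : V) (t : V ⊗[k] V) :
    leibniz (adF μ a) (adF μ a) t = firstLeg μ a t +
      (TensorProduct.comm k V V).toLinearMap.lTensor H
        (firstLeg μ a (TensorProduct.comm k V V t)) := by
  induction t using TensorProduct.induction_on with
  | zero => simp
  | add x y hx hy => rw [map_add, hx, hy]; simp only [map_add]; abel
  | tmul x y =>
    rw [leibniz_tmul]
    congr 1
    change _ = (TensorProduct.comm k V V).toLinearMap.lTensor H
      (TensorProduct.assoc k H V V (adF μ a y ⊗ₜ x))
    induction adF μ a y using TensorProduct.induction_on with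
    | zero => simp
    | add x y hx hy => simp only [map_add, TensorProduct.tmul_add, TensorProduct.add_tmul, hx, hy]
    | tmul p q => rfl

theorem lTensor_tcoef_comm (s t : ι) (z : H ⊗[k] (V ⊗[k] V)) :
    quadEmb ((tcoef e e s t).lTensor H ((TensorProduct.comm k V V).toLinearMap.lTensor H z)) =
      rho34 k H (quadEmb ((tcoef e e t s).lTensor H z)) := by
  induction z using TensorProduct.induction_on with
  | zero => simp
  | add x y hx hy => simp only [map_add, hx, hy]
  | tmul h τ =>
    rw [LinearMap.lTensor_tmul, LinearMap.lTensor_tmul, LinearMap.lTensor_tmul, quadEmb_tmul,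
      quadEmb_tmul, rho34_cls, LinearEquiv.coe_coe, tcoef_comm, antipode2_flip2]
    rfl

/-- The coordinates of the action on the first factor. -/
theorem firstLeg_coef (μ : PolyLin k H V V V) (i s n : ι) (t : V ⊗[k] V) :
    quadEmb ((tcoef e e s n).lTensor H (firstLeg μ (e i) t)) =
      ∑ m, rho23 k H (glue k H (flip13 k H (μ.table e i m s))
        (nrm3 k H (tau12 k H (cls3 k H (1 ⊗ₜ antipode2 k H (tcoef e e m n t)))))) := by
  induction t using TensorProduct.induction_on with
  | zero => simp
  | add x y hx hy =>
    simp only [map_add, TensorProduct.tmul_add, hx, hy, Finset.sum_add_distrib]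
  | tmul v w =>
    have h1 : (tcoef e e s n).lTensor H (firstLeg μ (e i) (v ⊗ₜ w)) =
        TensorProduct.assoc k H H H
          ((kcoord k e s).lTensor H (adF μ (e i) v) ⊗ₜ e.repr w n) := by
      change (tcoef e e s n).lTensor H (TensorProduct.assoc k H V V (adF μ (e i) v ⊗ₜ w)) = _
      induction adF μ (e i) v using TensorProduct.induction_on with
      | zero => simp
      | add x y hx hy => simp only [map_add, TensorProduct.add_tmul, hx, hy]
      | tmul a b => rfl
    have h2 : Ext.coef (comul2 k H) e s (μ.toLin (e i) v) =
        ∑ m, (1 ⊗ₜ e.repr v m) * μ.table e i m s := by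
      conv_lhs => rw [← e.sum_repr v, map_sum, map_sum]
      refine Finset.sum_congr rfl fun m _ => ?_
      rw [μ.smul_right, Ext.coef_smul]
      rfl
    have h3 : ∀ (z : H ⊗[k] H) (q : H), quadEmb (TensorProduct.assoc k H H H (z ⊗ₜ q)) =
        rho23 k H (glue k H ((antipode k).lTensor H z) (1 ⊗ₜ antipode k q)) := by
      intro z q
      induction z using TensorProduct.induction_on with
      | zero => simp
      | add x y hx hy => simp only [map_add, TensorProduct.add_tmul, LinearMap.add_apply, hx, hy]
      | tmul a b => rw [LinearMap.lTensor_tmul, glue_tmul, rho23_cls]; rfl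
    have h4 : ∀ p q : H, nrm3 k H (tau12 k H (cls3 k H (1 ⊗ₜ antipode2 k H (p ⊗ₜ q)))) =
        (1 ⊗ₜ antipode k q) * comul2 k H (antipode k (antipode k p)) := by
      intro p q
      rw [tau12_cls, ← nrm3_cls]
      rfl
    rw [h1, h3, adF, LinearMap.comp_apply, lTensor_kcoord_fourier, h2, map_sum, map_sum, map_sum,
      LinearMap.sum_apply, map_sum]
    refine Finset.sum_congr rfl fun m _ => ?_
    rw [lTensor_antipode_fourierHH_mul, glue_mul_comul, tcoef_tmul, h4]

/-- The coordinates of the action of `e_i` on `δ(e_j)` through the first factor, for structure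
constants `c` of a pseudobracket and `f` of a cobracket. -/
def actTable (c f : ι → ι → ι → H ⊗[k] H) (i j s t : ι) : F4 k H :=
  ∑ m, glue k H (flip13 k H (c i m s)) (nrm3 k H (tau12 k H (cls3 k H (1 ⊗ₜ f m t j))))

/-- The difference of the two sides of the cocycle condition in coordinates. -/
def cocycleDefect (c f : ι → ι → ι → H ⊗[k] H) (i j s t : ι) : F4 k H :=
  (rho23 k H (actTable c f i j s t) - rho34 k H (rho23 k H (actTable c f i j t s))) -
    rho12 k H (rho23 k H (actTable c f j i s t) - rho34 k H (rho23 k H (actTable c f j i t s))) -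
    ∑ m, glue k H (c i j m) (f s t m)

/-- The coordinates of `e_i * δ(e_j)`.  By skew-symmetry of the cobracket, the action on the second
factor is the flip of that on the first, which gives the second term. -/
theorem quadCoef_tensorAct (μ : PolyLin k H V V V) {δ : V →ₗ[H] DTensor k H V V}
    (hδ : ∀ v, TensorProduct.comm k V V (plainCobracket δ v) = - plainCobracket δ v)
    (i j s t : ι) :
    quadCoef e s t (tensorAct μ μ (e i) (δ (e j))) =
      rho23 k H (actTable (μ.table e) (dualTable e δ) i j s t) -
        rho34 k H (rho23 k H (actTable (μ.table e) (dualTable e δ) i j t s)) := by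
  have h0 : tensorAct μ μ (e i) (δ (e j)) = unfourier k H (DTensor k H V V)
      ((DTensor.plain k H V V).symm.toLinearMap.lTensor H
        (leibniz (adF μ (e i)) (adF μ (e i)) (plainCobracket δ (e j)))) := rfl
  rw [h0, quadCoef_unfourier, leibniz_eq, map_add, map_add, lTensor_tcoef_comm, hδ, map_neg,
    map_neg, map_neg, map_neg, ← sub_eq_add_neg, firstLeg_coef, firstLeg_coef, ← map_sum,
    ← map_sum]
  rfl

theorem tensorAct_smul_left (μ : PolyLin k H V V V) (g : H) (a : V) (t : DTensor k H V V) :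
    tensorAct μ μ (g • a) t = (g ⊗ₜ[k] (1 : H) : H ⊗[k] H) • tensorAct μ μ a t := by
  have hF : ∀ v, adF μ (g • a) v = (LinearMap.mulLeft k g).rTensor V (adF μ a v) := by
    intro v
    rw [← fourier_unfourier ((LinearMap.mulLeft k g).rTensor V _), adF, LinearMap.comp_apply,
      μ.smul_left, ← unfourier_adF μ a v]
    congr 1
    induction adF μ a v using TensorProduct.induction_on with
    | zero => simp
    | add x y hx hy => simp only [map_add, smul_add, hx, hy]
    | tmul p q =>
      rw [LinearMap.rTensor_tmul, unfourier_tmul, unfourier_tmul, Ext.smul_mk,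
        Algebra.TensorProduct.tmul_mul_tmul, one_mul]
      rfl
  have hL : ∀ t : V ⊗[k] V, leibniz (adF μ (g • a)) (adF μ (g • a)) t =
      (LinearMap.mulLeft k g).rTensor _ (leibniz (adF μ a) (adF μ a) t) := by
    intro t
    induction t using TensorProduct.induction_on with
    | zero => simp
    | add x y hx hy => simp only [map_add, hx, hy]
    | tmul x y =>
      rw [leibniz_tmul, leibniz_tmul, hF, hF, map_add]
      congr 1
      · induction adF μ a x using TensorProduct.induction_on with
        | zero => simp
        | add x y hx hy => simp only [map_add, TensorProduct.add_tmul, hx, hy]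
        | tmul p q => rfl
      · induction adF μ a y using TensorProduct.induction_on with
        | zero => simp
        | add x y hx hy => simp only [map_add, TensorProduct.tmul_add, hx, hy]
        | tmul p q => rfl
  change unfourier k H (DTensor k H V V) ((DTensor.plain k H V V).symm.toLinearMap.lTensor H
    (leibniz (adF μ (g • a)) (adF μ (g • a)) (DTensor.plain k H V V t))) =
    (g ⊗ₜ[k] (1 : H) : H ⊗[k] H) • unfourier k H (DTensor k H V V)
      ((DTensor.plain k H V V).symm.toLinearMap.lTensor H
        (leibniz (adF μ a) (adF μ a) (DTensor.plain k H V V t)))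
  rw [hL]
  induction leibniz (adF μ a) (adF μ a) (DTensor.plain k H V V t)
    using TensorProduct.induction_on with
  | zero => simp
  | add x y hx hy => simp only [map_add, smul_add, hx, hy]
  | tmul p q =>
    rw [LinearMap.rTensor_tmul, LinearMap.lTensor_tmul, LinearMap.lTensor_tmul,
      unfourier_tmul, unfourier_tmul, Ext.smul_mk, Algebra.TensorProduct.tmul_mul_tmul,
      one_mul]
    rfl

theorem tensorAct_add_left (μ : PolyLin k H V V V) (a a' : V) (t : DTensor k H V V) :
    tensorAct μ μ (a + a') t = tensorAct μ μ a t + tensorAct μ μ a' t := by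
  simp only [tensorAct, map_add, LinearMap.comp_add, LinearMap.add_comp, LinearMap.rTensor_add,
    LinearMap.lTensor_add, LinearMap.add_apply]
  abel

theorem tensorAct_zero_left (μ : PolyLin k H V V V) (t : DTensor k H V V) :
    tensorAct μ μ 0 t = 0 := by
  have h := tensorAct_smul_left μ 0 0 t
  rwa [zero_smul, TensorProduct.zero_tmul, zero_smul] at h

theorem pt2Map_smul {W : Type*} [AddCommGroup W] [Module k W] [Module H W] [IsScalarTower k H W]
    (f : V →ₗ[H] W) (x : H ⊗[k] H) (y : PT2 k H V) : pt2Map f (x • y) = x • pt2Map f y :=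
  Ext.map_smul _ _ _ _ _

/-- The cocycle condition need only be checked on a basis, where it is an identity of tables. -/
theorem cocycle_iff_table (μ : PolyLin k H V V V) {δ : V →ₗ[H] DTensor k H V V}
    (hδ : ∀ v, TensorProduct.comm k V V (plainCobracket δ v) = - plainCobracket δ v) :
    (∀ a b, tensorAct μ μ a (δ b) - swap (DTensor k H V V) (tensorAct μ μ b (δ a)) =
      pt2Map δ (μ.toLin a b)) ↔
      ∀ i j s t, cocycleDefect (μ.table e) (dualTable e δ) i j s t = 0 := by
  have h1 : ∀ i j s t, cocycleDefect (μ.table e) (dualTable e δ) i j s t =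
      quadCoef e s t (tensorAct μ μ (e i) (δ (e j)) -
        swap (DTensor k H V V) (tensorAct μ μ (e j) (δ (e i))) -
          pt2Map δ (μ.toLin (e i) (e j))) := by
    intro i j s t
    rw [map_sub, map_sub, quadCoef_swap, quadCoef_tensorAct e μ hδ, quadCoef_tensorAct e μ hδ,
      quadCoef_pt2Map]
    rfl
  constructor
  · intro h i j s t
    rw [h1, h, sub_self, map_zero]
  · intro h a b
    induction a using basis_induction e with
    | zero => simp [tensorAct_zero_left]
    | add v w hv hw =>
      simp only [map_add, tensorAct_add_left, LinearMap.add_apply, ← hv, ← hw]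
      abel
    | smul g v hv =>
      rw [tensorAct_smul_left, map_smul, tensorAct_smul, swap_smul, μ.smul_left, pt2Map_smul, ← hv,
        smul_sub]
    | basis i =>
      induction b using basis_induction e with
      | zero => simp [tensorAct_zero_left]
      | add v w hv hw =>
        simp only [map_add, tensorAct_add_left, ← hv, ← hw]
        abel
      | smul g v hv =>
        rw [tensorAct_smul_left, map_smul, tensorAct_smul, swap_smul, μ.smul_right, pt2Map_smul,
          ← hv, smul_sub]
      | basis j =>
        refine sub_eq_zero.1 (quadCoef_ext e fun s t => ?_)
        rw [← h1, h, map_zero]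

end Cocycle

/-! ### The structure constants of the double -/

section DoubleTables

open Coalgebra HopfAlgebra

variable {k : Type*} [Field k] {H : Type*} [Ring H] [HopfAlgebra k H] [IsCocomm k H]
variable {ι : Type*} [Fintype ι]

/-- Half the sum of the signs of two indices of a basis of `L ⊕ L*`, the sign being `1` on `L` and
`-1` on `L*`. -/
def weight : ι ⊕ ι → ι ⊕ ι → ℤ
  | .inl _, .inl _ => 1
  | .inr _, .inr _ => -1
  | _, _ => 0

/-- The indicator of the indices of `L`. -/
def leftInd : ι ⊕ ι → ℤ
  | .inl _ => 1
  | .inr _ => 0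

theorem weight_eq (s t : ι ⊕ ι) : weight s t = leftInd s + leftInd t - 1 := by
  rcases s with s | s <;> rcases t with t | t <;> rfl

theorem leftInd_swap (s : ι ⊕ ι) : leftInd s.swap = 1 - leftInd s := by
  rcases s with s | s <;> rfl

theorem weight_comm (s t : ι ⊕ ι) : weight s t = weight t s := by
  rw [weight_eq, weight_eq]
  ring

/-- The structure constants of the cobracket `δ_L - δ_{L*}` of the double. -/
def doubleCotable (Φ : ι ⊕ ι → ι ⊕ ι → ι ⊕ ι → F3 k H) (s t m : ι ⊕ ι) : H ⊗[k] H :=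
  weight s t • nrm3 k H (Φ m s.swap t.swap)

variable {Φ : ι ⊕ ι → ι ⊕ ι → ι ⊕ ι → F3 k H}

/-- The gluing `selfGlue`, summed over the basis of `L` only. -/
def halfGlue (Φ : ι ⊕ ι → ι ⊕ ι → ι ⊕ ι → F3 k H) (a b c d : ι ⊕ ι) : F4 k H :=
  ∑ σ, leftInd σ • glue k H (nrm3 k H (Φ σ a b)) (nrm3 k H (Φ σ.swap c d))

/-- The flip of the summation index exchanges `L` with `L*`, hence the sum over the basis of `L` with
the complementary sum. -/
theorem halfGlue_symm (a b c d : ι ⊕ ι) : halfGlue Φ c d a b =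
    rho23 k H (rho12 k H (rho34 k H (rho23 k H
      (selfGlue Sum.swap Φ a b c d - halfGlue Φ a b c d)))) := by
  have h1 : selfGlue Sum.swap Φ a b c d - halfGlue Φ a b c d =
      ∑ σ, leftInd σ.swap • glue k H (nrm3 k H (Φ σ a b)) (nrm3 k H (Φ σ.swap c d)) := by
    simp only [selfGlue, halfGlue, leftInd_swap, sub_smul, one_smul, Finset.sum_sub_distrib]
  rw [h1]
  simp only [halfGlue, map_sum, map_zsmul, ← glue_symm]
  refine Fintype.sum_equiv (Equiv.sumComm ι ι) _ _ fun σ => ?_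
  simp [Equiv.sumComm]

/-- The cobracket weights the indices by `weight`, so the action of the double on its cobracket is a
sum over the basis of `L` only, corrected by a full sum when `t` is in `L*`. -/
theorem actTable_double (hΦ : IsAlternating Φ) (i j s t : ι ⊕ ι) :
    actTable (alternatingTable Sum.swap Φ) (doubleCotable Φ) i j s t =
      halfGlue Φ i s.swap j t.swap + (leftInd t - 1) • selfGlue Sum.swap Φ i s.swap j t.swap := by
  rw [actTable, halfGlue, selfGlue, Finset.smul_sum, ← Finset.sum_add_distrib]
  refine Finset.sum_congr rfl fun m _ => ?_
  have h1 : flip13 k H (alternatingTable Sum.swap Φ i m s) = - nrm3 k H (Φ m i s.swap) := by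
    rw [flip13, alternatingTable, cls_nrm3, ← map_neg]
    congr 1
    rw [hΦ.swap_left i m, hΦ.swap_right i s.swap, hΦ.swap_left s.swap i]
    simp only [map_neg, neg_neg]
  have h2 : nrm3 k H (tau12 k H (cls3 k H (1 ⊗ₜ doubleCotable Φ m t j))) =
      - (weight m t • nrm3 k H (Φ m.swap j t.swap)) := by
    rw [doubleCotable, TensorProduct.tmul_smul, map_zsmul, map_zsmul, map_zsmul, cls_nrm3,
      hΦ.swap_left j m.swap, map_neg, smul_neg, neg_neg]
  rw [h1, h2]
  simp only [map_neg, LinearMap.neg_apply, map_zsmul]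
  rw [← add_smul, weight_eq, smul_neg, neg_neg]
  congr 1
  ring

/-- The cocycle condition of the double is a consequence of its Jacobi identity. -/
theorem cocycleDefect_double (hΦ : IsAlternating Φ) (i j s t : ι ⊕ ι) :
    cocycleDefect (alternatingTable Sum.swap Φ) (doubleCotable Φ) i j s t =
      - (weight s t • jacobiator Sum.swap Φ i j s.swap t.swap) := by
  have h1 : ∑ m, glue k H (alternatingTable Sum.swap Φ i j m) (doubleCotable Φ s t m) =
      weight s t • selfGlue Sum.swap Φ i j s.swap t.swap := by
    rw [selfGlue, Finset.smul_sum]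
    refine Fintype.sum_equiv (Equiv.sumComm ι ι) _ _ fun m => ?_
    simp only [doubleCotable, alternatingTable, Equiv.sumComm_apply, Sum.swap_swap, map_zsmul]
  rw [cocycleDefect, h1]
  simp only [actTable_double hΦ, halfGlue_symm (Φ := Φ) i s.swap j t.swap,
    halfGlue_symm (Φ := Φ) i t.swap j s.swap,
    selfGlue_symm (Φ := Φ) Sum.swap_swap i s.swap j t.swap,
    selfGlue_symm (Φ := Φ) Sum.swap_swap i t.swap j s.swap, jacobiator]
  simp only [map_add, map_sub, map_zsmul, rho23_rho23, rho12_rho34, rho12_rho12, rho34_rho34,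
    weight_eq]
  module

variable {c f : ι → ι → ι → H ⊗[k] H}

/-- An alternating form on `L ⊕ L*` vanishing on `L` and on `L*` is determined by its values on
`L* × L × L` and `L × L* × L*`. -/
theorem IsAlternating.eq_doubleForm (hΦ : IsAlternating Φ)
    (hl : ∀ a b d, Φ (.inl a) (.inl b) (.inl d) = 0)
    (hr : ∀ a b d, Φ (.inr a) (.inr b) (.inr d) = 0)
    (hc : ∀ m i j, Φ (.inr m) (.inl i) (.inl j) = cls3 k H (1 ⊗ₜ c i j m))
    (hf : ∀ m i j, Φ (.inl m) (.inr i) (.inr j) = cls3 k H (1 ⊗ₜ f i j m)) :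
    Φ = doubleForm c f := by
  funext a b d
  rcases a with a | a <;> rcases b with b | b <;> rcases d with d | d <;>
    simp only [doubleForm, hl, hr, hc, hf]
  · rw [hΦ.rotate (.inr d), hc]
  · rw [hΦ.swap_left (.inr b), hc]
  · rw [hΦ.swap_left (.inl b), hf]
  · rw [hΦ.rotate (.inl d), hf]

theorem doubleForm_swap (c f : ι → ι → ι → H ⊗[k] H) (a b d : ι ⊕ ι) :
    doubleForm f c a b d = doubleForm c f a.swap b.swap d.swap := by
  rcases a with a | a <;> rcases b with b | b <;> rcases d with d | d <;> rfl

theorem alternatingTable_inl (c f : ι → ι → ι → H ⊗[k] H) (i j m : ι) :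
    alternatingTable Sum.swap (doubleForm c f) (.inl i) (.inl j) (.inl m) = c i j m :=
  nrm3_cls_one _

theorem alternatingTable_inr (c f : ι → ι → ι → H ⊗[k] H) (i j m : ι) :
    alternatingTable Sum.swap (doubleForm c f) (.inr i) (.inr j) (.inr m) = f i j m :=
  nrm3_cls_one _

theorem alternatingTable_inl_inr (c f : ι → ι → ι → H ⊗[k] H) (i j m : ι) :
    alternatingTable Sum.swap (doubleForm c f) (.inl i) (.inl j) (.inr m) = 0 :=
  map_zero _

theorem alternatingTable_inr_inl (c f : ι → ι → ι → H ⊗[k] H) (i j m : ι) :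
    alternatingTable Sum.swap (doubleForm c f) (.inr i) (.inr j) (.inl m) = 0 :=
  map_zero _

theorem doubleCotable_inl (c f : ι → ι → ι → H ⊗[k] H) (i j m : ι) :
    doubleCotable (doubleForm c f) (.inl i) (.inl j) (.inl m) = f i j m :=
  (one_smul ℤ _).trans (nrm3_cls_one _)

theorem doubleCotable_inr (c f : ι → ι → ι → H ⊗[k] H) (i j m : ι) :
    doubleCotable (doubleForm c f) (.inr i) (.inr j) (.inr m) = - c i j m :=
  (neg_one_smul ℤ _).trans (congrArg _ (nrm3_cls_one _))

theorem doubleCotable_inl_inr (c f : ι → ι → ι → H ⊗[k] H) (i j : ι) (m : ι ⊕ ι) :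
    doubleCotable (doubleForm c f) (.inl i) (.inr j) m = 0 := zero_smul ℤ _

theorem doubleCotable_inr_inl (c f : ι → ι → ι → H ⊗[k] H) (i j : ι) (m : ι ⊕ ι) :
    doubleCotable (doubleForm c f) (.inr i) (.inl j) m = 0 := zero_smul ℤ _

theorem doubleCotable_inl_inl_inr (c f : ι → ι → ι → H ⊗[k] H) (i j m : ι) :
    doubleCotable (doubleForm c f) (.inl i) (.inl j) (.inr m) = 0 :=
  (one_smul ℤ _).trans (map_zero _)

theorem doubleCotable_inr_inr_inl (c f : ι → ι → ι → H ⊗[k] H) (i j m : ι) :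
    doubleCotable (doubleForm c f) (.inr i) (.inr j) (.inl m) = 0 :=
  (neg_one_smul ℤ _).trans (by rw [show doubleForm c f (.inl m) (Sum.inr i).swap
    (Sum.inr j).swap = 0 from rfl, map_zero, neg_zero])

theorem actTable_doubleForm_inl (i j s t : ι) :
    actTable (alternatingTable Sum.swap (doubleForm c f)) (doubleCotable (doubleForm c f))
      (.inl i) (.inl j) (.inl s) (.inl t) = actTable c f i j s t := by
  simp only [actTable, Fintype.sum_sum_type, alternatingTable_inl, doubleCotable_inl,
    doubleCotable_inr_inl, TensorProduct.tmul_zero, map_zero, Finset.sum_const_zero, add_zero]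

theorem actTable_doubleForm_inr (i j s t : ι) :
    actTable (alternatingTable Sum.swap (doubleForm c f)) (doubleCotable (doubleForm c f))
      (.inr i) (.inr j) (.inr s) (.inr t) = - actTable f c i j s t := by
  simp only [actTable, Fintype.sum_sum_type, alternatingTable_inr, doubleCotable_inr,
    doubleCotable_inl_inr, TensorProduct.tmul_zero, TensorProduct.tmul_neg, map_zero, map_neg,
    Finset.sum_const_zero, zero_add, Finset.sum_neg_distrib]

theorem cocycleDefect_doubleForm_inl (i j s t : ι) :
    cocycleDefect (alternatingTable Sum.swap (doubleForm c f)) (doubleCotable (doubleForm c f))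
      (.inl i) (.inl j) (.inl s) (.inl t) = cocycleDefect c f i j s t := by
  simp only [cocycleDefect, actTable_doubleForm_inl, Fintype.sum_sum_type, alternatingTable_inl,
    alternatingTable_inl_inr, doubleCotable_inl, map_zero, LinearMap.zero_apply,
    Finset.sum_const_zero, add_zero]

theorem cocycleDefect_doubleForm_inr (i j s t : ι) :
    cocycleDefect (alternatingTable Sum.swap (doubleForm c f)) (doubleCotable (doubleForm c f))
      (.inr i) (.inr j) (.inr s) (.inr t) = - cocycleDefect f c i j s t := by
  simp only [cocycleDefect, actTable_doubleForm_inr, Fintype.sum_sum_type, alternatingTable_inr,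
    alternatingTable_inr_inl, doubleCotable_inr, map_zero, LinearMap.zero_apply, map_neg,
    Finset.sum_neg_distrib, Finset.sum_const_zero, zero_add]
  simp only [map_sub, map_neg]
  abel

/-- The structure constants of a Lie pseudo-bialgebra: those of the pseudobracket and of the
pseudobracket dual to the cobracket. -/
structure IsBialgTable (c f : ι → ι → ι → H ⊗[k] H) : Prop where
  skew : ∀ i j m, c j i m = - flip2 k H (c i j m)
  coskew : ∀ i j m, f j i m = - flip2 k H (f i j m)
  jacobi : TableJacobi c
  cojacobi : TableJacobi f
  cocycle : ∀ i j s t, cocycleDefect c f i j s t = 0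

/-- With three arguments in `L`, the jacobiator of the double is that of `L`. -/
theorem jacobiator_inr_inl_inl_inl (hc : ∀ i j m, c j i m = - flip2 k H (c i j m))
    (hf : ∀ i j m, f j i m = - flip2 k H (f i j m)) (hJ : TableJacobi c) (s i j l : ι) :
    jacobiator Sum.swap (doubleForm c f) (.inr s) (.inl i) (.inl j) (.inl l) = 0 := by
  refine (tableJacobi_iff (bar := Sum.swap) (doubleForm_isAlternating hc hf) (.inl i) (.inl j)
    (.inl l) (.inl s)).1 ?_
  have h := hJ i j l s
  simpa only [Fintype.sum_sum_type, alternatingTable_inl, alternatingTable_inl_inr, map_zero,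
    zero_mul, Finset.sum_const_zero, add_zero] using h

theorem selfGlue_swap_index (a b d g : ι ⊕ ι) : selfGlue Sum.swap (doubleForm f c) a b d g =
    selfGlue Sum.swap (doubleForm c f) a.swap b.swap d.swap g.swap := by
  simp only [selfGlue, doubleForm_swap c f]
  refine Fintype.sum_equiv (Equiv.sumComm ι ι) _ _ fun σ => ?_
  simp [Equiv.sumComm]

/-- The axioms of a Lie pseudo-bialgebra give the Jacobi identity of its double. -/
theorem IsBialgTable.jacobiator (h : IsBialgTable c f) (a b d g : ι ⊕ ι) :
    jacobiator Sum.swap (doubleForm c f) a b d g = 0 := by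
  have hΦ := doubleForm_isAlternating h.skew h.coskew
  refine jacobiator_eq_zero hΦ (fun _ _ _ => rfl) (fun _ _ _ => rfl)
    (jacobiator_inr_inl_inl_inl h.skew h.coskew h.jacobi) ?_ ?_ a b d g
  · intro i j s t
    have h1 := cocycleDefect_double hΦ (.inl i) (.inl j) (.inl s) (.inl t)
    rw [cocycleDefect_doubleForm_inl, h.cocycle] at h1
    simpa [weight] using h1.symm
  · intro s i j l
    have h1 := jacobiator_inr_inl_inl_inl h.coskew h.skew h.cojacobi s i j l
    simpa only [PseudoBialg.jacobiator, selfGlue_swap_index (c := c) (f := f), Sum.swap_inl, Sum.swap_inr] using h1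

/-- The dual of a Lie pseudo-bialgebra is a Lie pseudo-bialgebra. -/
theorem IsBialgTable.dual (h : IsBialgTable c f) : IsBialgTable f c where
  skew := h.coskew
  coskew := h.skew
  jacobi := h.cojacobi
  cojacobi := h.jacobi
  cocycle i j s t := by
    have h1 := cocycleDefect_double (doubleForm_isAlternating h.skew h.coskew)
      (.inr i) (.inr j) (.inr s) (.inr t)
    rw [cocycleDefect_doubleForm_inr, h.jacobiator, smul_zero, neg_zero] at h1
    exact neg_eq_zero.1 h1

/-- The double of a Lie pseudo-bialgebra is a Lie pseudo-bialgebra. -/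
theorem IsBialgTable.double (h : IsBialgTable c f) : IsBialgTable
    (alternatingTable Sum.swap (doubleForm c f)) (doubleCotable (doubleForm c f)) where
  skew i j m := (doubleForm_isAlternating h.skew h.coskew).nrm3_swap _ _ _
  coskew i j m := by
    rw [doubleCotable, doubleCotable, (doubleForm_isAlternating h.skew h.coskew).nrm3_swap,
      weight_comm, map_zsmul, smul_neg]
  jacobi a b d s :=
    (tableJacobi_iff (doubleForm_isAlternating h.skew h.coskew) a b d s).2 (h.jacobiator _ _ _ _)
  cojacobi a b d s := by
    rcases a with a | a <;> rcases b with b | b <;> rcases d with d | d <;> rcases s with s | s <;>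
      simp only [Fintype.sum_sum_type, doubleCotable_inl, doubleCotable_inr, doubleCotable_inl_inr,
        doubleCotable_inr_inl, doubleCotable_inl_inl_inr, doubleCotable_inr_inr_inl, map_zero,
        map_neg, mul_neg, neg_mul, neg_neg, zero_mul, mul_zero, neg_zero, Finset.sum_const_zero,
        add_zero, zero_add, sub_zero]
    · exact h.cojacobi a b d s
    · exact h.jacobi a b d s
  cocycle i j s t := by
    rw [cocycleDefect_double (doubleForm_isAlternating h.skew h.coskew), h.jacobiator, smul_zero,
      neg_zero]

end DoubleTables

/-! ### Lie pseudo-bialgebras and their structure constants -/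

section OfTable

open Coalgebra HopfAlgebra

variable {k : Type*} [Field k] {H : Type*} [Ring H] [HopfAlgebra k H] [IsCocomm k H]
variable {V : Type*} [AddCommGroup V] [Module k V] [Module H V] [IsScalarTower k H V]
variable {ι : Type*} [Fintype ι] (e : Module.Basis ι H V)

theorem LiePseudoBialgebra.isBialgTable (B : LiePseudoBialgebra k H V) :
    IsBialgTable (B.bracket.table e) (dualTable e B.cobracket) where
  skew i j m := (skew_iff_table e B.bracket).1 B.skew i j m
  coskew i j m := (coskew_iff_table e B.cobracket).1 B.coskew i j m
  jacobi := (jacobi_iff_table e B.bracket).1 B.jacobi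
  cojacobi := (coJacobi_iff_table e B.cobracket).1 fun v => sub_eq_zero.2 (B.cojacobi v)
  cocycle := (cocycle_iff_table e B.bracket B.coskew).1 B.cocycle

/-- The pseudobracket with given structure constants. -/
def bracketOfTable (c : ι → ι → ι → H ⊗[k] H) : PolyLin k H V V V :=
  PolyLin.ofBasis e e fun i j => ∑ s, Ext.mk (comul2 k H) (c i j s) (e s)

theorem table_bracketOfTable (c : ι → ι → ι → H ⊗[k] H) :
    (bracketOfTable e c).table e = c :=
  PolyLin.table_eq e fun i j => PolyLin.ofBasis_apply e e _ i j

theorem dualTable_cobracketOfTable (f : ι → ι → ι → H ⊗[k] H) :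
    dualTable e (cobracketOfTable e f) = f :=
  dualTable_eq e fun s => plainCobracket_cobracketOfTable e f s

theorem PolyLin.ext_table {μ μ' : PolyLin k H V V V} (h : μ.table e = μ'.table e) : μ = μ' :=
  PolyLin.ext_basis e e fun i j => by rw [← μ.sum_table e, ← μ'.sum_table e, h]

/-- The Lie pseudo-bialgebra with given structure constants. -/
def LiePseudoBialgebra.ofTable {c f : ι → ι → ι → H ⊗[k] H} (h : IsBialgTable c f) :
    LiePseudoBialgebra k H V where
  bracket := bracketOfTable e c
  skew := (skew_iff_table e _).2 (by rw [table_bracketOfTable]; exact h.skew)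
  jacobi := (jacobi_iff_table e _).2 (by rw [table_bracketOfTable]; exact h.jacobi)
  cobracket := cobracketOfTable e f
  coskew := (coskew_iff_table e (cobracketOfTable e f)).2
    (by rw [dualTable_cobracketOfTable]; exact h.coskew)
  cojacobi v := sub_eq_zero.1 ((coJacobi_iff_table e (cobracketOfTable e f)).2
    (by rw [dualTable_cobracketOfTable]; exact h.cojacobi) v)
  cocycle := (cocycle_iff_table e (bracketOfTable e c) ((coskew_iff_table e (cobracketOfTable e f)).2
    (by rw [dualTable_cobracketOfTable]; exact h.coskew))).2
      (by rw [table_bracketOfTable, dualTable_cobracketOfTable]; exact h.cocycle)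

end OfTable

/-! ### Dual structure constants are independent of the basis -/

section Pairing

open Coalgebra HopfAlgebra

variable {k : Type*} [Field k] {H : Type*} [Ring H] [HopfAlgebra k H] [IsCocomm k H]
variable {V W : Type*} [AddCommGroup V] [Module k V] [Module H V] [IsScalarTower k H V]
  [AddCommGroup W] [Module k W] [Module H W] [IsScalarTower k H W]

variable (k H) in
/-- The isomorphism `(H ⊗ H) ⊗_H k → H`, `(f ⊗ g) ⊗_H 1 ↦ g S(f)`. -/
def nrm2 : PT2 k H (Triv k H) →ₗ[k] H :=
  nrm (AlgHom.id k H) (comul2 k H) (fun h => by simp)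

theorem nrm2_cls (f g : H) : nrm2 k H (cls (comul2 k H) (f ⊗ₜ g)) = g * antipode k f :=
  nrm_cls _ _ _

theorem nrm2_injective : Function.Injective (nrm2 k H) := nrm_injective _

theorem nrm2_smul (f g : H) (y : PT2 k H (Triv k H)) :
    nrm2 k H ((f ⊗ₜ[k] g : H ⊗[k] H) • y) = g * nrm2 k H y * antipode k f :=
  nrm_smul _ _ _ _

theorem nrm3_emb23_smul (x : H ⊗[k] H) (y : F3 k H) :
    nrm3 k H (emb23 k H x • y) = x * nrm3 k H y := by
  have h1 := nrm_smul (φ := comul2 k H) (φ₁ := comul3 k H) comul3_def 1 x y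
  rwa [antipode_one, map_one, mul_one] at h1

theorem nrm3_tmul_one_smul (h : H) (y : F3 k H) :
    nrm3 k H ((h ⊗ₜ[k] (1 : H ⊗[k] H) : H ⊗[k] (H ⊗[k] H)) • y) =
      nrm3 k H y * comul2 k H (antipode k h) := by
  have h1 := nrm_smul (φ := comul2 k H) (φ₁ := comul3 k H) comul3_def h 1 y
  rwa [one_mul] at h1

/-- The evaluation `w ↦ ⟨w, a⟩` of a pairing, with values in `H`. -/
def pairEval (γ : PolyLin k H W V (Triv k H)) (a : V) : W →ₗ[k] H :=
  nrm2 k H ∘ₗ γ.toLin.flip a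

theorem pairEval_smul (γ : PolyLin k H W V (Triv k H)) (a : V) (h : H) (w : W) :
    pairEval γ a (h • w) = pairEval γ a w * antipode k h := by
  change nrm2 k H (γ.toLin (h • w) a) = nrm2 k H (γ.toLin w a) * _
  rw [γ.smul_left, nrm2_smul, one_mul]

theorem pairEval_smul_left (γ : PolyLin k H W V (Triv k H)) (a : V) (h : H) (w : W) :
    pairEval γ (h • a) w = h * pairEval γ a w := by
  change nrm2 k H (γ.toLin w (h • a)) = _ * nrm2 k H (γ.toLin w a)
  rw [γ.smul_right, nrm2_smul, antipode_one, mul_one]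

theorem map_pairEval_act2 (γ : PolyLin k H W V (Triv k H)) (a b : V) (x : H ⊗[k] H)
    (t : W ⊗[k] W) :
    TensorProduct.map (pairEval γ a) (pairEval γ b) (act2 k H W W x t) =
      TensorProduct.map (pairEval γ a) (pairEval γ b) t * antipode2 k H x := by
  induction x using TensorProduct.induction_on with
  | zero => simp
  | add x y hx hy => simp only [map_add, LinearMap.add_apply, mul_add, hx, hy]
  | tmul f g =>
    induction t using TensorProduct.induction_on with
    | zero => simp
    | add x y hx hy => simp only [map_add, add_mul, hx, hy]
    | tmul v w =>
      rw [act2_tmul, TensorProduct.map_tmul, pairEval_smul, pairEval_smul, TensorProduct.map_tmul,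
        TensorProduct.map_tmul, Algebra.TensorProduct.tmul_mul_tmul]

/-- The pairing `γ` of `W` and `V` intertwines the pseudobracket `μ` of `V` and the cobracket `δ`
of `W`: `⟨w, [a * b]⟩ = ⟨δ(w), a ⊗ b⟩`. -/
def IsDualPair (γ : PolyLin k H W V (Triv k H)) (μ : PolyLin k H V V V)
    (δ : W →ₗ[H] DTensor k H W W) : Prop :=
  ∀ w a b, nrm3 k H (γ.compRight w (μ.toLin a b)) =
    TensorProduct.map (pairEval γ a) (pairEval γ b) (plainCobracket δ w)

section Basis

variable {ι : Type*} [Fintype ι] [DecidableEq ι] (e : Module.Basis ι H V)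
  (e' : Module.Basis ι H W)

variable {γ : PolyLin k H W V (Triv k H)} {e e'}

/-- Composition with a dual basis element reads off a coordinate. -/
theorem nrm3_compRight_dual
    (hγ : ∀ i j, γ.toLin (e' i) (e j) = if i = j then cls (comul2 k H) 1 else 0) (s : ι)
    (y : PT2 k H V) : nrm3 k H (γ.compRight (e' s) y) = Ext.coef (comul2 k H) e s y := by
  have h1 : ∀ j, nrm3 k H (Ext.map (φ' := comul3 k H) (idComul k H) (idComul_comul k H)
      LinearMap.id (γ.toLin (e' s) (e j))) = if s = j then 1 else 0 := by
    intro j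
    rw [hγ]
    split_ifs
    · rw [map_cls, map_one]
      exact nrm3_cls_one _
    · simp
  conv_lhs => rw [← Ext.sum_coef e y]
  rw [map_sum, map_sum]
  simp only [PolyLin.compRight_mk, nrm3_emb23_smul, h1]
  simp

theorem pairEval_dual
    (hγ : ∀ i j, γ.toLin (e' i) (e j) = if i = j then cls (comul2 k H) 1 else 0) (j : ι)
    (w : W) : pairEval γ (e j) w = antipode k (e'.repr w j) := by
  have h1 : ∀ i, pairEval γ (e j) (e' i) = if i = j then 1 else 0 := by
    intro i
    change nrm2 k H (γ.toLin (e' i) (e j)) = _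
    rw [hγ]
    split_ifs
    · rw [Algebra.TensorProduct.one_def, nrm2_cls, antipode_one, mul_one]
    · simp
  conv_lhs => rw [← e'.sum_repr w]
  rw [map_sum]
  simp only [pairEval_smul, h1]
  simp

theorem map_pairEval_dual
    (hγ : ∀ i j, γ.toLin (e' i) (e j) = if i = j then cls (comul2 k H) 1 else 0) (i j : ι)
    (t : W ⊗[k] W) : TensorProduct.map (pairEval γ (e i)) (pairEval γ (e j)) t =
      antipode2 k H (tcoef e' e' i j t) := by
  induction t using TensorProduct.induction_on with
  | zero => simp
  | add x y hx hy => simp only [map_add, hx, hy]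
  | tmul v w =>
    rw [TensorProduct.map_tmul, pairEval_dual hγ, pairEval_dual hγ, tcoef_tmul,
      TensorProduct.map_tmul]

/-- In dual bases, the pseudobracket and the cobracket are dual to each other if and only if they
have the same structure constants. -/
theorem isDualPair_iff_table
    (hγ : ∀ i j, γ.toLin (e' i) (e j) = if i = j then cls (comul2 k H) 1 else 0)
    (μ : PolyLin k H V V V) (δ : W →ₗ[H] DTensor k H W W) :
    IsDualPair γ μ δ ↔ μ.table e = dualTable e' δ := by
  have h1 : ∀ s i j, nrm3 k H (γ.compRight (e' s) (μ.toLin (e i) (e j))) = μ.table e i j s :=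
    fun s i j => nrm3_compRight_dual hγ _ _
  have h2 : ∀ s i j, TensorProduct.map (pairEval γ (e i)) (pairEval γ (e j))
      (plainCobracket δ (e' s)) = dualTable e' δ i j s := fun s i j => map_pairEval_dual hγ _ _ _
  constructor
  · intro h
    funext i j s
    rw [← h1, h, h2]
  · intro h w a b
    induction w using basis_induction e' with
    | zero => simp [PolyLin.compRight_zero_left]
    | add v w hv hw => rw [γ.compRight_add_left, map_add, hv, hw, map_add, map_add]
    | smul g v hv =>
      rw [γ.compRight_smul_left, nrm3_tmul_one_smul, hv, plainCobracket_smul, map_pairEval_act2,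
        antipode2_comul2]
    | basis s =>
      induction a using basis_induction e with
      | zero => simp [pairEval]
      | add v w hv hw =>
        rw [map_add, LinearMap.add_apply, map_add, map_add, hv, hw, ← LinearMap.add_apply,
          ← TensorProduct.map_add_left]
        congr 2
        simp [pairEval, LinearMap.comp_add]
      | smul g v hv =>
        have h3 : pairEval γ (g • v) = LinearMap.mulLeft k g ∘ₗ pairEval γ v :=
          LinearMap.ext fun w => pairEval_smul_left _ _ _ _
        rw [μ.smul_left, γ.compRight_smul, nrm3_emb23_smul, hv, h3]
        induction plainCobracket δ (e' s) using TensorProduct.induction_on with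
        | zero => simp
        | add x y hx hy => simp only [map_add, mul_add, hx, hy]
        | tmul x y => simp
      | basis i =>
        induction b using basis_induction e with
        | zero => simp [pairEval]
        | add v w hv hw =>
          rw [map_add, map_add, map_add, hv, hw, ← LinearMap.add_apply,
            ← TensorProduct.map_add_right]
          congr 2
          simp [pairEval, LinearMap.comp_add]
        | smul g v hv =>
          have h3 : pairEval γ (g • v) = LinearMap.mulLeft k g ∘ₗ pairEval γ v :=
            LinearMap.ext fun w => pairEval_smul_left _ _ _ _
          rw [μ.smul_right, γ.compRight_smul, nrm3_emb23_smul, hv, h3]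
          induction plainCobracket δ (e' s) using TensorProduct.induction_on with
          | zero => simp
          | add x y hx hy => simp only [map_add, mul_add, hx, hy]
          | tmul x y => simp
        | basis j => rw [h1, h2, h]

end Basis

/-- The condition of `HasDualConstants`, which asks for some representation of the structure
constants by pure tensors, is an equality of tables. -/
theorem hasDualConstants_iff_table {n : ℕ} (e : Module.Basis (Fin n) H V)
    (e' : Module.Basis (Fin n) H W) (μ : PolyLin k H V V V) (δ : W →ₗ[H] DTensor k H W W) :
    HasDualConstants μ e δ e' ↔ μ.table e = dualTable e' δ := by
  constructor
  · rintro ⟨x, hx, hx'⟩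
    rw [PolyLin.table_eq e hx, dualTable_eq e' hx']
  · intro h
    refine ⟨μ.table e, fun i j => (μ.sum_table e i j).symm, fun s => ?_⟩
    rw [h]
    exact sum_dualTable e' δ s

end Pairing

/-! ### Perfect pairings and the dual basis -/

section DualBasis

open Coalgebra HopfAlgebra

variable {k : Type*} [Field k] {H : Type*} [Ring H] [HopfAlgebra k H] [IsCocomm k H]
variable {V W : Type*} [AddCommGroup V] [Module k V] [Module H V] [IsScalarTower k H V]
  [AddCommGroup W] [Module k W] [Module H W] [IsScalarTower k H W]
variable {ι : Type*} [Fintype ι]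

theorem Chom.ext_basis (e : Module.Basis ι H V) {φ ψ : PDual k H V}
    (h : ∀ i, φ.toLin (e i) = ψ.toLin (e i)) : φ = ψ := by
  refine Chom.ext fun v => ?_
  induction v using basis_induction e with
  | zero => simp
  | add v w hv hw => rw [map_add, map_add, hv, hw]
  | smul g v hv => rw [Chom.map_smul', Chom.map_smul', hv]
  | basis i => exact h i

/-- A pairing with dual bases is perfect. -/
theorem toDual_bijective [DecidableEq ι] {β : PseudoForm k H V} {e e' : Module.Basis ι H V}
    (hβ : ∀ i j, β.toLin (e' i) (e j) = if i = j then cls (comul2 k H) 1 else 0) :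
    Function.Bijective β.toDual := by
  have hS : ∀ x y : H, antipode k x = antipode k y → x = y := fun x y h => by
    rw [← antipode_antipode (k := k) x, h, antipode_antipode]
  constructor
  · intro v w h
    refine e'.repr.injective (Finsupp.ext fun j => hS _ _ ?_)
    rw [← pairEval_dual hβ, ← pairEval_dual hβ]
    exact congrArg (fun φ => nrm2 k H (φ.toLin (e j))) h
  · intro φ
    refine ⟨∑ i, antipode k (nrm2 k H (φ.toLin (e i))) • e' i,
      Chom.ext_basis e fun j => nrm2_injective ?_⟩
    refine (pairEval_dual hβ j _).trans ?_
    rw [e'.repr_sum_self, antipode_antipode]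

/-- The coordinates of `V*` with respect to the dual basis. -/
def dualBasisEquiv {n : ℕ} (e : Module.Basis (Fin n) H V) : PDual k H V ≃ₗ[H] (Fin n → H) where
  toFun φ i := antipode k (nrm2 k H (φ.toLin (e i)))
  map_add' φ ψ := by
    funext i
    simp
  map_smul' h φ := by
    funext i
    rw [Chom.smul_toLin, nrm2_smul, one_mul, antipode_mul_antidistrib, antipode_antipode]
    rfl
  invFun x := ∑ i, x i • dualBasis e i
  left_inv φ := by
    refine Chom.ext_basis e fun j => nrm2_injective ?_
    rw [map_sum, LinearMap.sum_apply, map_sum]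
    simp only [Chom.smul_toLin, nrm2_smul, dualBasis_apply, one_mul, antipode_antipode]
    rw [Finset.sum_eq_single j]
    · rw [if_pos rfl, ← cls_eq_mk, nrm2_cls, antipode_one, one_mul, one_mul]
    · intro i _ hi
      rw [if_neg hi, map_zero, zero_mul]
    · simp
  right_inv x := by
    funext j
    change antipode k (nrm2 k H (Chom.toLin (∑ i, x i • dualBasis e i) (e j))) = x j
    rw [map_sum, LinearMap.sum_apply, map_sum, map_sum]
    simp only [Chom.smul_toLin, nrm2_smul, dualBasis_apply, one_mul]
    rw [Finset.sum_eq_single j]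
    · rw [if_pos rfl, ← cls_eq_mk, nrm2_cls, antipode_one, one_mul, one_mul, antipode_antipode]
    · intro i _ hi
      rw [if_neg hi, map_zero, zero_mul, map_zero]
    · simp

/-- The dual basis, as a basis of `V*`. -/
def dualBasisBasis {n : ℕ} (e : Module.Basis (Fin n) H V) :
    Module.Basis (Fin n) H (PDual k H V) := Module.Basis.ofEquivFun (dualBasisEquiv e)

theorem coe_dualBasisBasis {n : ℕ} (e : Module.Basis (Fin n) H V) :
    ⇑(dualBasisBasis (k := k) e) = dualBasis e := by
  classical
  funext i
  rw [dualBasisBasis, Module.Basis.coe_ofEquivFun]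
  change ∑ j, (Pi.single i (1 : H) : Fin n → H) j • dualBasis e j = dualBasis e i
  rw [Finset.sum_eq_single i]
  · rw [Pi.single_eq_same, one_smul]
  · intro j _ hj
    rw [Pi.single_eq_of_ne hj, zero_smul]
  · simp

/-- The basis of `V ⊕ V*` formed by a basis of `V` and its dual basis. -/
def doubleBasis {n : ℕ} (e : Module.Basis (Fin n) H V) :
    Module.Basis (Fin n ⊕ Fin n) H (V × PDual k H V) := e.prod (dualBasisBasis e)

theorem doubleBasis_inl {n : ℕ} (e : Module.Basis (Fin n) H V) (i : Fin n) :
    doubleBasis (k := k) e (.inl i) = LinearMap.inl H V (PDual k H V) (e i) := by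
  simp [doubleBasis]

theorem doubleBasis_inr {n : ℕ} (e : Module.Basis (Fin n) H V) (i : Fin n) :
    doubleBasis (k := k) e (.inr i) =
      LinearMap.inr H V (PDual k H V) (dualBasisBasis (k := k) e i) := by
  simp [doubleBasis]

theorem dualBasisBasis_apply {n : ℕ} (e : Module.Basis (Fin n) H V) (i j : Fin n) :
    (dualBasisBasis (k := k) e i).toLin (e j) = if i = j then cls (comul2 k H) 1 else 0 := by
  rw [coe_dualBasisBasis, dualBasis_apply]
  rfl

theorem swap_cls (x : H ⊗[k] H) :
    swap (Triv k H) (cls (comul2 k H) x) = cls (comul2 k H) (flip2 k H x) := map_cls _ _ _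

theorem canonicalForm_apply (x y : V × PDual k H V) : (canonicalForm k H V).toLin x y =
    x.2.toLin y.1 + swap (Triv k H) (y.2.toLin x.1) := rfl

theorem canonicalForm_basis {n : ℕ} (e : Module.Basis (Fin n) H V) (a b : Fin n ⊕ Fin n) :
    (canonicalForm k H V).toLin (doubleBasis e a) (doubleBasis e b) =
      if a.swap = b then cls (comul2 k H) 1 else 0 := by
  rcases a with a | a <;> rcases b with b | b <;>
    simp only [doubleBasis_inl, doubleBasis_inr, canonicalForm_apply, LinearMap.inl_apply,
      LinearMap.inr_apply, map_zero, LinearMap.zero_apply, add_zero, zero_add, Sum.swap_inl,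
      Sum.swap_inr, dualBasisBasis_apply, Sum.inl.injEq, Sum.inr.injEq, reduceCtorEq, if_false]
  · by_cases h : b = a
    · rw [if_pos h, if_pos h.symm, swap_cls, map_one]
    · rw [if_neg h, if_neg (Ne.symm h), map_zero]

/-- The basis of `V ⊕ V*` dual to `doubleBasis` with respect to the canonical form. -/
def doubleBasisSwap {n : ℕ} (e : Module.Basis (Fin n) H V) :
    Module.Basis (Fin n ⊕ Fin n) H (V × PDual k H V) :=
  (doubleBasis e).reindex (Equiv.sumComm _ _)

theorem doubleBasisSwap_apply {n : ℕ} (e : Module.Basis (Fin n) H V) (a : Fin n ⊕ Fin n) :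
    doubleBasisSwap (k := k) e a = doubleBasis e a.swap := by
  simp [doubleBasisSwap]

theorem canonicalForm_dual {n : ℕ} (e : Module.Basis (Fin n) H V) (a b : Fin n ⊕ Fin n) :
    (canonicalForm k H V).toLin (doubleBasisSwap e a) (doubleBasis e b) =
      if a = b then cls (comul2 k H) 1 else 0 := by
  rw [doubleBasisSwap_apply, canonicalForm_basis, Sum.swap_swap]

theorem canonicalForm_symm (v w : V × PDual k H V) : (canonicalForm k H V).toLin v w =
    swap (Triv k H) ((canonicalForm k H V).toLin w v) := by
  rw [canonicalForm_apply, canonicalForm_apply, map_add, swap_swap, add_comm]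

/-! #### Coordinates of the images of the inclusions -/

variable {n : ℕ} (e : Module.Basis (Fin n) H V)

theorem repr_inl_inl (v : V) (i : Fin n) :
    (doubleBasis (k := k) e).repr (LinearMap.inl H V (PDual k H V) v) (.inl i) = e.repr v i := by
  simp [doubleBasis]

theorem repr_inl_inr (v : V) (i : Fin n) :
    (doubleBasis (k := k) e).repr (LinearMap.inl H V (PDual k H V) v) (.inr i) = 0 := by
  simp [doubleBasis]

theorem repr_inr_inl (φ : PDual k H V) (i : Fin n) :
    (doubleBasis (k := k) e).repr (LinearMap.inr H V (PDual k H V) φ) (.inl i) = 0 := by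
  simp [doubleBasis]

theorem repr_inr_inr (φ : PDual k H V) (i : Fin n) :
    (doubleBasis (k := k) e).repr (LinearMap.inr H V (PDual k H V) φ) (.inr i) =
      (dualBasisBasis e).repr φ i := by
  simp [doubleBasis]

/-- The coordinates of `pt2Map f y`, if those of `f` are known. -/
theorem coef_pt2Map {ι κ : Type*} [Fintype ι] [Fintype κ] {e : Module.Basis ι H V}
    {e' : Module.Basis κ H W} {f : V →ₗ[H] W} {i : ι} {j : κ}
    (h : ∀ v, e'.repr (f v) j = e.repr v i) (y : PT2 k H V) :
    Ext.coef (comul2 k H) e' j (pt2Map f y) = Ext.coef (comul2 k H) e i y := by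
  induction y using Ext.induction with
  | h0 => simp
  | h2 x y hx hy => simp only [map_add, hx, hy]
  | h1 x m => rw [pt2Map, Ext.map_mk, Ext.coef_mk, Ext.coef_mk, h]; rfl

theorem coef_pt2Map_zero {κ : Type*} [Fintype κ]
    {e' : Module.Basis κ H W} {f : V →ₗ[H] W} {j : κ}
    (h : ∀ v, e'.repr (f v) j = 0) (y : PT2 k H V) :
    Ext.coef (comul2 k H) e' j (pt2Map f y) = 0 := by
  induction y using Ext.induction with
  | h0 => simp
  | h2 x y hx hy => simp only [map_add, hx, hy, add_zero]
  | h1 x m => rw [pt2Map, Ext.map_mk, Ext.coef_mk, h, map_zero, mul_zero]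

end DualBasis

/-! ### The pseudo Manin triple -/

section ManinTriple

open Coalgebra HopfAlgebra

variable {k : Type*} [Field k] {H : Type*} [Ring H] [HopfAlgebra k H] [IsCocomm k H]
variable {V W : Type*} [AddCommGroup V] [Module k V] [Module H V] [IsScalarTower k H V]
  [AddCommGroup W] [Module k W] [Module H W] [IsScalarTower k H W]
variable {n : ℕ} (e : Module.Basis (Fin n) H V)

/-- Composition on the left is composition on the right, up to a cyclic permutation of the arguments. -/
theorem emb12_eq_rotate (x : H ⊗[k] H) :
    cls3 k H (emb12 k H x) = tau23 k H (tau12 k H (cls3 k H (1 ⊗ₜ x))) := by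
  rw [tau12_cls, tau23_cls]
  induction x using TensorProduct.induction_on with
  | zero => simp
  | add x y hx hy => simp only [map_add, TensorProduct.tmul_add, hx, hy]
  | tmul a b => rfl

theorem compRight_canonicalForm (a : Fin n ⊕ Fin n) (y : PT2 k H (V × PDual k H V)) :
    (canonicalForm k H V).compRight (doubleBasis e a) y =
      cls3 k H (1 ⊗ₜ Ext.coef (comul2 k H) (doubleBasis e) a.swap y) := by
  have h := nrm3_compRight_dual (canonicalForm_dual (k := k) e) a.swap y
  rw [doubleBasisSwap_apply, Sum.swap_swap] at h
  rw [← h, cls_nrm3]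

theorem compLeft_canonicalForm (a : Fin n ⊕ Fin n) (y : PT2 k H (V × PDual k H V)) :
    (canonicalForm k H V).compLeft (doubleBasis e a) y = tau23 k H (tau12 k H
      (cls3 k H (1 ⊗ₜ Ext.coef (comul2 k H) (doubleBasis e) a.swap y))) := by
  have h1 : ∀ b, Ext.map (φ' := comul3 k H) (comulId k H) (comulId_comul k H)
      LinearMap.id ((canonicalForm k H V).toLin (doubleBasis e b) (doubleBasis e a)) =
        if a.swap = b then cls3 k H 1 else 0 := by
    intro b
    rw [canonicalForm_basis]
    by_cases h : b.swap = a
    · rw [if_pos h, if_pos (by rw [← h, Sum.swap_swap]), map_cls, map_one]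
    · rw [if_neg h, if_neg (fun h' => h (by rw [← h', Sum.swap_swap])), map_zero]
  rw [← emb12_eq_rotate]
  conv_lhs => rw [← Ext.sum_coef (doubleBasis e) y]
  rw [map_sum]
  simp only [PolyLin.compLeft_mk, h1]
  rw [Finset.sum_eq_single a.swap]
  · rw [if_pos rfl, smul_cls, mul_one]
  · intro b _ hb
    rw [if_neg (Ne.symm hb), smul_zero]
  · simp

theorem compLeft_smul_of_left (β : PseudoForm k H V) (μ : PolyLin k H V V V) (g : H) (a b c : V) :
    β.compLeft c (μ.toLin (g • a) b) =
      (g ⊗ₜ[k] (1 : H ⊗[k] H) : H ⊗[k] (H ⊗[k] H)) • β.compLeft c (μ.toLin a b) := by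
  rw [μ.smul_left, β.compLeft_smul]
  rfl

/-- Invariance of a pseudo-form has to be checked on a basis only. -/
theorem invariant_of_basis {ι : Type*} (e : Module.Basis ι H V) (β : PseudoForm k H V)
    (μ : PolyLin k H V V V)
    (h : ∀ i j l, β.compLeft (e l) (μ.toLin (e i) (e j)) =
      β.compRight (e i) (μ.toLin (e j) (e l))) (a b c : V) :
    β.compLeft c (μ.toLin a b) = β.compRight a (μ.toLin b c) := by
  induction a using basis_induction e with
  | zero => simp [PolyLin.compRight_zero_left]
  | add v w hv hw =>
    rw [map_add, LinearMap.add_apply, map_add, hv, hw, β.compRight_add_left]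
  | smul g v hv => rw [compLeft_smul_of_left, β.compRight_smul_left, hv]
  | basis i =>
    induction b using basis_induction e with
    | zero => simp
    | add v w hv hw =>
      rw [map_add, map_add, hv, hw, map_add, LinearMap.add_apply, map_add]
    | smul g v hv =>
      rw [μ.smul_right, μ.smul_left, β.compLeft_smul, β.compRight_smul, hv]
      rfl
    | basis j =>
      induction c using basis_induction e with
      | zero => simp [PolyLin.compLeft_zero_left]
      | add v w hv hw => rw [map_add, map_add, β.compLeft_add_left, hv, hw]
      | smul g v hv =>
        rw [μ.smul_right, β.compRight_smul, β.compLeft_smul_left, hv]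
        rfl
      | basis l => exact h i j l

theorem isPseudoalgHom_of_basis {ι : Type*} (e : Module.Basis ι H V) {P : LiePseudoalgebra k H V}
    {P' : LiePseudoalgebra k H W} {f : V →ₗ[H] W}
    (h : ∀ i j, P'.bracket.toLin (f (e i)) (f (e j)) = pt2Map f (P.bracket.toLin (e i) (e j))) :
    IsPseudoalgHom P P' f := by
  have hs : ∀ (x : H ⊗[k] H) (y : PT2 k H V), pt2Map f (x • y) = x • pt2Map f y :=
    fun x y => pt2Map_smul f x y
  intro a b
  induction a using basis_induction e with
  | zero => simp
  | add v w hv hw =>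
    rw [map_add, map_add, LinearMap.add_apply, hv, hw, map_add, LinearMap.add_apply, map_add]
  | smul g v hv => rw [map_smul, PolyLin.smul_left, hv, PolyLin.smul_left, hs]
  | basis i =>
    induction b using basis_induction e with
    | zero => simp
    | add v w hv hw => rw [map_add, map_add, hv, hw, map_add, map_add]
    | smul g v hv => rw [map_smul, PolyLin.smul_right, hv, PolyLin.smul_right, hs]
    | basis j => exact h i j

theorem LiePseudoalgebra.ext_bracket {R R' : LiePseudoalgebra k H V}
    (h : R.bracket = R'.bracket) : R = R' := by
  cases R
  cases R'
  cases h
  rfl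

variable {B : LiePseudoBialgebra k H V} {B' : LiePseudoBialgebra k H (PDual k H V)}

/-- The pseudobracket of a pseudo Manin triple is determined by the pseudobrackets of `V` and `V*`:
by invariance, `⟨a, [b * c]⟩` is an alternating form. -/
theorem IsAssociatedManinTriple.table_eq {R : LiePseudoalgebra k H (V × PDual k H V)}
    (hR : IsAssociatedManinTriple B B' R)
    (hB : B'.bracket.table (dualBasisBasis e) = dualTable e B.cobracket) :
    R.bracket.table (doubleBasis e) = alternatingTable Sum.swap
      (doubleForm (B.bracket.table e) (dualTable e B.cobracket)) := by
  set E := doubleBasis (k := k) e with hE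
  let Φ : Fin n ⊕ Fin n → Fin n ⊕ Fin n → Fin n ⊕ Fin n → F3 k H :=
    fun a b c => (canonicalForm k H V).compRight (E a) (R.bracket.toLin (E b) (E c))
  have hΦ' : ∀ a b c, Φ a b c = cls3 k H (1 ⊗ₜ R.bracket.table E b c a.swap) :=
    fun a b c => compRight_canonicalForm e a _
  have hskew := (skew_iff_table E R.bracket).1 R.skew
  have hΦ : IsAlternating Φ := by
    constructor
    · intro a b c
      change (canonicalForm k H V).compRight _ _ = - tau12 k H
        ((canonicalForm k H V).compRight _ _)
      rw [← hR.isManinTriple.invariant, ← hR.isManinTriple.invariant, R.skew (E a) (E b), map_neg,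
        PolyLin.compLeft_swap]
      rfl
    · intro a b c
      rw [hΦ', hΦ', hskew b c, TensorProduct.tmul_neg, map_neg, cls3_one_tmul_flip]
  have hll : ∀ i j, R.bracket.toLin (E (.inl i)) (E (.inl j)) =
      pt2Map (LinearMap.inl H V (PDual k H V)) (B.bracket.toLin (e i) (e j)) := by
    intro i j
    rw [hE, doubleBasis_inl, doubleBasis_inl]
    exact hR.hom_inl _ _
  have hrr : ∀ i j, R.bracket.toLin (E (.inr i)) (E (.inr j)) =
      pt2Map (LinearMap.inr H V (PDual k H V))
        (B'.bracket.toLin (dualBasisBasis e i) (dualBasisBasis e j)) := by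
    intro i j
    rw [hE, doubleBasis_inr, doubleBasis_inr]
    exact hR.hom_inr _ _
  have key : Φ = doubleForm (B.bracket.table e) (dualTable e B.cobracket) := by
    refine hΦ.eq_doubleForm (fun a b c => ?_) (fun a b c => ?_) (fun m i j => ?_)
      (fun m i j => ?_)
    · rw [hΦ', PolyLin.table, hll, Sum.swap_inl, coef_pt2Map_zero fun v => repr_inl_inr e v _,
        TensorProduct.tmul_zero, map_zero]
    · rw [hΦ', PolyLin.table, hrr, Sum.swap_inr, coef_pt2Map_zero fun v => repr_inr_inl e v _,
        TensorProduct.tmul_zero, map_zero]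
    · rw [hΦ', PolyLin.table, hll, Sum.swap_inr, coef_pt2Map fun v => repr_inl_inl e v _]
      rfl
    · rw [hΦ', PolyLin.table, hrr, Sum.swap_inl, coef_pt2Map fun v => repr_inr_inr e v _, ← hB]
      rfl
  funext a b c
  rw [← key, alternatingTable, hΦ', Sum.swap_swap, nrm3_cls_one]

/-- The form `⟨a, [b * c]⟩` being alternating, the canonical form is invariant. -/
theorem canonicalForm_invariant {μ : PolyLin k H (V × PDual k H V) (V × PDual k H V)
      (V × PDual k H V)} {Φ : Fin n ⊕ Fin n → Fin n ⊕ Fin n → Fin n ⊕ Fin n → F3 k H}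
    (hΦ : IsAlternating Φ) (hμ : μ.table (doubleBasis e) = alternatingTable Sum.swap Φ)
    (a b c : V × PDual k H V) : (canonicalForm k H V).compLeft c (μ.toLin a b) =
      (canonicalForm k H V).compRight a (μ.toLin b c) := by
  have h1 : ∀ a b c, Ext.coef (comul2 k H) (doubleBasis e) c
      (μ.toLin (doubleBasis e a) (doubleBasis e b)) = nrm3 k H (Φ c.swap a b) :=
    fun a b c => congrFun (congrFun (congrFun hμ a) b) c
  refine invariant_of_basis (doubleBasis e) _ μ (fun i j l => ?_) a b c
  rw [compLeft_canonicalForm, compRight_canonicalForm, h1, h1, Sum.swap_swap, Sum.swap_swap,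
    cls_nrm3, cls_nrm3, hΦ.rotate l i j]

theorem mem_range_pt2Map_subtype (f : V →ₗ[H] W) (y : PT2 k H V) :
    pt2Map f y ∈ LinearMap.range (pt2Map (k := k) (LinearMap.range f).subtype) := by
  induction y using Ext.induction with
  | h0 => simp
  | h2 x y hx hy => rw [map_add]; exact Submodule.add_mem _ hx hy
  | h1 x m =>
    refine ⟨Ext.mk (comul2 k H) x (f.rangeRestrict m), ?_⟩
    rw [pt2Map, Ext.map_mk, pt2Map, Ext.map_mk]
    rfl

/-- The structure constants of the double define the associated pseudo Manin triple. -/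
theorem isAssociatedManinTriple_of_table {R : LiePseudoalgebra k H (V × PDual k H V)}
    (hB : B'.bracket.table (dualBasisBasis e) = dualTable e B.cobracket)
    (hR : R.bracket.table (doubleBasis e) = alternatingTable Sum.swap
      (doubleForm (B.bracket.table e) (dualTable e B.cobracket))) :
    IsAssociatedManinTriple B B' R := by
  have hl : IsPseudoalgHom B.toLiePseudoalgebra R (LinearMap.inl H V (PDual k H V)) := by
    refine isPseudoalgHom_of_basis e fun i j => Ext.ext_coef (doubleBasis e) fun s => ?_
    have h1 := congrFun (congrFun (congrFun hR (.inl i)) (.inl j)) s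
    rw [PolyLin.table, doubleBasis_inl, doubleBasis_inl] at h1
    rw [h1]
    rcases s with s | s
    · rw [coef_pt2Map fun v => repr_inl_inl e v _, alternatingTable_inl]
      rfl
    · rw [coef_pt2Map_zero fun v => repr_inl_inr e v _, alternatingTable_inl_inr]
  have hr : IsPseudoalgHom B'.toLiePseudoalgebra R (LinearMap.inr H V (PDual k H V)) := by
    refine isPseudoalgHom_of_basis (dualBasisBasis e) fun i j =>
      Ext.ext_coef (doubleBasis e) fun s => ?_
    have h1 := congrFun (congrFun (congrFun hR (.inr i)) (.inr j)) s
    rw [PolyLin.table, doubleBasis_inr, doubleBasis_inr] at h1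
    rw [h1]
    rcases s with s | s
    · rw [coef_pt2Map_zero fun v => repr_inr_inl e v _, alternatingTable_inr_inl]
    · rw [coef_pt2Map fun v => repr_inr_inr e v _, alternatingTable_inr, ← hB]
      rfl
  have hV : Module.Finite H V := Module.Finite.of_basis e
  have hV' : Module.Finite H (PDual k H V) := Module.Finite.of_basis (dualBasisBasis e)
  refine ⟨hl, hr, ?_⟩
  exact
    { finite := inferInstance
      finite_one := inferInstance
      finite_zero := inferInstance
      symm := canonicalForm_symm
      invariant := canonicalForm_invariant e (doubleForm_isAlternating
        (B.isBialgTable e).skew (B.isBialgTable e).coskew) hR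
      nondegenerate := toDual_bijective (canonicalForm_dual e)
      subalgebra_one := by
        rintro _ ⟨a, rfl⟩ _ ⟨b, rfl⟩
        rw [hl]
        exact mem_range_pt2Map_subtype _ _
      subalgebra_zero := by
        rintro _ ⟨a, rfl⟩ _ ⟨b, rfl⟩
        rw [hr]
        exact mem_range_pt2Map_subtype _ _
      isCompl := (LinearMap.isCompl_range_inl_inr).symm
      isotropic_one := by
        rintro _ ⟨a, rfl⟩ _ ⟨b, rfl⟩
        simp [canonicalForm_apply]
      isotropic_zero := by
        rintro _ ⟨a, rfl⟩ _ ⟨b, rfl⟩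
        simp [canonicalForm_apply] }

end ManinTriple

/-! ### The dual Lie pseudo-bialgebra and the double -/

section Double

open Coalgebra HopfAlgebra

variable {k : Type*} [Field k] {H : Type*} [Ring H] [HopfAlgebra k H] [IsCocomm k H]
variable {V : Type*} [AddCommGroup V] [Module k V] [Module H V] [IsScalarTower k H V]

theorem LiePseudoBialgebra.ext_table {ι : Type*} [Fintype ι] (e : Module.Basis ι H V)
    {B B' : LiePseudoBialgebra k H V} (h : B.bracket.table e = B'.bracket.table e)
    (h' : dualTable e B.cobracket = dualTable e B'.cobracket) : B = B' := by
  have h1 := PolyLin.ext_table e h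
  have h2 := cobracket_ext_table e h'
  obtain ⟨⟨μ, _, _⟩, ⟨δ, _, _⟩, _⟩ := B
  obtain ⟨⟨μ', _, _⟩, ⟨δ', _, _⟩, _⟩ := B'
  cases h1
  cases h2
  rfl

variable (k H V) in
/-- The evaluation pairing of `V*` and `V`. -/
def evalPairing : PolyLin k H (PDual k H V) V (Triv k H) where
  toLin := Chom.toLin
  map_smul_smul f g φ v := by
    rw [Chom.smul_toLin, Chom.map_smul', ← mul_smul, Algebra.TensorProduct.tmul_mul_tmul, one_mul,
      mul_one]

variable (k H V) in
/-- The evaluation pairing of `V` and `V*`. -/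
def evalPairingSwap : PolyLin k H V (PDual k H V) (Triv k H) where
  toLin := (LinearMap.compr₂ Chom.toLin (swap (Triv k H))).flip
  map_smul_smul f g v φ := by
    simp only [LinearMap.flip_apply, LinearMap.compr₂_apply]
    rw [Chom.smul_toLin, Chom.map_smul', ← mul_smul, Algebra.TensorProduct.tmul_mul_tmul, one_mul,
      mul_one, swap_smul]

theorem evalPairing_dual {n : ℕ} (e : Module.Basis (Fin n) H V) (i j : Fin n) :
    (evalPairing k H V).toLin (dualBasisBasis e i) (e j) =
      if i = j then cls (comul2 k H) 1 else 0 := dualBasisBasis_apply e i j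

theorem evalPairingSwap_dual {n : ℕ} (e : Module.Basis (Fin n) H V) (i j : Fin n) :
    (evalPairingSwap k H V).toLin (e i) (dualBasisBasis e j) =
      if i = j then cls (comul2 k H) 1 else 0 := by
  change swap (Triv k H) ((dualBasisBasis e j).toLin (e i)) = _
  rw [dualBasisBasis_apply]
  by_cases h : j = i
  · rw [if_pos h, if_pos h.symm, swap_cls, map_one]
  · rw [if_neg h, if_neg (Ne.symm h), map_zero]

/-- Duality of Lie pseudo-bialgebras is detected by one basis. -/
theorem isDualBialgebra_iff {n : ℕ} (e : Module.Basis (Fin n) H V) {B : LiePseudoBialgebra k H V}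
    {B' : LiePseudoBialgebra k H (PDual k H V)} : IsDualBialgebra B B' ↔
      B.bracket.table e = dualTable (dualBasisBasis e) B'.cobracket ∧
        B'.bracket.table (dualBasisBasis e) = dualTable e B.cobracket := by
  constructor
  · intro h
    have h1 := h n e
    rw [← coe_dualBasisBasis] at h1
    exact ⟨(hasDualConstants_iff_table _ _ _ _).1 h1.1, (hasDualConstants_iff_table _ _ _ _).1 h1.2⟩
  · rintro ⟨h1, h2⟩ m e'
    rw [← coe_dualBasisBasis, hasDualConstants_iff_table, hasDualConstants_iff_table,
      ← isDualPair_iff_table (evalPairing_dual e'), ← isDualPair_iff_table (evalPairingSwap_dual e'),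
      isDualPair_iff_table (evalPairing_dual e), isDualPair_iff_table (evalPairingSwap_dual e)]
    exact ⟨h1, h2⟩

variable {n : ℕ} (e : Module.Basis (Fin n) H V)

/-- The cobracket `δ_V - δ_{V*}` of the double. -/
def doubleCobracket (δ : V →ₗ[H] DTensor k H V V)
    (δ' : PDual k H V →ₗ[H] DTensor k H (PDual k H V) (PDual k H V)) :
    V × PDual k H V →ₗ[H] DTensor k H (V × PDual k H V) (V × PDual k H V) :=
  dtMapH (LinearMap.inl H V (PDual k H V)) ∘ₗ δ ∘ₗ LinearMap.fst H V (PDual k H V) -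
    dtMapH (LinearMap.inr H V (PDual k H V)) ∘ₗ δ' ∘ₗ LinearMap.snd H V (PDual k H V)

theorem tcoef_dtMap {W : Type*} [AddCommGroup W] [Module k W] [Module H W] [IsScalarTower k H W]
    {ι κ : Type*} [Fintype ι] [Fintype κ] {e : Module.Basis ι H V} {e' : Module.Basis κ H W}
    {f : V →ₗ[H] W} {i i' : ι} {j j' : κ} (h : ∀ v, e'.repr (f v) j = e.repr v i)
    (h' : ∀ v, e'.repr (f v) j' = e.repr v i') (t : DTensor k H V V) :
    tcoef e' e' j j' (DTensor.plain k H W W (dtMap f t)) =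
      tcoef e e i i' (DTensor.plain k H V V t) := by
  obtain ⟨t, rfl⟩ := (DTensor.plain k H V V).symm.surjective t
  induction t using TensorProduct.induction_on with
  | zero => simp
  | add x y hx hy => simp only [map_add, hx, hy]
  | tmul v w =>
    change e'.repr (f v) j ⊗ₜ e'.repr (f w) j' = e.repr v i ⊗ₜ e.repr w i'
    rw [h, h']

theorem tcoef_dtMap_zero {W : Type*} [AddCommGroup W] [Module k W] [Module H W]
    [IsScalarTower k H W] {κ : Type*} [Fintype κ] {e' : Module.Basis κ H W}
    {f : V →ₗ[H] W} {j j' : κ} (h : (∀ v, e'.repr (f v) j = 0) ∨ ∀ v, e'.repr (f v) j' = 0)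
    (t : DTensor k H V V) : tcoef e' e' j j' (DTensor.plain k H W W (dtMap f t)) = 0 := by
  obtain ⟨t, rfl⟩ := (DTensor.plain k H V V).symm.surjective t
  induction t using TensorProduct.induction_on with
  | zero => simp
  | add x y hx hy => simp only [map_add, hx, hy, add_zero]
  | tmul v w =>
    change e'.repr (f v) j ⊗ₜ[k] e'.repr (f w) j' = 0
    rcases h with h | h <;> rw [h] <;> simp

/-- The cobracket `δ_L - δ_{L*}` has the structure constants `doubleCotable` of the double. -/
theorem dualTable_doubleCobracket {δ : V →ₗ[H] DTensor k H V V}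
    {δ' : PDual k H V →ₗ[H] DTensor k H (PDual k H V) (PDual k H V)} :
    dualTable (doubleBasis e) (doubleCobracket δ δ') =
      doubleCotable (doubleForm (dualTable (dualBasisBasis e) δ') (dualTable e δ)) := by
  have hl : ∀ i j (m : Fin n), dualTable (doubleBasis e) (doubleCobracket δ δ') i j (.inl m) =
      antipode2 k H (tcoef (doubleBasis e) (doubleBasis e) i j (DTensor.plain k H _ _
        (dtMap (LinearMap.inl H V (PDual k H V)) (δ (e m))))) := by
    intro i j m
    change antipode2 k H (tcoef (doubleBasis e) (doubleBasis e) i j (DTensor.plain k H _ _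
      (doubleCobracket δ δ' (doubleBasis e (.inl m))))) = _
    rw [doubleBasis_inl]
    simp [doubleCobracket, dtMapH_apply]
  have hr : ∀ i j (m : Fin n), dualTable (doubleBasis e) (doubleCobracket δ δ') i j (.inr m) =
      - antipode2 k H (tcoef (doubleBasis e) (doubleBasis e) i j (DTensor.plain k H _ _
        (dtMap (LinearMap.inr H V (PDual k H V)) (δ' (dualBasisBasis e m))))) := by
    intro i j m
    change antipode2 k H (tcoef (doubleBasis e) (doubleBasis e) i j (DTensor.plain k H _ _
      (doubleCobracket δ δ' (doubleBasis e (.inr m))))) = _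
    rw [doubleBasis_inr]
    simp [doubleCobracket, dtMapH_apply]
  funext i j m
  rcases m with m | m
  · rw [hl]
    rcases i with i | i <;> rcases j with j | j
    · rw [tcoef_dtMap (fun v => repr_inl_inl e v i) (fun v => repr_inl_inl e v j),
        doubleCotable_inl]
      rfl
    · rw [tcoef_dtMap_zero (.inr fun v => repr_inl_inr e v j), doubleCotable_inl_inr, map_zero]
    · rw [tcoef_dtMap_zero (.inl fun v => repr_inl_inr e v i), doubleCotable_inr_inl, map_zero]
    · rw [tcoef_dtMap_zero (.inl fun v => repr_inl_inr e v i), doubleCotable_inr_inr_inl,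
        map_zero]
  · rw [hr]
    rcases i with i | i <;> rcases j with j | j
    · rw [tcoef_dtMap_zero (.inl fun v => repr_inr_inl e v i), doubleCotable_inl_inl_inr,
        map_zero, neg_zero]
    · rw [tcoef_dtMap_zero (.inl fun v => repr_inr_inl e v i), doubleCotable_inl_inr, map_zero,
        neg_zero]
    · rw [tcoef_dtMap_zero (.inr fun v => repr_inr_inl e v j), doubleCotable_inr_inl, map_zero,
        neg_zero]
    · rw [tcoef_dtMap (fun v => repr_inr_inr e v i) (fun v => repr_inr_inr e v j),
        doubleCotable_inr]
      rfl

end Double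

/-! ### The coboundary of the canonical tensor -/

section Coboundary

open Coalgebra HopfAlgebra

variable {k : Type*} [Field k] {H : Type*} [Ring H] [HopfAlgebra k H] [IsCocomm k H]
variable {V : Type*} [AddCommGroup V] [Module k V] [Module H V] [IsScalarTower k H V]

variable (k H V) in
/-- The map `h ⊗ t ↦ h t` to `V ⊗ V`. -/
def diagSmul : H ⊗[k] (V ⊗[k] V) →ₗ[k] V ⊗[k] V :=
  TensorProduct.lift ((act2 k H V V).toLinearMap ∘ₗ (comul2 k H).toLinearMap)

theorem diagSmul_tmul (h : H) (t : V ⊗[k] V) :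
    diagSmul k H V (h ⊗ₜ t) = act2 k H V V (comul2 k H h) t := rfl

theorem idCounit_smul {M : Type*} [AddCommGroup M] [Module k M] [Module H M] [IsScalarTower k H M]
    (g : H) (y : PT2 k H M) :
    idCounit k H M ((g ⊗ₜ[k] (1 : H) : H ⊗[k] H) • y) = g • idCounit k H M y := by
  induction y using Ext.induction with
  | h0 => simp
  | h2 x y hx hy => simp only [map_add, smul_add, hx, hy]
  | h1 x m =>
    rw [Ext.smul_mk]
    induction x using TensorProduct.induction_on with
    | zero => simp
    | add x y hx hy => simp only [map_add, mul_add, smul_add, LinearMap.add_apply, hx, hy]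
    | tmul a b =>
      have h1 : ∀ (c : k) (x : M), c • g • x = g • c • x := fun c x => by
        rw [← smul_assoc, ← algebraMap_smul H c x, ← mul_smul, ← Algebra.commutes,
          Algebra.smul_def]
      simp [idCounit, Ext.lift_mk, mul_smul, h1]

theorem plain_coboundary (μ : PolyLin k H V V V) (r : DTensor k H V V) (a : V) :
    DTensor.plain k H V V (coboundary μ r a) =
      diagSmul k H V (leibniz (adF μ a) (adF μ a) (DTensor.plain k H V V r)) := by
  change DTensor.plain k H V V (idCounit k H _ (unfourier k H (DTensor k H V V)
    ((DTensor.plain k H V V).symm.toLinearMap.lTensor H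
      (leibniz (adF μ a) (adF μ a) (DTensor.plain k H V V r))))) = _
  induction leibniz (adF μ a) (adF μ a) (DTensor.plain k H V V r)
    using TensorProduct.induction_on with
  | zero => simp
  | add x y hx hy => simp only [map_add, hx, hy]
  | tmul h t =>
    rw [LinearMap.lTensor_tmul, unfourier_tmul, diagSmul_tmul]
    have h1 : idCounit k H (DTensor k H V V) (Ext.mk (comul2 k H) (h ⊗ₜ 1)
        ((DTensor.plain k H V V).symm t)) = h • (DTensor.plain k H V V).symm t := by
      simp [idCounit, Ext.lift_mk]
    exact (congrArg (DTensor.plain k H V V) h1).trans (DTensor.plain_smul k H V V h _)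

theorem comm_act2 (x : H ⊗[k] H) (t : V ⊗[k] V) :
    TensorProduct.comm k V V (act2 k H V V x t) =
      act2 k H V V (flip2 k H x) (TensorProduct.comm k V V t) := by
  induction x using TensorProduct.induction_on with
  | zero => simp
  | add x y hx hy => simp only [map_add, LinearMap.add_apply, hx, hy]
  | tmul a b =>
    induction t using TensorProduct.induction_on with
    | zero => simp
    | add x y hx hy => simp only [map_add, hx, hy]
    | tmul v w => rfl

theorem diagSmul_comm (z : H ⊗[k] (V ⊗[k] V)) :
    diagSmul k H V ((TensorProduct.comm k V V).toLinearMap.lTensor H z) =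
      TensorProduct.comm k V V (diagSmul k H V z) := by
  induction z using TensorProduct.induction_on with
  | zero => simp
  | add x y hx hy => simp only [map_add, hx, hy]
  | tmul h t =>
    rw [LinearMap.lTensor_tmul, diagSmul_tmul, diagSmul_tmul, comm_act2, flip2_comul]
    rfl

theorem lTensor_comm_comm (z : H ⊗[k] (V ⊗[k] V)) :
    (TensorProduct.comm k V V).toLinearMap.lTensor H
      ((TensorProduct.comm k V V).toLinearMap.lTensor H z) = z := by
  induction z using TensorProduct.induction_on with
  | zero => simp
  | add x y hx hy => simp only [map_add, hx, hy]
  | tmul h t => simp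

/-- The coboundary commutes with the flip, `H` being cocommutative. -/
theorem plain_coboundary_flipTensor (μ : PolyLin k H V V V) (r : DTensor k H V V) (a : V) :
    DTensor.plain k H V V (coboundary μ (flipTensor r) a) =
      TensorProduct.comm k V V (DTensor.plain k H V V (coboundary μ r a)) := by
  have h1 : DTensor.plain k H V V (flipTensor r) =
    TensorProduct.comm k V V (DTensor.plain k H V V r) := rfl
  rw [plain_coboundary, plain_coboundary, ← diagSmul_comm, h1, leibniz_eq, leibniz_eq,
    TensorProduct.comm_comm, map_add (LinearMap.lTensor _ _), lTensor_comm_comm, add_comm]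

variable {ι : Type*} [Fintype ι] (e : Module.Basis ι H V)

/-- The trilinear coordinates of an element of `H ⊗ (V ⊗ V)`, the last two arguments running
through the dual basis. -/
def triCoef (s t : ι) : H ⊗[k] (V ⊗[k] V) →ₗ[k] F3 k H :=
  cls3 k H ∘ₗ (antipode2 k H ∘ₗ tcoef e e s t).lTensor H

theorem antipode2_tcoef_diagSmul (s t : ι) (z : H ⊗[k] (V ⊗[k] V)) :
    antipode2 k H (tcoef e e s t (diagSmul k H V z)) = nrm3 k H (triCoef e s t z) := by
  induction z using TensorProduct.induction_on with
  | zero => simp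
  | add x y hx hy => simp only [map_add, hx, hy]
  | tmul h τ =>
    rw [diagSmul_tmul, tcoef_act2, antipode2_mul, antipode2_comul2, ← nrm3_cls]
    rfl

theorem triCoef_comm (s t : ι) (z : H ⊗[k] (V ⊗[k] V)) :
    triCoef e s t ((TensorProduct.comm k V V).toLinearMap.lTensor H z) =
      tau23 k H (triCoef e t s z) := by
  induction z using TensorProduct.induction_on with
  | zero => simp
  | add x y hx hy => simp only [map_add, hx, hy]
  | tmul h τ =>
    have h1 : ∀ (s t : ι) (τ : V ⊗[k] V), triCoef e s t (h ⊗ₜ τ) =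
      cls3 k H (h ⊗ₜ antipode2 k H (tcoef e e s t τ)) := fun _ _ _ => rfl
    rw [LinearMap.lTensor_tmul, h1, h1, tau23_cls, LinearEquiv.coe_coe, tcoef_comm,
      antipode2_flip2]
    rfl

theorem triCoef_firstLeg [DecidableEq ι] (μ : PolyLin k H V V V) (a i j s t : ι) :
    triCoef e s t (firstLeg μ (e a) (e i ⊗ₜ e j)) =
      if j = t then tau12 k H (cls3 k H (1 ⊗ₜ μ.table e a i s)) else 0 := by
  have h1 : ∀ z : H ⊗[k] V, triCoef e s t (TensorProduct.assoc k H V V (z ⊗ₜ e j)) =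
      if j = t then cls3 k H (emb12 k H ((antipode k).lTensor H ((kcoord k e s).lTensor H z)))
        else 0 := by
    intro z
    induction z using TensorProduct.induction_on with
    | zero => simp
    | add x y hx hy =>
      rw [TensorProduct.add_tmul, map_add, map_add, hx, hy]
      split_ifs <;> simp
    | tmul h v =>
      change cls3 k H (h ⊗ₜ (antipode k (e.repr v s) ⊗ₜ antipode k (e.repr (e j) t))) = _
      rw [e.repr_self, Finsupp.single_apply]
      split_ifs
      · rw [antipode_one]
        rfl
      · simp
  -- `h1` expresses the coordinates by `flip13` of the structure constants, shifted cyclically.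
  refine (h1 (adF μ (e a) (e i))).trans ?_
  rw [adF, LinearMap.comp_apply, lTensor_kcoord_fourier, ← flip13_eq, emb12_eq_rotate, flip13,
    cls_nrm3, tau12_tau12, tau23_tau23]
  rfl

end Coboundary

/-! ### The canonical tensor satisfies the classical Yang-Baxter equation modulo `H₊` -/

section YangBaxter

open Coalgebra HopfAlgebra

variable {k : Type*} [Field k] {H : Type*} [Ring H] [HopfAlgebra k H] [IsCocomm k H]
variable {V : Type*} [AddCommGroup V] [Module k V] [Module H V] [IsScalarTower k H V]

variable (k H V) in
/-- The projection of `V ⊗ V ⊗ V` to its quotient by `H₊ · (V ⊗ V ⊗ V)`. -/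
def augProj : V ⊗[k] (V ⊗[k] V) →ₗ[k]
    (DTensor k H V (DTensor k H V V) ⧸ augTensor3 k H V) :=
  (augTensor3 k H V).mkQ ∘ₗ (plain3 k H V).symm.toLinearMap

theorem mkQ_augTensor3_smul (h : H) (t : DTensor k H V (DTensor k H V V)) :
    (augTensor3 k H V).mkQ (h • t) = counit (R := k) h • (augTensor3 k H V).mkQ t := by
  rw [← map_smul, ← sub_eq_zero, ← map_sub, Submodule.mkQ_apply, Submodule.Quotient.mk_eq_zero]
  refine Submodule.subset_span ⟨h - algebraMap k H (counit (R := k) h), t, ?_, ?_⟩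
  · simp
  · rw [sub_smul, algebraMap_smul]

/-- The map `p ⊗ q ⊗ w ↦ p x ⊗ q y ⊗ w z`. -/
def orbit3 (x y z : V) : H ⊗[k] (H ⊗[k] H) →ₗ[k] V ⊗[k] (V ⊗[k] V) :=
  TensorProduct.map ((Algebra.lsmul k k V).toLinearMap.flip x)
    (TensorProduct.map ((Algebra.lsmul k k V).toLinearMap.flip y)
      ((Algebra.lsmul k k V).toLinearMap.flip z))

theorem orbit3_tmul (x y z : V) (p q w : H) :
    orbit3 (k := k) x y z (p ⊗ₜ (q ⊗ₜ w)) = (p • x) ⊗ₜ ((q • y) ⊗ₜ (w • z)) := rfl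

theorem smul_orbit3 (x y z : V) (h : H) (u : H ⊗[k] (H ⊗[k] H)) :
    h • (plain3 k H V).symm (orbit3 x y z u) =
      (plain3 k H V).symm (orbit3 x y z (comul3 k H h * u)) := by
  induction u using tensor3_induction with
  | zero => simp
  | add u u' hu hu' => simp only [map_add, smul_add, mul_add, hu, hu']
  | tmul p q w =>
    have key : ∀ v : H ⊗[k] H, act2 k H V (DTensor k H V V) v
        ((p • x) ⊗ₜ (DTensor.plain k H V V).symm ((q • y) ⊗ₜ (w • z))) =
        DTensor.plain k H V (DTensor k H V V)
          ((plain3 k H V).symm (orbit3 x y z (idComul k H v * (p ⊗ₜ (q ⊗ₜ w))))) := by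
      intro v
      induction v using TensorProduct.induction_on with
      | zero => simp
      | add v v' hv hv' => simp only [map_add, LinearMap.add_apply, add_mul, hv, hv']
      | tmul a b =>
        have h2 : ∀ v : H ⊗[k] H, (a • p • x) ⊗ₜ[k] (DTensor.plain k H V V).symm
            (act2 k H V V v ((q • y) ⊗ₜ (w • z))) = DTensor.plain k H V (DTensor k H V V)
          ((plain3 k H V).symm (orbit3 x y z ((a ⊗ₜ v) * (p ⊗ₜ (q ⊗ₜ w))))) := by
          intro v
          induction v using TensorProduct.induction_on with
          | zero => simp
          | add v v' hv hv' =>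
            simp only [map_add, LinearMap.add_apply, TensorProduct.tmul_add, add_mul, hv, hv']
          | tmul b c =>
            rw [Algebra.TensorProduct.tmul_mul_tmul, Algebra.TensorProduct.tmul_mul_tmul,
              orbit3_tmul, mul_smul, mul_smul, mul_smul]
            rfl
        exact h2 (comul2 k H b)
    exact (DTensor.plain k H V (DTensor k H V V)).injective (key (comul2 k H h))

theorem antipode3_comul3 (h : H) :
    antipode3 k H (comul3 k H h) = comul3 k H (antipode k h) := by
  rw [← idComul_comul, antipode3_idComul, antipode2_comul2, idComul_comul]

/-- The map `H^{⊗3} ⊗_H k → V^{⊗3} / H₊ V^{⊗3}`, `(p ⊗ q ⊗ w) ⊗_H 1 ↦ S(p) x ⊗ S(q) y ⊗ S(w) z`. -/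
def realize (x y z : V) : F3 k H →ₗ[k]
    (DTensor k H V (DTensor k H V V) ⧸ augTensor3 k H V) :=
  clsLift (comul3 k H) (augProj k H V ∘ₗ orbit3 x y z ∘ₗ antipode3 k H) (by
    intro u h
    change (augTensor3 k H V).mkQ ((plain3 k H V).symm
      (orbit3 x y z (antipode3 k H (u * comul3 k H h)))) = counit (R := k) h •
        (augTensor3 k H V).mkQ ((plain3 k H V).symm (orbit3 x y z (antipode3 k H u)))
    rw [antipode3_mul, antipode3_comul3, ← smul_orbit3, mkQ_augTensor3_smul, counit_antipode])

theorem realize_cls (x y z : V) (p q w : H) :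
    realize x y z (cls3 k H (p ⊗ₜ (q ⊗ₜ w))) =
      augProj k H V ((antipode k p • x) ⊗ₜ ((antipode k q • y) ⊗ₜ (antipode k w • z))) :=
  clsLift_cls _ _ _

variable (k H) in
/-- The map `h ⊗ z ↦ (S(z) ⊗ h ⊗ 1) ⊗_H 1`. -/
def yangEmb : H ⊗[k] H →ₗ[k] F3 k H :=
  cls3 k H ∘ₗ TensorProduct.map (antipode k) ((TensorProduct.mk k H H).flip 1) ∘ₗ
    (TensorProduct.comm k H H).toLinearMap

theorem yangEmb_tmul (h z : H) :
    yangEmb k H (h ⊗ₜ z) = cls3 k H (antipode k z ⊗ₜ (h ⊗ₜ 1)) := rfl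

/-- The conventions of `[[r, r]]`, which are those of the Fourier transform followed by an antipode,
give back the values of the trilinear form. -/
theorem yangEmb_fourierHH (x : H ⊗[k] H) :
    yangEmb k H (fourierHH k H x) = cls3 k H (1 ⊗ₜ x) := by
  have key : ∀ y : H ⊗[k] H, yangEmb k H y = cls3 k H (1 ⊗ₜ unfourierHH k H y) := by
    intro y
    induction y using TensorProduct.induction_on with
    | zero => simp
    | add x y hx hy => simp only [map_add, TensorProduct.tmul_add, hx, hy]
    | tmul h z =>
      refine nrm3_injective ?_
      rw [nrm3_cls_one, yangEmb_tmul, nrm3_cls, antipode_antipode, unfourierHH_tmul]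
  rw [key, unfourierHH_fourierHH]

variable {ι : Type*} [Fintype ι] (e : Module.Basis ι H V)

/-- The element `Σ h ⊗ z m` of `H ⊗ V` for `y = Σ h ⊗ z`. -/
def spreadRight (m : V) : H ⊗[k] H →ₗ[k] H ⊗[k] V :=
  ((Algebra.lsmul k k V).toLinearMap.flip m).lTensor H

theorem spreadRight_tmul (m : V) (h z : H) :
    spreadRight (k := k) m (h ⊗ₜ z) = h ⊗ₜ (z • m) := rfl

theorem bracketF_basis (μ : PolyLin k H V V V) (i j : ι) : bracketF μ (e i) (e j) =
    ∑ s, spreadRight (e s) (fourierHH k H (μ.table e i j s)) := by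
  change fourier k H V (μ.toLin (e i) (e j)) = _
  rw [← μ.sum_table e i j, map_sum]
  refine Finset.sum_congr rfl fun s _ => ?_
  rw [fourier_mk_eq]
  induction fourierHH k H (μ.table e i j s) using TensorProduct.induction_on with
  | zero => simp
  | add x y hx hy => simp only [map_add, TensorProduct.add_tmul, hx, hy]
  | tmul h z => rfl

theorem augProj_transfer (m x y : V) (z : H ⊗[k] H) :
    augProj k H V (transfer k H V (spreadRight m z ⊗ₜ (x ⊗ₜ y))) =
      realize m x y (yangEmb k H z) := by
  induction z using TensorProduct.induction_on with
  | zero => simp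
  | add z z' hz hz' => simp only [map_add, TensorProduct.add_tmul, hz, hz']
  | tmul h z =>
    rw [spreadRight_tmul, transfer_tmul, yangEmb_tmul, realize_cls, antipode_antipode,
      antipode_one, one_smul]

/-- Moving the last tensor factor of `transfer` to the front. -/
theorem augProj_rotate_transfer (m x y : V) (z : H ⊗[k] H) :
    augProj k H V (TensorProduct.comm k (V ⊗[k] V) V ((TensorProduct.assoc k V V V).symm
      (transfer k H V (spreadRight m z ⊗ₜ (x ⊗ₜ y))))) =
      realize y m x (tau12 k H (tau23 k H (yangEmb k H z))) := by
  induction z using TensorProduct.induction_on with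
  | zero => simp
  | add z z' hz hz' => simp only [map_add, TensorProduct.add_tmul, hz, hz']
  | tmul h z =>
    rw [spreadRight_tmul, transfer_tmul, yangEmb_tmul, tau23_cls, tau12_cls]
    have h1 : flip12 k H (flip23 k H (antipode k z ⊗ₜ (h ⊗ₜ 1))) =
      1 ⊗ₜ (antipode k z ⊗ₜ h) := rfl
    rw [h1, realize_cls, antipode_antipode, antipode_one, one_smul]
    rfl

/-- Reversing the tensor factors of `transfer`. -/
theorem augProj_reverse_transfer (m x y : V) (z : H ⊗[k] H) :
    augProj k H V (TensorProduct.assoc k V V V ((TensorProduct.comm k V V).toLinearMap.rTensor V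
      (TensorProduct.comm k V (V ⊗[k] V)
        (transfer k H V (spreadRight m z ⊗ₜ (x ⊗ₜ y)))))) =
      realize y x m (tau12 k H (tau23 k H (tau12 k H (yangEmb k H z)))) := by
  induction z using TensorProduct.induction_on with
  | zero => simp
  | add z z' hz hz' => simp only [map_add, TensorProduct.add_tmul, hz, hz']
  | tmul h z =>
    rw [spreadRight_tmul, transfer_tmul, yangEmb_tmul, tau12_cls, tau23_cls, tau12_cls]
    have h1 : flip12 k H (flip23 k H (flip12 k H (antipode k z ⊗ₜ (h ⊗ₜ 1)))) =
      1 ⊗ₜ (h ⊗ₜ antipode k z) := rfl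
    rw [h1, realize_cls, antipode_antipode, antipode_one, one_smul]
    rfl

theorem augProj_cyb1 (μ : PolyLin k H V V V) (i j : ι) (x y : V) :
    augProj k H V (cyb1 μ ((e i ⊗ₜ x) ⊗ₜ (e j ⊗ₜ y))) =
      ∑ s, realize (e s) x y (cls3 k H (1 ⊗ₜ μ.table e i j s)) := by
  rw [cyb1_tmul, bracketF_basis, TensorProduct.sum_tmul, map_sum, map_sum]
  simp only [augProj_transfer, yangEmb_fourierHH]

theorem augProj_cyb2 (μ : PolyLin k H V V V) (i j : ι) (x y : V) :
    augProj k H V (cyb2 μ ((e i ⊗ₜ x) ⊗ₜ (y ⊗ₜ e j))) =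
      ∑ s, realize y (e s) x (tau12 k H (tau23 k H (cls3 k H (1 ⊗ₜ μ.table e i j s)))) := by
  change augProj k H V (TensorProduct.comm k (V ⊗[k] V) V ((TensorProduct.assoc k V V V).symm
    (transfer k H V (bracketF μ (e i) (e j) ⊗ₜ (x ⊗ₜ y))))) = _
  rw [bracketF_basis, TensorProduct.sum_tmul]
  simp only [map_sum, augProj_rotate_transfer, yangEmb_fourierHH]

theorem augProj_cyb3 (μ : PolyLin k H V V V) (i j : ι) (x y : V) :
    augProj k H V (cyb3 μ ((x ⊗ₜ e i) ⊗ₜ (y ⊗ₜ e j))) =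
      ∑ s, realize y x (e s) (tau12 k H (tau23 k H (tau12 k H
        (cls3 k H (1 ⊗ₜ μ.table e i j s))))) := by
  change augProj k H V (TensorProduct.assoc k V V V
    ((TensorProduct.comm k V V).toLinearMap.rTensor V (TensorProduct.comm k V (V ⊗[k] V)
      (transfer k H V (bracketF μ (e i) (e j) ⊗ₜ (x ⊗ₜ y)))))) = _
  rw [bracketF_basis, TensorProduct.sum_tmul]
  simp only [map_sum, augProj_reverse_transfer, yangEmb_fourierHH]

end YangBaxter

/-! ### Quasitriangularity -/

section Quasitriangular

open Coalgebra HopfAlgebra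

variable {k : Type*} [Field k] {H : Type*} [Ring H] [HopfAlgebra k H] [IsCocomm k H]
variable {V : Type*} [AddCommGroup V] [Module k V] [Module H V] [IsScalarTower k H V]
variable {ι : Type*} [Fintype ι] (E : Module.Basis (ι ⊕ ι) H V)

/-- The tensor `Σ E_i ⊗ E_{bar i}`, with `i` running through the first half of the basis. -/
def halfTensor : V ⊗[k] V := ∑ i, E (.inl i) ⊗ₜ E (.inr i)

variable {Φ : ι ⊕ ι → ι ⊕ ι → ι ⊕ ι → F3 k H} {μ : PolyLin k H V V V}

theorem triCoef_firstLeg_halfTensor (hΦ : IsAlternating Φ)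
    (hμ : μ.table E = alternatingTable Sum.swap Φ) (a s t : ι ⊕ ι) :
    triCoef E s t (firstLeg μ (E a) (halfTensor E)) =
      (leftInd t - 1) • Φ a s.swap t.swap := by
  classical
  simp only [halfTensor, map_sum, triCoef_firstLeg]
  rcases t with t | t
  · simp [leftInd]
  · rw [Finset.sum_eq_single t]
    · rw [if_pos rfl, hμ, alternatingTable, cls_nrm3, hΦ.swap_left a s.swap, map_neg, tau12_tau12]
      simp [leftInd]
    · intro i _ hi
      rw [if_neg (fun h => hi (Sum.inr.inj h))]
    · simp

/-- The coordinates of the coboundary of `∑ e_i ⊗ e_i*` are those of the cobracket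
`δ_L - δ_{L*}` of the double. -/
theorem tcoef_coboundary (hΦ : IsAlternating Φ)
    (hμ : μ.table E = alternatingTable Sum.swap Φ) {r : DTensor k H V V}
    (hr : DTensor.plain k H V V r = halfTensor E) (a s t : ι ⊕ ι) :
    antipode2 k H (tcoef E E s t (DTensor.plain k H V V (coboundary μ r (E a)))) =
      doubleCotable Φ s t a := by
  have h0 : triCoef E t s (firstLeg μ (E a) (TensorProduct.comm k V V (halfTensor E))) =
      - (leftInd s • Φ a t.swap s.swap) := by
    classical
    simp only [halfTensor, map_sum, TensorProduct.comm_tmul, triCoef_firstLeg]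
    rcases s with s | s
    · rw [Finset.sum_eq_single s]
      · rw [if_pos rfl, hμ, alternatingTable, cls_nrm3, hΦ.swap_left a t.swap, map_neg, tau12_tau12]
        simp [leftInd]
      · intro i _ hi
        rw [if_neg (fun h => hi (Sum.inl.inj h))]
      · simp
    · simp [leftInd]
  rw [plain_coboundary, antipode2_tcoef_diagSmul, hr, leibniz_eq, map_add, triCoef_comm, h0,
    triCoef_firstLeg_halfTensor E hΦ hμ, map_neg, map_zsmul, hΦ.swap_right a s.swap t.swap,
    map_neg, tau23_tau23, smul_neg, neg_neg, ← add_smul, map_zsmul, doubleCotable, weight_eq]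
  congr 1
  ring

/-- The cobracket with the structure constants of the double is the coboundary of the canonical
tensor. -/
theorem cobracket_eq_coboundary (hΦ : IsAlternating Φ)
    (hμ : μ.table E = alternatingTable Sum.swap Φ) {δ : V →ₗ[H] DTensor k H V V}
    (hδ : dualTable E δ = doubleCotable Φ) {r : DTensor k H V V}
    (hr : DTensor.plain k H V V r = halfTensor E) (a : V) : δ a = coboundary μ r a := by
  induction a using basis_induction E with
  | zero => rw [map_zero, coboundary, tensorAct_zero_left, map_zero]
  | add v w hv hw => rw [map_add, hv, hw, coboundary, coboundary, coboundary, tensorAct_add_left,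
      map_add]
  | smul g v hv => rw [map_smul, hv, coboundary, coboundary, tensorAct_smul_left, idCounit_smul]
  | basis a =>
    refine (DTensor.plain k H V V).injective (tcoef_ext E E fun s t => ?_)
    rw [← antipode2_antipode2 (tcoef E E s t (DTensor.plain k H V V (coboundary μ r (E a)))),
      tcoef_coboundary E hΦ hμ hr, ← hδ, dualTable, antipode2_antipode2]
    rfl

/-- The contributions of the three terms of `[[r, r]]` cancel, except for those in which the three
arguments of the alternating form lie all in `L` or all in `L*`. -/
theorem augProj_cybe (hΦ : IsAlternating Φ)
    (hl : ∀ a b c, Φ (.inl a) (.inl b) (.inl c) = 0)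
    (hr : ∀ a b c, Φ (.inr a) (.inr b) (.inr c) = 0)
    (hμ : μ.table E = alternatingTable Sum.swap Φ) {r : DTensor k H V V}
    (hr' : DTensor.plain k H V V r = halfTensor E) : augProj k H V (cybe μ r) = 0 := by
  let R : ι ⊕ ι → ι ⊕ ι → ι ⊕ ι → DTensor k H V (DTensor k H V V) ⧸ augTensor3 k H V :=
    fun a b c => realize (E a.swap) (E b.swap) (E c.swap) (Φ a b c)
  have hsum : ∀ F : ι ⊕ ι → DTensor k H V (DTensor k H V V) ⧸ augTensor3 k H V,
      ∑ s : ι ⊕ ι, F s.swap = ∑ i, F (.inl i) + ∑ i, F (.inr i) := by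
    intro F
    rw [Fintype.sum_sum_type, add_comm]
    rfl
  have h1 : augProj k H V (cyb1 μ (halfTensor E ⊗ₜ halfTensor E)) =
      ∑ j, ∑ i, (∑ g, R (.inl g) (.inl j) (.inl i) + ∑ g, R (.inr g) (.inl j) (.inl i)) := by
    simp only [halfTensor, TensorProduct.sum_tmul, TensorProduct.tmul_sum, map_sum, augProj_cyb1]
    rw [Finset.sum_comm]
    refine Finset.sum_congr rfl fun j _ => Finset.sum_congr rfl fun i _ => ?_
    rw [← hsum (fun g => R g (.inl j) (.inl i))]
    refine Finset.sum_congr rfl fun g _ => ?_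
    rw [hμ, alternatingTable, cls_nrm3]
    simp [R]
  have h2 : augProj k H V (cyb2 μ (halfTensor E ⊗ₜ halfTensor E)) =
      ∑ j, ∑ i, (∑ g, R (.inr i) (.inl g) (.inl j) + ∑ g, R (.inr i) (.inr g) (.inl j)) := by
    simp only [halfTensor, TensorProduct.sum_tmul, TensorProduct.tmul_sum, map_sum, augProj_cyb2]
    rw [Finset.sum_comm]
    refine Finset.sum_congr rfl fun j _ => Finset.sum_congr rfl fun i _ => ?_
    rw [← hsum (fun g => R (.inr i) g (.inl j))]
    refine Finset.sum_congr rfl fun g _ => ?_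
    rw [hμ, alternatingTable, cls_nrm3, hΦ.rotate (.inr i), tau23_tau23, tau12_tau12]
    simp [R]
  have h3 : augProj k H V (cyb3 μ (halfTensor E ⊗ₜ halfTensor E)) =
      - ∑ j, ∑ i, (∑ g, R (.inr i) (.inr j) (.inl g) + ∑ g, R (.inr i) (.inr j) (.inr g)) := by
    simp only [halfTensor, TensorProduct.sum_tmul, TensorProduct.tmul_sum, map_sum, augProj_cyb3]
    rw [Finset.sum_comm, ← Finset.sum_neg_distrib]
    refine Finset.sum_congr rfl fun j _ => ?_
    rw [← Finset.sum_neg_distrib]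
    refine Finset.sum_congr rfl fun i _ => ?_
    rw [← hsum (fun g => R (.inr i) (.inr j) g), ← Finset.sum_neg_distrib]
    refine Finset.sum_congr rfl fun g _ => ?_
    have h4 : tau12 k H (tau23 k H (tau12 k H (Φ g.swap (.inr j) (.inr i)))) =
        - Φ (.inr i) (.inr j) g.swap := by
      rw [hΦ.swap_left (.inr j) (.inr i), hΦ.swap_right (.inr j) g.swap,
        hΦ.swap_left g.swap (.inr j)]
      simp only [map_neg, neg_neg]
    rw [hμ, alternatingTable, cls_nrm3, h4]
    simp [R]
  have hRl : ∀ a b c, R (.inl a) (.inl b) (.inl c) = 0 := fun a b c => by simp [R, hl]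
  have hRr : ∀ a b c, R (.inr a) (.inr b) (.inr c) = 0 := fun a b c => by simp [R, hr]
  have h5 : cybe μ r = cyb1 μ (halfTensor E ⊗ₜ halfTensor E) -
      cyb2 μ (halfTensor E ⊗ₜ halfTensor E) - cyb3 μ (halfTensor E ⊗ₜ halfTensor E) := by
    rw [← hr']
    rfl
  rw [h5, map_sub, map_sub, h1, h2, h3]
  simp only [hRl, hRr, Finset.sum_const_zero, zero_add, add_zero, Finset.sum_add_distrib]
  have h6 : ∀ F : ι → ι → ι → DTensor k H V (DTensor k H V V) ⧸ augTensor3 k H V,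
      ∑ j, ∑ i, ∑ g, F i g j = ∑ a, ∑ b, ∑ c, F a b c := fun F => by
    rw [Finset.sum_comm]
    exact Finset.sum_congr rfl fun i _ => Finset.sum_comm
  have h7 : ∀ F : ι → ι → ι → DTensor k H V (DTensor k H V V) ⧸ augTensor3 k H V,
      ∑ j, ∑ i, ∑ g, F g j i = ∑ a, ∑ b, ∑ c, F a b c := fun F => by
    rw [h6 fun a b c => F b c a]
    exact Finset.sum_comm.trans (Finset.sum_congr rfl fun i _ => Finset.sum_comm)
  rw [h7 fun a b c => R (.inr a) (.inl b) (.inl c),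
    h6 fun a b c => R (.inr a) (.inl b) (.inl c), h6 fun a b c => R (.inr a) (.inr b) (.inl c),
    Finset.sum_comm (f := fun j i => ∑ g, R (.inr i) (.inr j) (.inl g))]
  abel

/-- A Lie pseudo-bialgebra with the structure constants of a double is quasitriangular with respect
to the canonical tensor. -/
theorem isQuasitriangular_of_table {D : LiePseudoBialgebra k H V} (hΦ : IsAlternating Φ)
    (hl : ∀ a b c, Φ (.inl a) (.inl b) (.inl c) = 0)
    (hr : ∀ a b c, Φ (.inr a) (.inr b) (.inr c) = 0)
    (hμ : D.bracket.table E = alternatingTable Sum.swap Φ)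
    (hδ : dualTable E D.cobracket = doubleCotable Φ) {r : DTensor k H V V}
    (hr' : DTensor.plain k H V V r = halfTensor E) : IsQuasitriangular D r where
  isCoboundary := cobracket_eq_coboundary E hΦ hμ hδ hr'
  cybe_mem := by
    have h := augProj_cybe E hΦ hl hr hμ hr'
    exact (Submodule.Quotient.mk_eq_zero _).1 h
  invariant a := by
    refine (DTensor.plain k H V V).injective ?_
    have h1 : coboundary D.bracket (r + flipTensor r) a =
      coboundary D.bracket r a + coboundary D.bracket (flipTensor r) a := by
      simp only [coboundary, map_add]
    rw [h1, map_add, plain_coboundary_flipTensor, ← cobracket_eq_coboundary E hΦ hμ hδ hr',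
      D.coskew, map_zero, add_neg_cancel]

end Quasitriangular

end PseudoBialg

end

theorem mainTheorem4
    {k : Type*} [Field k] [IsAlgClosed k] [CharZero k]
    {H : Type*} [Ring H] [HopfAlgebra k H] [Coalgebra.IsCocomm k H]
    {L : Type*} [AddCommGroup L] [Module k L] [Module H L] [IsScalarTower k H L]
    [Module.Free H L] [Module.Finite H L]
    (B : PseudoBialg.LiePseudoBialgebra k H L) :
    ∃ (B' : PseudoBialg.LiePseudoBialgebra k H (PseudoBialg.PDual k H L))
      (D : PseudoBialg.LiePseudoBialgebra k H (L × PseudoBialg.PDual k H L)),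
      -- `B'` is the dual Lie pseudo-bialgebra of `L`, and it is unique
      PseudoBialg.IsDualBialgebra B B' ∧
      (∀ B'' : PseudoBialg.LiePseudoBialgebra k H (PseudoBialg.PDual k H L),
        PseudoBialg.IsDualBialgebra B B'' → B'' = B') ∧
      -- the pseudobracket of `D` is that of the associated pseudo Manin triple, and it is unique
      PseudoBialg.IsAssociatedManinTriple B B' D.toLiePseudoalgebra ∧
      (∀ R : PseudoBialg.LiePseudoalgebra k H (L × PseudoBialg.PDual k H L),
        PseudoBialg.IsAssociatedManinTriple B B' R → R = D.toLiePseudoalgebra) ∧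
      -- the cobracket of `D` is `δ_L - δ_{L*}`
      (∀ (a : L) (f : PseudoBialg.PDual k H L),
        D.cobracket (a, f) =
          PseudoBialg.dtMap (LinearMap.inl H L (PseudoBialg.PDual k H L)) (B.cobracket a) -
          PseudoBialg.dtMap (LinearMap.inr H L (PseudoBialg.PDual k H L)) (B'.cobracket f)) ∧
      -- the inclusions of `L` and of `(L*)^op` are homomorphisms of Lie pseudo-bialgebras
      PseudoBialg.IsBialgHom B D (LinearMap.inl H L (PseudoBialg.PDual k H L)) ∧
      PseudoBialg.IsBialgHom B'.op D (LinearMap.inr H L (PseudoBialg.PDual k H L)) ∧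
      -- `D` is quasitriangular with respect to `r = Σ e_i ⊗ e_i*`, for every basis of `L`
      (∀ (n : ℕ) (e : Module.Basis (Fin n) H L),
        PseudoBialg.IsQuasitriangular D (PseudoBialg.canonicalTensor e)) := by
  classical
  obtain ⟨n, e⟩ : ∃ n : ℕ, Nonempty (Module.Basis (Fin n) H L) :=
    ⟨_, ⟨(Module.Free.chooseBasis H L).reindex (Fintype.equivFin _)⟩⟩
  obtain ⟨e⟩ := e
  have hB := B.isBialgTable e
  let B' := PseudoBialg.LiePseudoBialgebra.ofTable (PseudoBialg.dualBasisBasis (k := k) e) hB.dual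
  have hB'1 : B'.bracket.table (PseudoBialg.dualBasisBasis e) =
      PseudoBialg.dualTable e B.cobracket := PseudoBialg.table_bracketOfTable _ _
  have hB'2 : PseudoBialg.dualTable (PseudoBialg.dualBasisBasis e) B'.cobracket =
      B.bracket.table e := PseudoBialg.dualTable_cobracketOfTable _ _
  let D := PseudoBialg.LiePseudoBialgebra.ofTable (PseudoBialg.doubleBasis (k := k) e) hB.double
  have hD : D.bracket.table (PseudoBialg.doubleBasis e) =
      PseudoBialg.alternatingTable Sum.swap (PseudoBialg.doubleForm (B.bracket.table e)
        (PseudoBialg.dualTable e B.cobracket)) := PseudoBialg.table_bracketOfTable _ _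
  have hdual : PseudoBialg.IsDualBialgebra B B' :=
    (PseudoBialg.isDualBialgebra_iff e).2 ⟨hB'2.symm, hB'1⟩
  have hassoc : PseudoBialg.IsAssociatedManinTriple B B' D.toLiePseudoalgebra :=
    PseudoBialg.isAssociatedManinTriple_of_table e hB'1 hD
  have hcob : D.cobracket = PseudoBialg.doubleCobracket B.cobracket B'.cobracket := by
    refine PseudoBialg.cobracket_ext_table (PseudoBialg.doubleBasis e) ?_
    rw [PseudoBialg.dualTable_doubleCobracket, hB'2]
    exact PseudoBialg.dualTable_cobracketOfTable _ _
  have hδ : ∀ (a : L) (f : PseudoBialg.PDual k H L), D.cobracket (a, f) =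
      PseudoBialg.dtMap (LinearMap.inl H L (PseudoBialg.PDual k H L)) (B.cobracket a) -
      PseudoBialg.dtMap (LinearMap.inr H L (PseudoBialg.PDual k H L)) (B'.cobracket f) := by
    intro a f
    rw [hcob]
    rfl
  refine ⟨B', D, hdual, fun B'' h => ?_, hassoc, fun R hR => ?_, hδ, ⟨hassoc.hom_inl, fun a => ?_⟩,
    ⟨hassoc.hom_inr, fun f => ?_⟩, fun m e' => ?_⟩
  · obtain ⟨h1, h2⟩ := (PseudoBialg.isDualBialgebra_iff e).1 h
    exact PseudoBialg.LiePseudoBialgebra.ext_table (PseudoBialg.dualBasisBasis e)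
      (h2.trans hB'1.symm) (h1.symm.trans hB'2.symm)
  · exact PseudoBialg.LiePseudoalgebra.ext_bracket (PseudoBialg.PolyLin.ext_table
      (PseudoBialg.doubleBasis e) ((hR.table_eq e hB'1).trans hD.symm))
  · rw [LinearMap.inl_apply, hδ, map_zero, map_zero, sub_zero]
  · rw [LinearMap.inr_apply, hδ, map_zero, map_zero, zero_sub, ← map_neg]
    rfl
  · obtain ⟨h1, h2⟩ := (PseudoBialg.isDualBialgebra_iff e').1 hdual
    refine PseudoBialg.isQuasitriangular_of_table (PseudoBialg.doubleBasis e')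
      (PseudoBialg.doubleForm_isAlternating (B.isBialgTable e').skew (B.isBialgTable e').coskew)
      (fun _ _ _ => rfl) (fun _ _ _ => rfl) (hassoc.table_eq e' h2) ?_ ?_
    · rw [hcob, PseudoBialg.dualTable_doubleCobracket, h1]
    · rw [PseudoBialg.halfTensor, PseudoBialg.canonicalTensor, LinearEquiv.apply_symm_apply]
      refine Finset.sum_congr rfl fun i _ => ?_
      rw [PseudoBialg.doubleBasis_inl, PseudoBialg.doubleBasis_inr, PseudoBialg.coe_dualBasisBasis]
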